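/- Let $n\ge 3$ and $\lambda,\Lambda>0$. Write $B_\rho=\{x\in\mathbb R^n:|x|<\rho\}$ for the Euclidean ball. Let $\mathcal M_{\lambda,\Lambda}$ be the class of Riemannian metrics $g=(g_{ij})$ on $B_1$ with $g_{ij}(0)=\delta_{ij}$, $|g_{ij}(x)-g_{ij}(y)|\le\Lambda|x-y|$ for all $x,y\in B_1$ and all $i,j$, and $\lambda|\xi|^2\le g_{ij}(x)\xi^i\xi^j\le\lambda^{-1}|\xi|^2$ for all $x\in B_1$, $\xi\in\mathbb R^n$. For $g\in\mathcal M_{\lambda,\Lambda}$ and $\varepsilon>0$, a solution of $$-\Delta_g u=\varepsilon^{-2}(1-|u|^2)u\quad\text{on }(B_1,g)$$ means a function $u\in C^1(B_1;\mathbb C)$ satisfying the equation weakly, i.e. $\int_{B_1}\big(\langle\nabla u,\nabla\zeta\rangle+\varepsilon^{-2}(|u|^2-1)\,u\cdot\zeta\big)\,d\mathrm{vol}_g=0$ for all $\zeta\in C^1_c(B_1;\mathbb C)$. Here $\langle\nabla u,\nabla\zeta\rangle=g^{ij}\,\partial_iu\cdot\partial_j\zeta$ (with $\cdot$ the real inner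 product on $\mathbb C$), $|\nabla u|^2=\langle\nabla u,\nabla u\rangle$ and $d\mathrm{vol}_g=\sqrt{\det g}\,dx$. Put $e_\varepsilon(u)=\frac{|\nabla u|^2}{2}+\frac{(1-|u|^2)^2}{4\varepsilon^2}$, $r(x)=|x|$ and $\nabla_ru=\langle\nabla r,\nabla u\rangle=g^{ij}\,\partial_ir\,\partial_ju$. Let $H^{n-1}$ be the $(n-1)$-dimensional Hausdorff measure. (a) There are constants $\chi,C>0$ depending only on $n,\lambda,\Lambda$ such that for all $g\in\mathcal M_{\lambda,\Lambda}$, all $\varepsilon>0$ and every solution $u$, the function $\rho\mapsto e^{\chi\rho}\rho^{2-n}\int_{B_\rho}e_\varepsilon(u)\,d\mathrm{vol}_g$ is nondecreasing on $(0,1)$, and for every $\rho\in(0,1)$ the following derivatives exist and satisfy $$\frac{\partial}{\partial\rho}\Big(e^{\chi\rho}\rho^{2-n}\!\int_{B_\rho}\!e_\varepsilon(u)\,d\mathrm{vol}_g\Big)\ge\frac1{1+C\rho}\Big[e^{\chi\rho}\rho^{1-n}\!\int_{B_\rho}\!\frac{(1-|u|^2)^2}{2\varepsilon^2}\,d\mathrm{vol}_g+e^{\chi\rho}\rho^{2-n}\!\int_{\partial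 B_\rho}\!|\nabla_ru|^2\sqrt{\det g}\,dH^{n-1}\Big],$$ $$\frac{\partial}{\partial\rho}\Big(e^{\chi\rho}\rho^{2-n}\!\int_{B_\rho}\!\Big[\frac{|\nabla u|^2}2+\Big(1+\frac{2}{(1+C)(n-2)}\Big)\frac{(1-|u|^2)^2}{4\varepsilon^2}\Big]d\mathrm{vol}_g\Big)\ge\frac{1}{1+C}\,e^{\chi\rho}\rho^{2-n}\!\int_{\partial B_\rho}\!\Big[\frac1{n-2}\frac{(1-|u|^2)^2}{2\varepsilon^2}+|\nabla_ru|^2\Big]\sqrt{\det g}\,dH^{n-1}.$$ (b) There are constants $\chi',C>0$ and $\rho_0\in(0,1]$ with $C\rho_0<1$, depending only on $n,\lambda,\Lambda$, such that for all $g\in\mathcal M_{\lambda,\Lambda}$, all $\varepsilon>0$, every solution $u$ and every $\rho\in(0,\rho_0)$ the following derivative exists and satisfies $$\frac{\partial}{\partial\rho}\Big(e^{-\chi'\rho}\rho^{2-n}\!\int_{B_\rho}\!e_\varepsilon(u)\,d\mathrm{vol}_g\Big)\le\frac1{1-C\rho}\Big[e^{-\chi'\rho}\rho^{1-n}\!\int_{B_\rho}\!\frac{(1-|u|^2)^2}{2\varepsilon^2}\,d\mathrm{vol}_g+e^{-\chi'\rho}\rho^{2-n}\!\int_{\partial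 B_\rho}\!|\nabla_ru|^2\sqrt{\det g}\,dH^{n-1}\Big].$$ -/

import Mathlib

open MeasureTheory Metric

noncomputable section

namespace GinzburgLandau

/-- The model space `ℝⁿ` with its Euclidean norm. -/
abbrev Rn (n : ℕ) : Type := EuclideanSpace ℝ (Fin n)

/-- The class of Lipschitz metrics `g = (g_ij)` on the open unit ball `B_1 ⊆ ℝⁿ` with
`g_ij(0) = δ_ij`, Lipschitz seminorm of every component at most `Lam`, and
`lam |ξ|² ≤ g_ij(x) ξ^i ξ^j ≤ lam⁻¹ |ξ|²` on `B_1`. Only the values of `g` on `B_1` matter. -/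
structure IsLipschitzMetric {n : ℕ} (lam Lam : ℝ) (g : Rn n → Matrix (Fin n) (Fin n) ℝ) :
    Prop where
  symm : ∀ x ∈ ball (0 : Rn n) 1, (g x).IsSymm
  normalized : g 0 = 1
  lipschitz : ∀ i j, ∀ x ∈ ball (0 : Rn n) 1, ∀ y ∈ ball (0 : Rn n) 1,
    |g x i j - g y i j| ≤ Lam * ‖x - y‖
  lower : ∀ x ∈ ball (0 : Rn n) 1, ∀ ξ : Rn n, lam * ‖ξ‖ ^ 2 ≤ ∑ i, ∑ j, g x i j * ξ i * ξ j
  upper : ∀ x ∈ ball (0 : Rn n) 1, ∀ ξ : Rn n, ∑ i, ∑ j, g x i j * ξ i * ξ j ≤ lam⁻¹ * ‖ξ‖ ^ 2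

/-- The partial derivative `∂_i u (x)` of a complex-valued function. -/
def partialDeriv {n : ℕ} (u : Rn n → ℂ) (i : Fin n) (x : Rn n) : ℂ :=
  fderiv ℝ u x (EuclideanSpace.single i 1)

/-- The pairing `⟨∇u, ∇v⟩ = g^{ij} ∂_i u · ∂_j v` at `x`, where `·` is the real inner product of
`ℂ = ℝ²` and `(g^{ij})` is the inverse matrix of `(g_ij)`. -/
def gradPairing {n : ℕ} (g : Rn n → Matrix (Fin n) (Fin n) ℝ) (u v : Rn n → ℂ) (x : Rn n) : ℝ :=
  ∑ i, ∑ j, (g x)⁻¹ i j * inner ℝ (partialDeriv u i x) (partialDeriv v j x)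

/-- `|∇u|²` with respect to `g`. -/
def gradSq {n : ℕ} (g : Rn n → Matrix (Fin n) (Fin n) ℝ) (u : Rn n → ℂ) (x : Rn n) : ℝ :=
  gradPairing g u u x

/-- The derivative of `u` in the direction of the `g`-gradient of `r(x) = |x|`:
`∇_r u = ⟨∇r, ∇u⟩ = g^{ij} ∂_i r ∂_j u`, with `∂_i r = x_i / |x|`. -/
def radialDeriv {n : ℕ} (g : Rn n → Matrix (Fin n) (Fin n) ℝ) (u : Rn n → ℂ) (x : Rn n) : ℂ :=
  ∑ i, ∑ j, ((g x)⁻¹ i j * (x i / ‖x‖)) • partialDeriv u j x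

/-- The potential term `(1 - |u|²)² / (4 ε²)`. -/
def potential {n : ℕ} (ε : ℝ) (u : Rn n → ℂ) (x : Rn n) : ℝ :=
  (1 - ‖u x‖ ^ 2) ^ 2 / (4 * ε ^ 2)

/-- The Ginzburg-Landau energy density `e_ε(u) = |∇u|² / 2 + (1 - |u|²)² / (4 ε²)`. -/
def energyDensity {n : ℕ} (ε : ℝ) (g : Rn n → Matrix (Fin n) (Fin n) ℝ) (u : Rn n → ℂ)
    (x : Rn n) : ℝ :=
  gradSq g u x / 2 + potential ε u x

/-- `∫_{B_ρ} f dvol_g`, where `B_ρ` is the Euclidean ball centred at `0` and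
`dvol_g = √(det g) dx`. -/
def ballIntegral {n : ℕ} (g : Rn n → Matrix (Fin n) (Fin n) ℝ) (ρ : ℝ) (f : Rn n → ℝ) : ℝ :=
  ∫ x in ball (0 : Rn n) ρ, f x * Real.sqrt (g x).det

/-- `∫_{∂B_ρ} f √(det g) dH^{n-1}`, with `H^{n-1}` the `(n-1)`-dimensional Hausdorff measure
(in its usual normalization, for which it is Lebesgue measure on `ℝ^{n-1}`). -/
def sphereIntegral {n : ℕ} (g : Rn n → Matrix (Fin n) (Fin n) ℝ) (ρ : ℝ) (f : Rn n → ℝ) : ℝ :=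
  ∫ x in sphere (0 : Rn n) ρ, f x * Real.sqrt (g x).det ∂(μHE[n - 1] : Measure (Rn n))

/-- `u` solves `-Δ_g u = ε⁻² (1 - |u|²) u` on `(B_1, g)`: it is `C¹` on `B_1` and satisfies the
equation weakly, `∫ (⟨∇u, ∇ζ⟩ + ε⁻² (|u|² - 1) u · ζ) dvol_g = 0` for all `ζ ∈ C¹_c(B_1; ℂ)`.
(The components of `g` are merely Lipschitz, so solutions need not be `C²`.) -/
structure IsSolution {n : ℕ} (ε : ℝ) (g : Rn n → Matrix (Fin n) (Fin n) ℝ) (u : Rn n → ℂ) :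
    Prop where
  contDiffOn : ContDiffOn ℝ 1 u (ball (0 : Rn n) 1)
  weak : ∀ ζ : Rn n → ℂ, ContDiff ℝ 1 ζ → HasCompactSupport ζ → tsupport ζ ⊆ ball (0 : Rn n) 1 →
    ballIntegral g 1
      (fun x => gradPairing g u ζ x + (‖u x‖ ^ 2 - 1) / ε ^ 2 * inner ℝ (u x) (ζ x)) = 0

/-- `e^{χρ} ρ^{2-n} ∫_{B_ρ} e_ε(u) dvol_g`. -/
def scaledEnergy {n : ℕ} (χ ε : ℝ) (g : Rn n → Matrix (Fin n) (Fin n) ℝ) (u : Rn n → ℂ)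
    (ρ : ℝ) : ℝ :=
  Real.exp (χ * ρ) * ρ ^ (2 - (n : ℤ)) * ballIntegral g ρ (energyDensity ε g u)

/-- `e^{χρ} ρ^{2-n} ∫_{B_ρ} |∇u|²/2 + (1 + 2/((1+C)(n-2))) (1-|u|²)²/(4ε²) dvol_g`. -/
def modifiedScaledEnergy {n : ℕ} (χ C ε : ℝ) (g : Rn n → Matrix (Fin n) (Fin n) ℝ)
    (u : Rn n → ℂ) (ρ : ℝ) : ℝ :=
  Real.exp (χ * ρ) * ρ ^ (2 - (n : ℤ)) *
    ballIntegral g ρ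
      (fun x => gradSq g u x / 2 + (1 + 2 / ((1 + C) * ((n : ℝ) - 2))) * potential ε u x)

end GinzburgLandau

end

noncomputable section

namespace GinzburgLandau

open scoped Pointwise ENNReal NNReal RealInnerProductSpace Topology

variable {n : ℕ}

/-! ### The Hausdorff measure of the sphere -/

/-! In the flat case everything follows from the Pohozaev identity: stationarity of the energy under
the radial field x gives (n-2) ∫_{B_ρ} e + 2 ∫_{B_ρ} V + ρ ∫_{∂B_ρ} |∂_r u|² = ρ ∫_{∂B_ρ} e, with V
the potential. The two terms in e combine into the derivative of ρ^{2-n} ∫_{B_ρ} e. For a Lipschitz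
metric with g(0) = I the identity survives as two inequalities with relative errors of order ρ, and
the exponential factors absorb these errors.

Since u is only C¹ and g only Lipschitz, x·∇u is not an admissible test function and the
coefficients cannot be differentiated. Finite differences avoid both problems. With φ_h(x) = x + h
θ(|x|²) x, the function u∘φ_h - u is an admissible test function. Convexity of the gradient term and
semiconvexity of the potential turn the weak equation into E(u∘φ_h) ≥ E(u) - C h². Changing
variables in E(u), dividing by h and letting h → 0 gives the one-sided inequality
`integral_variationBound_nonneg`, in which the oscillation of the coefficients enters only through
an error proportional to |θ|. Using θ and -θ yields both Pohozaev inequalities, and letting θ tend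
to the indicator of B_ρ (`sphInt_div_le_of_forall_cutoff`) localises them to the ball (`pohozaev`).

The derivatives exist because, in polar coordinates, a ball integral is the integral of a continuous
function of the radius. For this function to be the Hausdorff integral over the sphere, H^{n-1} on
the unit sphere must be the polar coordinate measure. That is `polarMeasure_eq_hausdorff`, proved by
comparing small caps with their gnomonic projections to tangent planes.

The constants depend only on n, λ, Λ because all values of all metrics in the class lie in one
compact convex set of positive definite matrices, on which inverse and determinant are smooth. -/

theorem euclideanHausdorffMeasure_image_le {X Y : Type*} [EMetricSpace X] [EMetricSpace Y]
    [MeasurableSpace X] [BorelSpace X] [MeasurableSpace Y] [BorelSpace Y] {K : ℝ≥0} {f : X → Y}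
    {s : Set X} (h : LipschitzOnWith K f s) (d : ℕ) :
    (μHE[d] : Measure Y) (f '' s) ≤ (K : ℝ≥0∞) ^ d * (μHE[d] : Measure X) s := by
  simp only [Measure.euclideanHausdorffMeasure_def, Measure.smul_apply, ENNReal.smul_def,
    smul_eq_mul]
  have := h.hausdorffMeasure_image_le (d := d) (by positivity)
  rw [ENNReal.rpow_natCast] at this
  calc _ ≤ _ := mul_le_mul_right this _
    _ = _ := by ring

/-- The gnomonic projection onto the affine hyperplane tangent to the sphere at `v`. -/
def gnomonic (v a : Rn n) : Rn n := (⟪v, a⟫)⁻¹ • a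

/-- The truncated cone over a subset of the sphere, cut off at height one in direction `v`. -/
def gnomonicCone (v : Rn n) (A : Set (Rn n)) : Set (Rn n) :=
  {y | 0 < ⟪v, y⟫ ∧ ⟪v, y⟫ < 1 ∧ ‖y‖⁻¹ • y ∈ A}

theorem gnomonicCone_inter_hyperplane {v : Rn n} (hv : ‖v‖ = 1) {A : Set (Rn n)}
    (hA : A ⊆ sphere 0 1) (hpos : ∀ a ∈ A, 0 < ⟪v, a⟫) {x : ℝ} (hx : x ∈ Set.Ioo (0 : ℝ) 1) :
    gnomonicCone v A ∩ (AffineSubspace.mk' (x • v +ᵥ (0 : Rn n)) (Submodule.span ℝ {v})ᗮ) =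
      x • (gnomonic v '' A) := by
  have hvv : ⟪v, v⟫ = 1 := by rw [real_inner_self_eq_norm_sq, hv]; norm_num
  have hmem : ∀ y : Rn n, y ∈ (AffineSubspace.mk' (x • v +ᵥ (0 : Rn n)) (Submodule.span ℝ {v})ᗮ)
      ↔ ⟪v, y⟫ = x := by
    intro y
    rw [AffineSubspace.mem_mk', Submodule.mem_orthogonal_singleton_iff_inner_right]
    simp only [vadd_eq_add, add_zero, vsub_eq_sub, inner_sub_right, inner_smul_right, hvv]
    constructor <;> intro h <;> linarith
  ext y
  simp only [Set.mem_inter_iff, SetLike.mem_coe, hmem, Set.mem_smul_set, Set.mem_image,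
    exists_exists_and_eq_and]
  constructor
  · rintro ⟨⟨h0, -, hyA⟩, hyx⟩
    refine ⟨_, hyA, ?_⟩
    have hy : ‖y‖ ≠ 0 := by
      intro h
      rw [norm_eq_zero] at h
      simp [h] at h0
    have hx0 : x ≠ 0 := hx.1.ne'
    rw [gnomonic, inner_smul_right, hyx, smul_smul, smul_smul]
    convert one_smul ℝ y
    field_simp
  · rintro ⟨a, ha, rfl⟩
    have h1 := hpos a ha
    have ha1 : ‖a‖ = 1 := by simpa using hA ha
    have h2 : ⟪v, x • gnomonic v a⟫ = x := by
      rw [gnomonic, inner_smul_right, inner_smul_right, inv_mul_cancel₀ h1.ne', mul_one]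
    refine ⟨⟨by rw [h2]; exact hx.1, by rw [h2]; exact hx.2, ?_⟩, h2⟩
    rw [gnomonic, smul_smul x, norm_smul, ha1, mul_one, Real.norm_of_nonneg
      (mul_nonneg hx.1.le (inv_nonneg.2 h1.le)), smul_smul, inv_mul_cancel₀, one_smul]
    · exact ha
    · exact mul_ne_zero hx.1.ne' (inv_ne_zero h1.ne')

/-- Cavalieri's principle: the slice at height x is the projected set scaled by x, hence has measure
x^(n-1) times that of the projection, and ∫₀¹ x^(n-1) dx = 1/n. This is the link between Lebesgue
measure on cones and Hausdorff measure. -/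
theorem volume_gnomonicCone (hn : n ≠ 0) {v : Rn n} (hv : ‖v‖ = 1) {A : Set (Rn n)}
    (hAm : MeasurableSet A) (hA : A ⊆ sphere 0 1) (hpos : ∀ a ∈ A, 0 < ⟪v, a⟫) :
    n * volume (gnomonicCone v A) = (μHE[n - 1] : Measure (Rn n)) (gnomonic v '' A) := by
  have hm : MeasurableSet (gnomonicCone v A) := by
    have h1 : Measurable fun y : Rn n => ⟪v, y⟫ := by fun_prop
    have h2 : Measurable fun y : Rn n => ‖y‖⁻¹ • y := by fun_prop
    exact (measurableSet_lt measurable_const h1).inter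
      ((measurableSet_lt h1 measurable_const).inter (h2 hAm))
  have hv0 : v ≠ 0 := by rintro rfl; simp at hv
  have key := EuclideanGeometry.euclideanHausdorffMeasure_eq_lintegral (0 : Rn n) hv0 hm
  rw [finrank_euclideanSpace_fin, EuclideanSpace.euclideanHausdorffMeasure_eq_volume] at key
  have hslice : ∀ x : ℝ, (μHE[n - 1] : Measure (Rn n)) (gnomonicCone v A ∩
      (AffineSubspace.mk' (x • v +ᵥ (0 : Rn n)) (Submodule.span ℝ {v})ᗮ)) =
      (Set.Ioo (0 : ℝ) 1).indicator (fun x => ENNReal.ofReal (x ^ (n - 1)) *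
        (μHE[n - 1] : Measure (Rn n)) (gnomonic v '' A)) x := by
    intro x
    by_cases hx : x ∈ Set.Ioo (0 : ℝ) 1
    · rw [Set.indicator_of_mem hx, gnomonicCone_inter_hyperplane hv hA hpos hx,
        Measure.euclideanHausdorffMeasure_smul₀ _ hx.1.ne', ENNReal.smul_def, smul_eq_mul]
      congr 1
      rw [ENNReal.ofReal_pow hx.1.le, ENNReal.coe_pow, ← Real.enorm_of_nonneg hx.1.le]
      rfl
    · rw [Set.indicator_of_notMem hx]
      convert measure_empty (μ := (μHE[n - 1] : Measure (Rn n)))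
      refine Set.eq_empty_of_forall_notMem ?_
      rintro y ⟨⟨h0, h1, -⟩, hy⟩
      rw [SetLike.mem_coe, AffineSubspace.mem_mk',
        Submodule.mem_orthogonal_singleton_iff_inner_right] at hy
      simp only [vadd_eq_add, add_zero, vsub_eq_sub, inner_sub_right, inner_smul_right,
        real_inner_self_eq_norm_sq, hv] at hy
      exact hx ⟨by linarith, by linarith⟩
  simp_rw [hslice] at key
  rw [lintegral_indicator measurableSet_Ioo, lintegral_mul_const _ (by fun_prop),
    ← ofReal_integral_eq_lintegral_ofReal, ← integral_Ioc_eq_integral_Ioo,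
    ← intervalIntegral.integral_of_le zero_le_one, integral_pow] at key
  · rw [key]
    have h3 : ((n - 1 : ℕ) : ℝ) + 1 = n := by
      rw [Nat.cast_pred (Nat.pos_of_ne_zero hn)]; ring
    have h4 : ‖v‖ₑ = 1 := by rw [← ofReal_norm, hv, ENNReal.ofReal_one]
    rw [h4, one_mul, h3, Nat.sub_add_cancel (Nat.pos_of_ne_zero hn), ← mul_assoc, one_pow,
      zero_pow hn, sub_zero, ← ENNReal.ofReal_natCast, ← ENNReal.ofReal_mul (by positivity),
      mul_one_div_cancel (by exact_mod_cast hn), ENNReal.ofReal_one, one_mul]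
  · exact (intervalIntegral.intervalIntegrable_pow (n - 1)).1.mono_set Set.Ioo_subset_Ioc_self
  · filter_upwards [ae_restrict_mem measurableSet_Ioo] with x hx
    exact pow_nonneg hx.1.le _

/-- The squared right side is (s - t)² + 2st(1 - ⟪a, b⟫), while the squared left side is 2(1 - ⟪a,
b⟫). It makes the radial projection back to the sphere, the inverse of the gnomonic map,
1-Lipschitz. -/
theorem norm_sub_le_norm_smul_sub_smul {a b : Rn n} (ha : ‖a‖ = 1) (hb : ‖b‖ = 1) {s t : ℝ}
    (hs : 1 ≤ s) (ht : 1 ≤ t) : ‖a - b‖ ≤ ‖s • a - t • b‖ := by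
  rw [← sq_le_sq₀ (norm_nonneg _) (norm_nonneg _), norm_sub_sq_real, norm_sub_sq_real,
    norm_smul, norm_smul, inner_smul_left, inner_smul_right, ha, hb,
    Real.norm_of_nonneg (by linarith), Real.norm_of_nonneg (by linarith)]
  simp only [conj_trivial]
  have h1 : ⟪a, b⟫ ≤ 1 := by
    have := real_inner_le_norm a b
    rwa [ha, hb, one_mul] at this
  nlinarith [sq_nonneg (s - t), mul_nonneg (sub_nonneg.2 h1)
    (show 0 ≤ s * t - 1 by nlinarith)]

/-- What matters is that the constant tends to 1 as δ → 0. A crude bound on the change of the factor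
⟪v, a⟫⁻¹ would only give a constant near 2. -/
theorem lipschitzOnWith_gnomonic {v : Rn n} (hv : ‖v‖ = 1) {δ : ℝ≥0} (hδ : δ < 1) :
    LipschitzOnWith ((1 - δ)⁻¹ ^ 2) (gnomonic v) (sphere 0 1 ∩ closedBall v δ) := by
  have hδ' : (δ : ℝ) < 1 := by exact_mod_cast hδ
  have hco : (((1 - δ)⁻¹ ^ 2 : ℝ≥0) : ℝ) = ((1 - (δ : ℝ))⁻¹) ^ 2 := by
    rw [NNReal.coe_pow, NNReal.coe_inv, NNReal.coe_sub hδ.le, NNReal.coe_one]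
  have hlow : ∀ a : Rn n, a ∈ closedBall v (δ : ℝ) → 1 - (δ : ℝ) ≤ ⟪v, a⟫ := by
    intro a ha
    have h1 : ⟪v, a⟫ = 1 + ⟪v, a - v⟫ := by
      rw [inner_sub_right, real_inner_self_eq_norm_sq, hv]; ring
    have h2 := abs_real_inner_le_norm v (a - v)
    rw [hv, one_mul] at h2
    rw [mem_closedBall, dist_eq_norm] at ha
    linarith [(abs_le.1 h2).1]
  refine LipschitzOnWith.of_dist_le_mul fun a ha b hb => ?_
  rw [hco, dist_eq_norm, dist_eq_norm]
  have ha1 : ‖a‖ = 1 := by simpa using ha.1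
  have hb1 : ‖b‖ = 1 := by simpa using hb.1
  have hav := hlow a ha.2
  have hbv := hlow b hb.2
  have ha2 := ha.2
  have hb2 := hb.2
  rw [mem_closedBall, dist_eq_norm] at ha2 hb2
  set κ : ℝ := 1 - (δ : ℝ) with hκ
  have hκ0 : 0 < κ := by linarith
  have hsa : 0 < ⟪v, a⟫ := by linarith
  have hsb : 0 < ⟪v, b⟫ := by linarith
  -- Chords of the sphere are orthogonal to their midpoints. Hence v may be replaced by v - (a +
  -- b)/2, of norm at most δ, when it is paired with a - b; this gains the factor δ in `hdiff`.
  have hperp : ⟪a + b, a - b⟫ = 0 := by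
    rw [inner_add_left, inner_sub_right, inner_sub_right, real_inner_self_eq_norm_sq,
      real_inner_self_eq_norm_sq, ha1, hb1, real_inner_comm]; ring
  have hdiff : |⟪v, b⟫ - ⟪v, a⟫| ≤ (δ : ℝ) * ‖a - b‖ := by
    have h1 : ⟪v, b⟫ - ⟪v, a⟫ = ⟪(1 / 2 : ℝ) • ((a - v) + (b - v)), a - b⟫ := by
      have : (1 / 2 : ℝ) • ((a - v) + (b - v)) = (1 / 2 : ℝ) • (a + b) - v := by
        module
      rw [this, inner_sub_left, inner_smul_left, hperp, inner_sub_right]; simp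
    rw [h1]
    refine (abs_real_inner_le_norm _ _).trans ?_
    gcongr
    rw [norm_smul]
    have := norm_add_le (a - v) (b - v)
    norm_num
    linarith
  have hdec : gnomonic v a - gnomonic v b =
      (⟪v, a⟫)⁻¹ • (a - b) + ((⟪v, b⟫ - ⟪v, a⟫) * ((⟪v, a⟫)⁻¹ * (⟪v, b⟫)⁻¹)) • b := by
    have : (⟪v, b⟫ - ⟪v, a⟫) * ((⟪v, a⟫)⁻¹ * (⟪v, b⟫)⁻¹) = (⟪v, a⟫)⁻¹ - (⟪v, b⟫)⁻¹ := by
      field_simp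
    rw [this, gnomonic, gnomonic]
    module
  have hia : (⟪v, a⟫)⁻¹ ≤ κ⁻¹ := inv_anti₀ hκ0 hav
  have hib : (⟪v, b⟫)⁻¹ ≤ κ⁻¹ := inv_anti₀ hκ0 hbv
  rw [hdec]
  refine (norm_add_le _ _).trans ?_
  rw [norm_smul, norm_smul, norm_mul, norm_mul, hb1, mul_one,
    Real.norm_of_nonneg (inv_nonneg.2 hsa.le), Real.norm_of_nonneg (inv_nonneg.2 hsb.le),
    Real.norm_eq_abs]
  calc _ ≤ κ⁻¹ * ‖a - b‖ + ((δ : ℝ) * ‖a - b‖) * (κ⁻¹ * κ⁻¹) := by gcongr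
    _ = κ⁻¹ ^ 2 * ‖a - b‖ := by
      have : (δ : ℝ) = 1 - κ := by rw [hκ]; ring
      rw [this]; field_simp; ring

theorem inner_pos_of_mem_closedBall {v : Rn n} (hv : ‖v‖ = 1) {δ : ℝ} {a : Rn n}
    (ha : a ∈ closedBall v δ) : 1 - δ ≤ ⟪v, a⟫ := by
  have h1 : ⟪v, a⟫ = 1 + ⟪v, a - v⟫ := by
    rw [inner_sub_right, real_inner_self_eq_norm_sq, hv]; ring
  have h2 := abs_real_inner_le_norm v (a - v)
  rw [hv, one_mul] at h2
  rw [mem_closedBall, dist_eq_norm] at ha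
  linarith [(abs_le.1 h2).1]

theorem inner_le_one_of_mem_sphere {v : Rn n} (hv : ‖v‖ = 1) {a : Rn n}
    (ha : ‖a‖ = 1) : ⟪v, a⟫ ≤ 1 := by
  simpa [hv, ha] using real_inner_le_norm v a

theorem cone_subset_gnomonicCone {v : Rn n} (hv : ‖v‖ = 1) {A : Set (Rn n)}
    (hA : A ⊆ sphere 0 1) (hpos : ∀ a ∈ A, 0 < ⟪v, a⟫) :
    Set.Ioo (0 : ℝ) 1 • A ⊆ gnomonicCone v A := by
  rintro _ ⟨t, ht, a, ha, rfl⟩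
  have ha1 : ‖a‖ = 1 := by simpa using hA ha
  have h1 := inner_le_one_of_mem_sphere hv ha1
  have h0 := hpos a ha
  refine ⟨?_, ?_, ?_⟩
  · simp only [inner_smul_right]; exact mul_pos ht.1 h0
  · simp only [inner_smul_right]; nlinarith [ht.1, ht.2]
  · simp only [norm_smul, ha1, mul_one, Real.norm_of_nonneg ht.1.le, smul_smul]
    rwa [inv_mul_cancel₀ ht.1.ne', one_smul]

theorem gnomonicCone_subset_smul_cone {v : Rn n} {A : Set (Rn n)} {κ : ℝ} (hκ : 0 < κ)
    (hlow : ∀ a ∈ A, κ ≤ ⟪v, a⟫) :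
    gnomonicCone v A ⊆ κ⁻¹ • (Set.Ioo (0 : ℝ) 1 • A) := by
  rintro y ⟨h0, h1, hyA⟩
  have hy : 0 < ‖y‖ := by
    rw [norm_pos_iff]; rintro rfl; simp at h0
  have h2 := hlow _ hyA
  rw [inner_smul_right] at h2
  refine ⟨κ • y, ⟨κ * ‖y‖, ⟨by positivity, ?_⟩, _, hyA, ?_⟩, ?_⟩
  · have : κ * ‖y‖ ≤ ⟪v, y⟫ := by
      calc κ * ‖y‖ ≤ (‖y‖⁻¹ * ⟪v, y⟫) * ‖y‖ := by gcongr
        _ = ⟪v, y⟫ := by field_simp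
    linarith
  · simp only [smul_smul]; congr 1; field_simp
  · simp only [smul_smul]; rw [inv_mul_cancel₀ hκ.ne', one_smul]

/-- The measure on the unit sphere given by polar coordinates, as a measure on the whole space. -/
def polarMeasure (n : ℕ) : Measure (Rn n) :=
  (volume : Measure (Rn n)).toSphere.map Subtype.val

theorem polarMeasure_apply {A : Set (Rn n)} (hA : A ⊆ sphere 0 1) (hAm : MeasurableSet A) :
    polarMeasure n A = n * volume (Set.Ioo (0 : ℝ) 1 • A) := by
  rw [polarMeasure, Measure.map_apply measurable_subtype_coe hAm,
    Measure.toSphere_apply' _ (measurable_subtype_coe hAm), finrank_euclideanSpace_fin,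
    Subtype.image_preimage_coe, Set.inter_eq_self_of_subset_right hA]

/-- The cone over A with apex 0 and radius one lies below the tangent plane at v, so its volume is
at most that of the gnomonic cone; the projection of A is then controlled by the Lipschitz constant.
-/
theorem polarMeasure_le_of_subset_closedBall (hn : n ≠ 0) {v : Rn n} (hv : ‖v‖ = 1) {δ : ℝ≥0}
    (hδ : δ < 1) {A : Set (Rn n)} (hA : A ⊆ sphere 0 1) (hAv : A ⊆ closedBall v δ)
    (hAm : MeasurableSet A) :
    polarMeasure n A ≤ (((1 - δ)⁻¹ : ℝ≥0) : ℝ≥0∞) ^ (2 * n) * (μHE[n - 1] : Measure (Rn n)) A := by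
  have hδ' : (δ : ℝ) < 1 := by exact_mod_cast hδ
  have hlow : ∀ a ∈ A, 1 - (δ : ℝ) ≤ ⟪v, a⟫ := fun a ha =>
    inner_pos_of_mem_closedBall hv (hAv ha)
  have hpos : ∀ a ∈ A, 0 < ⟪v, a⟫ := fun a ha => by linarith [hlow a ha]
  rw [polarMeasure_apply hA hAm]
  calc n * volume (Set.Ioo (0 : ℝ) 1 • A) ≤ n * volume (gnomonicCone v A) := by
        gcongr; exact cone_subset_gnomonicCone hv hA hpos
    _ = (μHE[n - 1] : Measure (Rn n)) (gnomonic v '' A) := volume_gnomonicCone hn hv hAm hA hpos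
    _ ≤ (((1 - δ)⁻¹ ^ 2 : ℝ≥0) : ℝ≥0∞) ^ (n - 1) * (μHE[n - 1] : Measure (Rn n)) A :=
        euclideanHausdorffMeasure_image_le
          ((lipschitzOnWith_gnomonic hv hδ).mono (Set.subset_inter hA hAv)) _
    _ ≤ _ := by
      rw [ENNReal.coe_pow, ← pow_mul]
      refine mul_le_mul_left (pow_le_pow_right₀ ?_ (by omega)) _
      rw [ENNReal.one_le_coe_iff]
      refine (one_le_inv₀ (tsub_pos_of_lt hδ)).2 tsub_le_self

/-- Here A is the 1-Lipschitz radial image of its gnomonic projection, and the gnomonic cone fits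
into the cone over A enlarged by (1 - δ)⁻¹. -/
theorem hausdorff_le_of_subset_closedBall (hn : n ≠ 0) {v : Rn n} (hv : ‖v‖ = 1) {δ : ℝ≥0}
    (hδ : δ < 1) {A : Set (Rn n)} (hA : A ⊆ sphere 0 1) (hAv : A ⊆ closedBall v δ)
    (hAm : MeasurableSet A) :
    (μHE[n - 1] : Measure (Rn n)) A ≤ (((1 - δ)⁻¹ : ℝ≥0) : ℝ≥0∞) ^ (2 * n) * polarMeasure n A := by
  have hδ' : (δ : ℝ) < 1 := by exact_mod_cast hδ
  have hlow : ∀ a ∈ A, 1 - (δ : ℝ) ≤ ⟪v, a⟫ := fun a ha =>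
    inner_pos_of_mem_closedBall hv (hAv ha)
  have hpos : ∀ a ∈ A, 0 < ⟪v, a⟫ := fun a ha => by linarith [hlow a ha]
  have himg : A = (fun y : Rn n => ‖y‖⁻¹ • y) '' (gnomonic v '' A) := by
    rw [Set.image_image]
    symm
    convert Set.image_id A using 1
    refine Set.image_congr fun a ha => ?_
    have ha1 : ‖a‖ = 1 := by simpa using hA ha
    have := hpos a ha
    rw [gnomonic, norm_smul, ha1, mul_one, Real.norm_of_nonneg (inv_nonneg.2 this.le), inv_inv,
      smul_smul, mul_inv_cancel₀ this.ne', one_smul, id]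
  have hlip : LipschitzOnWith 1 (fun y : Rn n => ‖y‖⁻¹ • y) (gnomonic v '' A) := by
    refine LipschitzOnWith.of_dist_le_mul ?_
    rintro _ ⟨a, ha, rfl⟩ _ ⟨b, hb, rfl⟩
    have ha1 : ‖a‖ = 1 := by simpa using hA ha
    have hb1 : ‖b‖ = 1 := by simpa using hA hb
    have h1 := hpos a ha
    have h2 := hpos b hb
    rw [NNReal.coe_one, one_mul, dist_eq_norm, dist_eq_norm]
    simp only [gnomonic, norm_smul, ha1, hb1, mul_one, Real.norm_of_nonneg (inv_nonneg.2 h1.le),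
      Real.norm_of_nonneg (inv_nonneg.2 h2.le), inv_inv, smul_smul, mul_inv_cancel₀ h1.ne',
      mul_inv_cancel₀ h2.ne', one_smul]
    exact norm_sub_le_norm_smul_sub_smul ha1 hb1
      ((one_le_inv₀ h1).2 (inner_le_one_of_mem_sphere hv ha1))
      ((one_le_inv₀ h2).2 (inner_le_one_of_mem_sphere hv hb1))
  calc (μHE[n - 1] : Measure (Rn n)) A
      ≤ ((1 : ℝ≥0) : ℝ≥0∞) ^ (n - 1) * (μHE[n - 1] : Measure (Rn n)) (gnomonic v '' A) := by
        conv_lhs => rw [himg]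
        exact euclideanHausdorffMeasure_image_le hlip _
    _ = n * volume (gnomonicCone v A) := by
        rw [volume_gnomonicCone hn hv hAm hA hpos]; simp
    _ ≤ n * volume ((1 - (δ : ℝ))⁻¹ • (Set.Ioo (0 : ℝ) 1 • A)) := by
        gcongr; exact gnomonicCone_subset_smul_cone (by linarith) hlow
    _ = (((1 - δ)⁻¹ : ℝ≥0) : ℝ≥0∞) ^ n * polarMeasure n A := by
        rw [polarMeasure_apply hA hAm, Measure.addHaar_smul, finrank_euclideanSpace_fin]
        have h0 : 0 ≤ (1 - (δ : ℝ))⁻¹ := inv_nonneg.2 (by linarith)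
        have : ENNReal.ofReal |(1 - (δ : ℝ))⁻¹ ^ n| = (((1 - δ)⁻¹ : ℝ≥0) : ℝ≥0∞) ^ n := by
          rw [abs_of_nonneg (by positivity), ENNReal.ofReal_pow h0]
          congr 1
          rw [← ENNReal.ofReal_coe_nnreal, NNReal.coe_inv, NNReal.coe_sub hδ.le, NNReal.coe_one]
        rw [this]; ring
    _ ≤ _ := by
      gcongr
      · rw [ENNReal.one_le_coe_iff]
        exact (one_le_inv₀ (tsub_pos_of_lt hδ)).2 tsub_le_self
      · omega

/-- An inequality between two measures on sets of small diameter in the unit sphere holds for all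
measurable subsets of the sphere. -/
theorem measure_le_of_subset_closedBall {μ ν : Measure (Rn n)} {c : ℝ≥0∞} {δ : ℝ≥0} (hδ : 0 < δ)
    (h : ∀ v : Rn n, ‖v‖ = 1 → ∀ A ⊆ sphere (0 : Rn n) 1, A ⊆ closedBall v δ → MeasurableSet A →
      μ A ≤ c * ν A) {A : Set (Rn n)} (hA : A ⊆ sphere 0 1) (hAm : MeasurableSet A) :
    μ A ≤ c * ν A := by
  rcases A.eq_empty_or_nonempty with rfl | ⟨a₀, ha₀⟩
  · simp
  have : Nonempty (sphere (0 : Rn n) 1) := ⟨⟨a₀, hA ha₀⟩⟩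
  let p : ℕ → sphere (0 : Rn n) 1 := TopologicalSpace.denseSeq _
  let B : ℕ → Set (Rn n) := disjointed fun k => closedBall (p k : Rn n) δ
  have hBm : ∀ k, MeasurableSet (B k) := fun k =>
    MeasurableSet.disjointed (fun _ => measurableSet_closedBall) k
  have hdisj : Pairwise (Function.onFun Disjoint fun k => A ∩ B k) := fun i j hij =>
    ((disjoint_disjointed _ hij).mono Set.inter_subset_right Set.inter_subset_right)
  have hU : A = ⋃ k, A ∩ B k := by
    rw [← Set.inter_iUnion, iUnion_disjointed, eq_comm, Set.inter_eq_left]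
    intro a ha
    obtain ⟨k, hk⟩ := (TopologicalSpace.denseRange_denseSeq (sphere (0 : Rn n) 1)).exists_dist_lt
      (⟨a, hA ha⟩ : sphere (0 : Rn n) 1) (show (0 : ℝ) < δ by exact_mod_cast hδ)
    exact Set.mem_iUnion.2 ⟨k, hk.le⟩
  have hm : ∀ k, MeasurableSet (A ∩ B k) := fun k => hAm.inter (hBm k)
  rw [hU, measure_iUnion hdisj hm, measure_iUnion hdisj hm, ← ENNReal.tsum_mul_left]
  refine ENNReal.tsum_le_tsum fun k => h (p k) (by simp) _
    (Set.inter_subset_left.trans hA) (Set.inter_subset_right.trans (disjointed_subset _ k)) (hm k)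

theorem le_of_forall_le_inv_pow_mul {a b : ℝ≥0∞} {m : ℕ} (hb : b ≠ ∞)
    (h : ∀ δ : ℝ≥0, 0 < δ → δ < 1 → a ≤ (((1 - δ)⁻¹ : ℝ≥0) : ℝ≥0∞) ^ m * b) : a ≤ b := by
  have h1 : Filter.Tendsto (fun δ : ℝ≥0 => (((1 - δ)⁻¹ : ℝ≥0) : ℝ≥0∞) ^ m * b) (𝓝[>] 0)
      (𝓝 (((1 : ℝ≥0) : ℝ≥0∞) ^ m * b)) := by
    refine ENNReal.Tendsto.mul_const ?_ (Or.inr hb)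
    refine ENNReal.Tendsto.pow (ENNReal.tendsto_coe.2 ?_)
    have h2 : Filter.Tendsto (fun δ : ℝ≥0 => (1 - δ)⁻¹) (𝓝 0) (𝓝 ((1 - 0)⁻¹)) := by
      refine Filter.Tendsto.inv₀ ?_ (by simp)
      exact (continuous_const.sub continuous_id).tendsto 0
    rw [tsub_zero, inv_one] at h2
    exact h2.mono_left nhdsWithin_le_nhds
  rw [ENNReal.coe_one, one_pow, one_mul] at h1
  refine ge_of_tendsto h1 ?_
  filter_upwards [Ioo_mem_nhdsGT (show (0 : ℝ≥0) < 1 by norm_num)] with δ hδ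
  exact h δ hδ.1 hδ.2

theorem polarMeasure_eq_hausdorff (hn : n ≠ 0) :
    polarMeasure n = (μHE[n - 1] : Measure (Rn n)).restrict (sphere 0 1) := by
  have : IsFiniteMeasure (polarMeasure n) := by unfold polarMeasure; infer_instance
  have key : ∀ A ⊆ sphere (0 : Rn n) 1, MeasurableSet A →
      (μHE[n - 1] : Measure (Rn n)) A = polarMeasure n A := by
    intro A hA hAm
    have h1 : (μHE[n - 1] : Measure (Rn n)) A ≤ polarMeasure n A := by
      refine le_of_forall_le_inv_pow_mul (m := 2 * n) (measure_ne_top _ _) fun δ h0 hδ => ?_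
      exact measure_le_of_subset_closedBall h0 (fun v hv B hB hBv hBm =>
        hausdorff_le_of_subset_closedBall hn hv hδ hB hBv hBm) hA hAm
    refine le_antisymm h1 ?_
    -- The limit δ → 0 needs a finite right side. Finiteness of the Hausdorff measure is not known
    -- beforehand; it comes from the inequality `h1` just proved.
    refine le_of_forall_le_inv_pow_mul (m := 2 * n) (ne_top_of_le_ne_top (measure_ne_top _ _) h1)
      fun δ h0 hδ => ?_
    exact measure_le_of_subset_closedBall h0 (fun v hv B hB hBv hBm =>
        polarMeasure_le_of_subset_closedBall hn hv hδ hB hBv hBm) hA hAm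
  ext A hAm
  rw [Measure.restrict_apply hAm, key _ Set.inter_subset_right (hAm.inter isClosed_sphere.measurableSet),
    polarMeasure, Measure.map_apply measurable_subtype_coe hAm,
    Measure.map_apply measurable_subtype_coe (hAm.inter isClosed_sphere.measurableSet)]
  congr 1
  ext x
  simp

/-! ### Polar coordinates and derivatives of ball integrals -/

/-- The integral over the sphere `∂B_s` with respect to the Hausdorff measure. -/
def sphInt (f : Rn n → ℝ) (s : ℝ) : ℝ :=
  ∫ x in sphere (0 : Rn n) s, f x ∂(μHE[n - 1] : Measure (Rn n))

theorem hausdorff_restrict_sphere {s : ℝ} (hs : 0 < s) :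
    (μHE[n - 1] : Measure (Rn n)).restrict (sphere 0 s) = ENNReal.ofReal (s ^ (n - 1)) •
      ((μHE[n - 1] : Measure (Rn n)).restrict (sphere 0 1)).map (fun x => s • x) := by
  have hme : MeasurableEmbedding (fun x : Rn n => s • x) :=
    (Homeomorph.smulOfNeZero s hs.ne').measurableEmbedding
  ext A hA
  rw [Measure.smul_apply, hme.map_apply, Measure.restrict_apply hA,
    Measure.restrict_apply (hme.measurable hA)]
  have h1 : A ∩ sphere (0 : Rn n) s = s • ((fun x : Rn n => s • x) ⁻¹' A ∩ sphere 0 1) := by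
    ext x
    rw [Set.mem_smul_set_iff_inv_smul_mem₀ hs.ne']
    simp only [Set.mem_inter_iff, mem_sphere_iff_norm, sub_zero, Set.mem_preimage, smul_smul,
      mul_inv_cancel₀ hs.ne', one_smul, norm_smul, norm_inv, Real.norm_of_nonneg hs.le]
    rw [inv_mul_eq_one₀ hs.ne', eq_comm (a := s)]
  rw [h1, Measure.euclideanHausdorffMeasure_smul₀ _ hs.ne', ENNReal.smul_def, smul_eq_mul,
    smul_eq_mul, ENNReal.ofReal_pow hs.le, ENNReal.coe_pow, ← Real.enorm_of_nonneg hs.le]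
  rfl

theorem sphInt_eq (hn : n ≠ 0) (f : Rn n → ℝ) {s : ℝ} (hs : 0 < s) :
    sphInt f s = s ^ (n - 1) *
      ∫ ω : sphere (0 : Rn n) 1, f (s • (ω : Rn n)) ∂(volume : Measure (Rn n)).toSphere := by
  have hme : MeasurableEmbedding (fun x : Rn n => s • x) :=
    (Homeomorph.smulOfNeZero s hs.ne').measurableEmbedding
  rw [sphInt, hausdorff_restrict_sphere hs, integral_smul_measure, hme.integral_map,
    ← polarMeasure_eq_hausdorff hn, polarMeasure,
    (MeasurableEmbedding.subtype_coe isClosed_sphere.measurableSet).integral_map,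
    ENNReal.toReal_ofReal (by positivity), smul_eq_mul]

/-- Fubini on the product of the unit sphere and (0, ∞) with density r^(n-1); the origin is a null
set. The scaling of Hausdorff measure turns each inner integral into an integral over ∂B_s. -/
theorem integrableOn_sphInt_and_integral_eq (hn : n ≠ 0) {F : Rn n → ℝ} (hF : Integrable F) :
    IntegrableOn (sphInt F) (Set.Ioi 0) ∧ ∫ x, F x = ∫ s in Set.Ioi 0, sphInt F s := by
  have : Nontrivial (Rn n) := Module.nontrivial_of_finrank_pos (R := ℝ)
    (by rw [finrank_euclideanSpace_fin]; exact Nat.pos_of_ne_zero hn)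
  set σ := (volume : Measure (Rn n)).toSphere with hσ
  set ν := Measure.volumeIoiPow (n - 1) with hν
  have hmp := (volume : Measure (Rn n)).measurePreserving_homeomorphUnitSphereProd
  rw [finrank_euclideanSpace_fin, ← hσ, ← hν] at hmp
  have hemb := (homeomorphUnitSphereProd (Rn n)).measurableEmbedding
  let H : sphere (0 : Rn n) 1 × Set.Ioi (0 : ℝ) → ℝ := fun p => F ((p.2 : ℝ) • (p.1 : Rn n))
  have hcomp : ∀ x : ({0}ᶜ : Set (Rn n)), H (homeomorphUnitSphereProd (Rn n) x) = F x := by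
    intro x
    simp only [H]
    rw [← homeomorphUnitSphereProd_symm_apply_coe, Homeomorph.symm_apply_apply]
  have hint : Integrable H (σ.prod ν) := by
    rw [← hmp.integrable_comp_emb hemb]
    have : H ∘ homeomorphUnitSphereProd (Rn n) = F ∘ Subtype.val := funext hcomp
    rw [this, ← integrableOn_iff_comap_subtypeVal (measurableSet_singleton _).compl]
    exact hF.integrableOn
  have hI : ∫ x, F x = ∫ p, H p ∂(σ.prod ν) := by
    rw [← hmp.integral_comp hemb]
    simp_rw [hcomp]
    rw [integral_subtype_comap (measurableSet_singleton _).compl F, restrict_compl_singleton]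
  have hpow : ∀ r : Set.Ioi (0 : ℝ), ENNReal.ofReal ((r : ℝ) ^ (n - 1)) < ∞ := fun _ =>
    ENNReal.ofReal_lt_top
  have hmeas : Measurable fun r : Set.Ioi (0 : ℝ) => ENNReal.ofReal ((r : ℝ) ^ (n - 1)) := by
    fun_prop
  have hsm : ∀ r : Set.Ioi (0 : ℝ), (ENNReal.ofReal ((r : ℝ) ^ (n - 1))).toReal •
      (∫ ω, H (ω, r) ∂σ) = sphInt F r := by
    intro r
    rw [sphInt_eq hn F r.2, ENNReal.toReal_ofReal (pow_nonneg (le_of_lt r.2) _), smul_eq_mul]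
  constructor
  · have h1 := hint.integral_prod_right
    rw [hν, Measure.volumeIoiPow, integrable_withDensity_iff_integrable_smul' hmeas
      (Filter.Eventually.of_forall hpow)] at h1
    simp_rw [hsm] at h1
    rw [integrableOn_iff_comap_subtypeVal measurableSet_Ioi]
    exact h1
  · rw [hI, integral_prod_symm _ hint, hν, Measure.volumeIoiPow,
      integral_withDensity_eq_integral_toReal_smul hmeas (Filter.Eventually.of_forall hpow)]
    simp_rw [hsm]
    rw [integral_subtype_comap measurableSet_Ioi (sphInt F)]

theorem integrableOn_ball_of_continuousOn {f : Rn n → ℝ} (hf : ContinuousOn f (ball 0 1)) {ρ : ℝ}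
    (hρ : ρ < 1) : IntegrableOn f (ball 0 ρ) :=
  ((hf.mono (closedBall_subset_ball hρ)).integrableOn_compact
    (isCompact_closedBall _ _)).mono_set ball_subset_closedBall

theorem sphInt_indicator_ball (f : Rn n → ℝ) (ρ s : ℝ) :
    sphInt ((ball 0 ρ).indicator f) s = (Set.Iio ρ).indicator (sphInt f) s := by
  by_cases hs : s < ρ
  · rw [Set.indicator_of_mem (Set.mem_Iio.2 hs), sphInt, sphInt]
    refine setIntegral_congr_fun isClosed_sphere.measurableSet fun x hx => ?_
    rw [Set.indicator_of_mem]
    simpa using (by simpa using hx : ‖x‖ = s) ▸ hs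
  · rw [Set.indicator_of_notMem (by simpa using hs), sphInt]
    refine setIntegral_eq_zero_of_forall_eq_zero fun x hx => ?_
    rw [Set.indicator_of_notMem]
    have : ‖x‖ = s := by simpa using hx
    simpa [this] using hs

theorem intervalIntegrable_sphInt (hn : n ≠ 0) {f : Rn n → ℝ} {ρ : ℝ} (h0 : 0 ≤ ρ)
    (hf : IntegrableOn f (ball 0 ρ)) : IntervalIntegrable (sphInt f) volume 0 ρ := by
  have h1 := (integrableOn_sphInt_and_integral_eq hn
    ((integrable_indicator_iff measurableSet_ball).2 hf)).1
  rw [intervalIntegrable_iff_integrableOn_Ioo_of_le h0]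
  refine (h1.mono_set Set.Ioo_subset_Ioi_self).congr_fun (fun s hs => ?_) measurableSet_Ioo
  rw [sphInt_indicator_ball, Set.indicator_of_mem (Set.mem_Iio.2 hs.2)]

theorem integral_ball_eq_integral_sphInt (hn : n ≠ 0) {f : Rn n → ℝ} {ρ : ℝ} (h0 : 0 ≤ ρ)
    (hf : IntegrableOn f (ball 0 ρ)) : ∫ x in ball 0 ρ, f x = ∫ s in 0..ρ, sphInt f s := by
  have h1 := (integrableOn_sphInt_and_integral_eq hn
    ((integrable_indicator_iff measurableSet_ball).2 hf)).2
  rw [integral_indicator measurableSet_ball] at h1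
  simp_rw [sphInt_indicator_ball] at h1
  rw [h1, setIntegral_indicator measurableSet_Iio, Set.Ioi_inter_Iio,
    intervalIntegral.integral_of_le h0, integral_Ioc_eq_integral_Ioo]

/-- Rescaling moves all the spheres to the fixed compact unit sphere, where only the integrand
depends on s. -/
theorem continuousOn_sphInt (hn : n ≠ 0) {f : Rn n → ℝ} (hf : ContinuousOn f (ball 0 1)) :
    ContinuousOn (sphInt f) (Set.Ioo 0 1) := by
  have h1 : ContinuousOn (fun s : ℝ => s ^ (n - 1) *
      ∫ ω : sphere (0 : Rn n) 1, f (s • (ω : Rn n)) ∂(volume : Measure (Rn n)).toSphere)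
      (Set.Ioo 0 1) := by
    refine (continuousOn_id.pow _).mul ?_
    have h2 := continuousOn_integral_of_compact_support
      (μ := (volume : Measure (Rn n)).toSphere) (s := Set.Ioo (0 : ℝ) 1)
      (f := fun s (ω : sphere (0 : Rn n) 1) => f (s • (ω : Rn n))) isCompact_univ ?_ ?_
    · exact h2
    · refine hf.comp (by fun_prop) ?_
      rintro ⟨s, ω⟩ ⟨hs, -⟩
      have : ‖(ω : Rn n)‖ = 1 := by simp
      simp [norm_smul, this, abs_of_pos hs.1, hs.2]
    · intro p x _ hx; exact absurd (Set.mem_univ x) hx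
  exact h1.congr fun s hs => sphInt_eq hn f hs.1

theorem hasDerivAt_integral_ball (hn : n ≠ 0) {f : Rn n → ℝ} (hf : ContinuousOn f (ball 0 1))
    {ρ : ℝ} (hρ : ρ ∈ Set.Ioo (0 : ℝ) 1) :
    HasDerivAt (fun ρ => ∫ x in ball 0 ρ, f x) (sphInt f ρ) ρ := by
  have hc := continuousOn_sphInt hn hf
  have h1 : HasDerivAt (fun r => ∫ s in 0..r, sphInt f s) (sphInt f ρ) ρ := by
    refine intervalIntegral.integral_hasDerivAt_right
      (intervalIntegrable_sphInt hn hρ.1.le (integrableOn_ball_of_continuousOn hf hρ.2)) ?_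
      (hc.continuousAt (Ioo_mem_nhds hρ.1 hρ.2))
    exact hc.stronglyMeasurableAtFilter isOpen_Ioo _ hρ
  refine h1.congr_of_eventuallyEq ?_
  filter_upwards [Ioo_mem_nhds hρ.1 hρ.2] with r hr
  exact integral_ball_eq_integral_sphInt hn hr.1.le (integrableOn_ball_of_continuousOn hf hr.2)

theorem sphInt_radial_mul (φ : ℝ → ℝ) (f : Rn n → ℝ) (s : ℝ) :
    sphInt (fun x => φ ‖x‖ * f x) s = φ s * sphInt f s := by
  rw [sphInt, sphInt, ← integral_const_mul]
  refine setIntegral_congr_fun isClosed_sphere.measurableSet fun x hx => ?_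
  rw [show ‖x‖ = s by simpa using hx]

/-! ### Radial cutoffs tending to the indicator of a ball -/

/-- Smooth cutoffs of the interval `(-∞, ρ²)`, with transition region of width `1 / k`. -/
def cutoff (ρ : ℝ) (k : ℕ) (t : ℝ) : ℝ := Real.smoothTransition (k * (ρ ^ 2 - t))

theorem contDiff_cutoff (ρ : ℝ) (k : ℕ) : ContDiff ℝ 1 (cutoff ρ k) := by
  have : ContDiff ℝ 1 Real.smoothTransition := Real.smoothTransition.contDiff (n := 1)
  exact this.comp (by fun_prop)

theorem cutoff_of_le {ρ t : ℝ} {k : ℕ} (h : ρ ^ 2 ≤ t) : cutoff ρ k t = 0 :=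
  Real.smoothTransition.zero_of_nonpos
    (mul_nonpos_of_nonneg_of_nonpos (Nat.cast_nonneg _) (by linarith))

theorem antitone_cutoff (ρ : ℝ) (k : ℕ) : Antitone (cutoff ρ k) := by
  intro s t h
  refine Real.smoothTransition.monotone ?_
  gcongr

theorem deriv_cutoff_eq_zero {ρ t : ℝ} {k : ℕ} (h : 1 < k * (ρ ^ 2 - t)) :
    deriv (cutoff ρ k) t = 0 := by
  have h1 : ∀ᶠ s in 𝓝 t, 1 < k * (ρ ^ 2 - s) :=
    ContinuousAt.eventually_lt continuousAt_const (by fun_prop) h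
  have h2 : cutoff ρ k =ᶠ[𝓝 t] fun _ => 1 := by
    filter_upwards [h1] with s hs
    exact Real.smoothTransition.one_of_one_le hs.le
  rw [h2.deriv_eq, deriv_const]

theorem tendsto_integral_cutoff_mul {F : Rn n → ℝ} {ρ : ℝ} (hF : IntegrableOn F (ball 0 ρ)) :
    Filter.Tendsto (fun k : ℕ => ∫ x in ball 0 ρ, cutoff ρ k (‖x‖ ^ 2) * F x) Filter.atTop
      (𝓝 (∫ x in ball 0 ρ, F x)) := by
  refine tendsto_integral_of_dominated_convergence (fun x => ‖F x‖) (fun k => ?_) hF.norm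
    (fun k => ?_) ?_
  · have : Continuous fun x : Rn n => cutoff ρ k (‖x‖ ^ 2) :=
      (contDiff_cutoff ρ k).continuous.comp (by fun_prop)
    exact this.aestronglyMeasurable.mul hF.aestronglyMeasurable
  · refine Filter.Eventually.of_forall fun x => ?_
    rw [norm_mul]
    refine mul_le_of_le_one_left (norm_nonneg _) ?_
    rw [cutoff, Real.norm_of_nonneg (Real.smoothTransition.nonneg _)]
    exact Real.smoothTransition.le_one _
  · filter_upwards [ae_restrict_mem measurableSet_ball] with x hx
    have hx' : 0 < ρ ^ 2 - ‖x‖ ^ 2 := by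
      rw [mem_ball_zero_iff] at hx
      nlinarith [norm_nonneg x]
    have h1 : Filter.Tendsto (fun k : ℕ => (k : ℝ) * (ρ ^ 2 - ‖x‖ ^ 2)) Filter.atTop
        Filter.atTop := tendsto_natCast_atTop_atTop.atTop_mul_const hx'
    refine tendsto_const_nhds.congr' ?_
    filter_upwards [h1.eventually_ge_atTop 1] with k hk
    rw [cutoff, Real.smoothTransition.one_of_one_le hk, one_mul]

/-- Letting radial cutoffs increase to the indicator function of `B_ρ`. -/
theorem sphInt_div_le_of_forall_cutoff (hn : n ≠ 0) {F f : Rn n → ℝ} {ρ : ℝ}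
    (hρ : ρ ∈ Set.Ioo (0 : ℝ) 1) (hF : ContinuousOn F (ball 0 1)) (hf : ContinuousOn f (ball 0 1))
    (h : ∀ θ : ℝ → ℝ, ContDiff ℝ 1 θ → (∀ t, 0 ≤ θ t) → (∀ t, ρ ^ 2 ≤ t → θ t = 0) →
      0 ≤ ∫ x in ball (0 : Rn n) ρ, (θ (‖x‖ ^ 2) * F x + 2 * deriv θ (‖x‖ ^ 2) * f x)) :
    sphInt f ρ / ρ ≤ ∫ x in ball 0 ρ, F x := by
  obtain ⟨hρ0, hρ1⟩ := hρ
  have hFi := integrableOn_ball_of_continuousOn hF hρ1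
  refine le_of_forall_pos_le_add fun ε hε => ?_
  -- The factor 1/s appears because 2θ'(s²) = (1/s) · d/ds θ(s²), and -d/ds θ(s²) is the density
  -- that concentrates at s = ρ.
  have hcJ : ContinuousAt (fun s => sphInt f s / s) ρ :=
    ((continuousOn_sphInt hn hf).continuousAt (Ioo_mem_nhds hρ0 hρ1)).div continuousAt_id hρ0.ne'
  obtain ⟨η, hη, hηJ⟩ := Metric.continuousAt_iff.1 hcJ ε hε
  -- For s ≤ ρ - min η ρ one has ρ² - s² ≥ ρ · min η ρ. Thus for such k the cutoff is constant
  -- there, and its transition takes place within distance η of ρ.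
  have hev : ∀ᶠ k : ℕ in Filter.atTop, 1 < (k : ℝ) * (ρ * min η ρ) := by
    have h1 : 0 < ρ * min η ρ := mul_pos hρ0 (lt_min hη hρ0)
    exact (tendsto_natCast_atTop_atTop.atTop_mul_const h1).eventually_gt_atTop 1
  have hbound : ∀ᶠ k : ℕ in Filter.atTop,
      sphInt f ρ / ρ - ε ≤ ∫ x in ball 0 ρ, cutoff ρ k (‖x‖ ^ 2) * F x := by
    filter_upwards [hev] with k hk
    set θ := cutoff ρ k with hθ
    have hθc := contDiff_cutoff ρ k
    have hθ'c : Continuous (deriv θ) := hθc.continuous_deriv_one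
    have hθ' : ∀ t, deriv θ t ≤ 0 := fun t => (antitone_cutoff ρ k).deriv_nonpos
    have hp := h θ hθc (fun t => Real.smoothTransition.nonneg _) fun t ht => cutoff_of_le ht
    have hc1 : ContinuousOn (fun x : Rn n => θ (‖x‖ ^ 2) * F x) (ball 0 1) :=
      (hθc.continuous.comp (by fun_prop)).continuousOn.mul hF
    have hc2 : ContinuousOn (fun x : Rn n => 2 * deriv θ (‖x‖ ^ 2) * f x) (ball 0 1) :=
      (continuous_const.mul (hθ'c.comp (by fun_prop))).continuousOn.mul hf
    have hi2 := integrableOn_ball_of_continuousOn hc2 hρ1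
    rw [integral_add (integrableOn_ball_of_continuousOn hc1 hρ1) hi2,
      integral_ball_eq_integral_sphInt hn hρ0.le hi2] at hp
    have hrad : ∀ s, sphInt (fun x : Rn n => 2 * deriv θ (‖x‖ ^ 2) * f x) s =
        2 * deriv θ (s ^ 2) * sphInt f s := fun s =>
      sphInt_radial_mul (fun s => 2 * deriv θ (s ^ 2)) f s
    have hii := intervalIntegrable_sphInt hn hρ0.le hi2
    simp_rw [hrad] at hp
    have hii' : IntervalIntegrable (fun s => 2 * deriv θ (s ^ 2) * sphInt f s) volume 0 ρ := by
      refine hii.congr fun s _ => hrad s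
    have hder : ∀ s ∈ Set.uIcc 0 ρ, HasDerivAt (fun s => θ (s ^ 2)) (deriv θ (s ^ 2) * (2 * s)) s := by
      intro s _
      have h1 := (hθc.differentiable one_ne_zero (s ^ 2)).hasDerivAt
      have h2 := hasDerivAt_pow 2 s
      simpa [Function.comp_def] using HasDerivAt.comp (h₂ := θ) (h := fun s : ℝ => s ^ 2) s h1 h2
    have hcont : Continuous fun s => deriv θ (s ^ 2) * (2 * s) :=
      (hθ'c.comp (by fun_prop)).mul (by fun_prop)
    -- The weight d/ds θ(s²) is nonpositive and has total integral -1 on (0, ρ), since θ(0) = 1 and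
    -- θ(ρ²) = 0.
    have hftc := intervalIntegral.integral_eq_sub_of_hasDerivAt hder (hcont.intervalIntegrable 0 ρ)
    have hθ0 : θ (0 ^ 2) = 1 := by
      refine Real.smoothTransition.one_of_one_le ?_
      have : ρ * min η ρ ≤ ρ * ρ := by gcongr; exact min_le_right _ _
      have h2 : (k : ℝ) * (ρ * min η ρ) ≤ k * (ρ * ρ) := by gcongr
      nlinarith
    rw [hθ0, hθ, cutoff_of_le le_rfl, zero_sub, ← hθ] at hftc
    have hmono : ∫ s in 0..ρ, 2 * deriv θ (s ^ 2) * sphInt f s ≤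
        ∫ s in 0..ρ, (sphInt f ρ / ρ - ε) * (deriv θ (s ^ 2) * (2 * s)) := by
      refine intervalIntegral.integral_mono_on_of_le_Ioo hρ0.le hii'
        ((hcont.intervalIntegrable 0 ρ).const_mul _) fun s hs => ?_
      by_cases hs2 : ρ - min η ρ < s
      · have h1 : dist s ρ < η := by
          rw [Real.dist_eq, abs_lt]
          constructor <;> linarith [min_le_left η ρ, hs.2]
        have h2 := hηJ h1
        rw [Real.dist_eq, abs_lt] at h2
        have h3 : 2 * deriv θ (s ^ 2) * sphInt f s =
            (sphInt f s / s) * (deriv θ (s ^ 2) * (2 * s)) := by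
          field_simp [hs.1.ne']
        rw [h3]
        refine mul_le_mul_of_nonpos_right (by linarith) ?_
        exact mul_nonpos_of_nonpos_of_nonneg (hθ' _) (by linarith [hs.1])
      · have h1 : deriv θ (s ^ 2) = 0 := by
          refine deriv_cutoff_eq_zero (hk.trans_le ?_)
          gcongr
          nlinarith [hs.1, hs.2, min_le_right η ρ, lt_min hη hρ0]
        rw [h1]; simp
    rw [intervalIntegral.integral_const_mul, hftc] at hmono
    linarith
  have := ge_of_tendsto (tendsto_integral_cutoff_mul hFi) hbound
  linarith

/-! ### Quadratic forms in complex gradients -/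

/-- The bilinear form `a^{ij} P_i · Q_j` in complex vectors. -/
def qform (a : Matrix (Fin n) (Fin n) ℝ) (P Q : Fin n → ℂ) : ℝ :=
  ∑ i, ∑ j, a i j * inner ℝ (P i) (Q j)

/-- The Euclidean gradient of a complex-valued function. -/
def grad (u : Rn n → ℂ) (x : Rn n) : Fin n → ℂ := fun i => partialDeriv u i x

theorem qform_comm {a : Matrix (Fin n) (Fin n) ℝ} (ha : a.IsSymm) (P Q : Fin n → ℂ) :
    qform a P Q = qform a Q P := by
  unfold qform
  rw [Finset.sum_comm]
  refine Finset.sum_congr rfl fun i _ => Finset.sum_congr rfl fun j _ => ?_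
  rw [real_inner_comm, ha.apply]

theorem qform_add_right (a : Matrix (Fin n) (Fin n) ℝ) (P Q R : Fin n → ℂ) :
    qform a P (Q + R) = qform a P Q + qform a P R := by
  simp only [qform, Pi.add_apply, inner_add_right, mul_add, Finset.sum_add_distrib]

theorem qform_smul_right (a : Matrix (Fin n) (Fin n) ℝ) (c : ℝ) (P Q : Fin n → ℂ) :
    qform a P (c • Q) = c * qform a P Q := by
  simp only [qform, Pi.smul_apply, inner_smul_right, Finset.mul_sum, mul_left_comm]

theorem qform_add_left (a : Matrix (Fin n) (Fin n) ℝ) (P Q R : Fin n → ℂ) :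
    qform a (P + Q) R = qform a P R + qform a Q R := by
  simp only [qform, Pi.add_apply, inner_add_left, mul_add, Finset.sum_add_distrib]

theorem qform_smul_left (a : Matrix (Fin n) (Fin n) ℝ) (c : ℝ) (P Q : Fin n → ℂ) :
    qform a (c • P) Q = c * qform a P Q := by
  simp only [qform, Pi.smul_apply, real_inner_smul_left, Finset.mul_sum, mul_left_comm]

theorem qform_smul_add_self {a : Matrix (Fin n) (Fin n) ℝ} (ha : a.IsSymm) (c d : ℝ)
    (P Q : Fin n → ℂ) : qform a (c • P + d • Q) (c • P + d • Q) =
      c ^ 2 * qform a P P + 2 * (c * d) * qform a Q P + d ^ 2 * qform a Q Q := by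
  simp only [qform_add_left, qform_add_right, qform_smul_left, qform_smul_right,
    qform_comm ha P Q]
  ring

theorem qform_smul_matrix (c : ℝ) (a : Matrix (Fin n) (Fin n) ℝ) (P Q : Fin n → ℂ) :
    qform (c • a) P Q = c * qform a P Q := by
  simp only [qform, Matrix.smul_apply, smul_eq_mul, Finset.mul_sum, mul_assoc]

theorem abs_qform_sub_le {a b : Matrix (Fin n) (Fin n) ℝ} {M : ℝ}
    (h : ∀ i j, |a i j - b i j| ≤ M) (P Q : Fin n → ℂ) :
    |qform a P Q - qform b P Q| ≤ M * ((∑ i, ‖P i‖) * ∑ i, ‖Q i‖) := by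
  have h1 : qform a P Q - qform b P Q = ∑ i, ∑ j, (a i j - b i j) * inner ℝ (P i) (Q j) := by
    simp only [qform, sub_mul, Finset.sum_sub_distrib]
  rw [h1, Finset.sum_mul_sum, Finset.mul_sum]
  refine (Finset.abs_sum_le_sum_abs _ _).trans (Finset.sum_le_sum fun i _ => ?_)
  rw [Finset.mul_sum]
  refine (Finset.abs_sum_le_sum_abs _ _).trans (Finset.sum_le_sum fun j _ => ?_)
  rw [abs_mul]
  have : 0 ≤ M := (abs_nonneg _).trans (h i j)
  gcongr
  · exact h i j
  · exact abs_real_inner_le_norm _ _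

theorem continuousOn_qform {X : Type*} [TopologicalSpace X] {s : Set X}
    {a : X → Matrix (Fin n) (Fin n) ℝ} {P Q : X → Fin n → ℂ}
    (ha : ∀ i j, ContinuousOn (fun x => a x i j) s) (hP : ContinuousOn P s)
    (hQ : ContinuousOn Q s) : ContinuousOn (fun x => qform (a x) (P x) (Q x)) s := by
  unfold qform
  refine continuousOn_finsetSum _ fun i _ => continuousOn_finsetSum _ fun j _ => ?_
  exact (ha i j).mul (((continuous_apply i).comp_continuousOn hP).inner
    ((continuous_apply j).comp_continuousOn hQ))

/-- The Ginzburg-Landau potential as a function of the value. -/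
def potentialAt (ε : ℝ) (z : ℂ) : ℝ := (1 - ‖z‖ ^ 2) ^ 2 / (4 * ε ^ 2)

theorem potentialAt_nonneg (ε : ℝ) (z : ℂ) : 0 ≤ potentialAt ε z := by
  unfold potentialAt; positivity

theorem continuous_potentialAt (ε : ℝ) : Continuous (potentialAt ε) := by
  unfold potentialAt; fun_prop

/-- The potential is semiconvex. -/
theorem potentialAt_sub_ge {ε : ℝ} (hε : 0 < ε) (z y : ℂ) :
    (‖z‖ ^ 2 - 1) / ε ^ 2 * ⟪z, y - z⟫ - ‖y - z‖ ^ 2 / (2 * ε ^ 2) ≤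
      potentialAt ε y - potentialAt ε z := by
  have h1 : ‖y‖ ^ 2 = ‖z‖ ^ 2 + 2 * ⟪z, y - z⟫ + ‖y - z‖ ^ 2 := by
    rw [← norm_add_sq_real, add_sub_cancel]
  unfold potentialAt
  rw [h1]
  set s := ‖z‖ ^ 2
  set b := ⟪z, y - z⟫
  set c := ‖y - z‖ ^ 2
  have hs : 0 ≤ s := by positivity
  have hc : 0 ≤ c := by positivity
  -- The remainder in the expansion of the potential is an explicit nonnegative expression once
  -- c/(2ε²) has been added; this is the semiconvexity.
  have h2 : (1 - (s + 2 * b + c)) ^ 2 / (4 * ε ^ 2) - (1 - s) ^ 2 / (4 * ε ^ 2) -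
      ((s - 1) / ε ^ 2 * b - c / (2 * ε ^ 2)) = ((2 * b + c) ^ 2 + 2 * s * c) / (4 * ε ^ 2) := by
    field_simp; ring
  have h3 : 0 ≤ ((2 * b + c) ^ 2 + 2 * s * c) / (4 * ε ^ 2) := by positivity
  linarith

/-- The energy density with coefficients `a`, `w`, gradient `P` and value `z`. -/
def densityAt (ε : ℝ) (a : Matrix (Fin n) (Fin n) ℝ) (w : ℝ) (P : Fin n → ℂ) (z : ℂ) : ℝ :=
  qform a P P / 2 + potentialAt ε z * w

/-- Convexity of the quadratic form in the gradient and semiconvexity of the potential in the value.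
With Q - P and y - z the gradient and value of a test function, the first two terms are the
integrand of the weak equation and integrate to zero; only a quadratic error remains. -/
theorem densityAt_sub_ge {ε : ℝ} (hε : 0 < ε) {a : Matrix (Fin n) (Fin n) ℝ} (ha : a.IsSymm)
    (hpos : ∀ P, 0 ≤ qform a P P) {w : ℝ} (hw : 0 ≤ w) (P Q : Fin n → ℂ) (z y : ℂ) :
    qform a P (Q - P) + (‖z‖ ^ 2 - 1) / ε ^ 2 * ⟪z, y - z⟫ * w -
      ‖y - z‖ ^ 2 / (2 * ε ^ 2) * w ≤ densityAt ε a w Q y - densityAt ε a w P z := by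
  have h1 := mul_le_mul_of_nonneg_right (potentialAt_sub_ge hε z y) hw
  have h2 := hpos (Q - P)
  have h3 := qform_smul_add_self ha 1 1 P (Q - P)
  rw [one_smul, one_smul, add_sub_cancel, qform_comm ha (Q - P) P] at h3
  unfold densityAt
  linarith

/-! ### Radial deformations -/

/-- The radial vector field `θ(|x|²) x`. -/
def radialField (θ : ℝ → ℝ) (x : Rn n) : Rn n := θ (‖x‖ ^ 2) • x

/-- The deformation `x + h θ(|x|²) x`. -/
def deformation (θ : ℝ → ℝ) (h : ℝ) (x : Rn n) : Rn n := x + h • radialField θ x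

/-- The derivative of the deformation. -/
def deformationDeriv (θ : ℝ → ℝ) (h : ℝ) (x : Rn n) : Rn n →L[ℝ] Rn n :=
  (1 + h * θ (‖x‖ ^ 2)) • ContinuousLinearMap.id ℝ (Rn n) +
    (2 * h * deriv θ (‖x‖ ^ 2)) • (innerSL ℝ x).smulRight x

theorem contDiff_radialField {θ : ℝ → ℝ} (hθ : ContDiff ℝ 1 θ) :
    ContDiff ℝ 1 (radialField θ : Rn n → Rn n) :=
  (hθ.comp (contDiff_norm_sq ℝ)).smul contDiff_id

theorem contDiff_deformation {θ : ℝ → ℝ} (hθ : ContDiff ℝ 1 θ) (h : ℝ) :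
    ContDiff ℝ 1 (deformation θ h : Rn n → Rn n) :=
  contDiff_id.add ((contDiff_radialField hθ).const_smul h)

theorem hasFDerivAt_deformation {θ : ℝ → ℝ} (hθ : ContDiff ℝ 1 θ) (h : ℝ) (x : Rn n) :
    HasFDerivAt (deformation θ h) (deformationDeriv θ h x) x := by
  have h1 : HasFDerivAt (fun x : Rn n => ‖x‖ ^ 2) (2 • innerSL ℝ x) x :=
    (hasStrictFDerivAt_norm_sq x).hasFDerivAt
  have h2 := ((hθ.differentiable one_ne_zero (‖x‖ ^ 2)).hasDerivAt).comp_hasFDerivAt x h1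
  have h3 := (hasFDerivAt_id x).add ((h2.smul (hasFDerivAt_id x)).const_smul h)
  refine h3.congr_fderiv ?_
  ext y : 1
  simp [deformationDeriv]
  module

/-- The derivative is a multiple α of the identity plus a rank-one map, that is, α times a
transvection, whose determinant is known. -/
theorem det_deformationDeriv (hn : n ≠ 0) (θ : ℝ → ℝ) (h : ℝ) (x : Rn n)
    (h0 : 1 + h * θ (‖x‖ ^ 2) ≠ 0) :
    (deformationDeriv θ h x).det = (1 + h * θ (‖x‖ ^ 2)) ^ (n - 1) *
      (1 + h * θ (‖x‖ ^ 2) + 2 * h * deriv θ (‖x‖ ^ 2) * ‖x‖ ^ 2) := by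
  set α := 1 + h * θ (‖x‖ ^ 2) with hα
  set β := 2 * h * deriv θ (‖x‖ ^ 2) with hβ
  have h1 : ((deformationDeriv θ h x : Rn n →L[ℝ] Rn n) : Rn n →ₗ[ℝ] Rn n) =
      α • LinearMap.transvection ((β / α) • (innerSL ℝ x : Rn n →ₗ[ℝ] ℝ)) x := by
    ext1 y
    simp only [deformationDeriv, LinearMap.transvection, ContinuousLinearMap.coe_coe,
      add_apply, ← hα, ← hβ, smul_apply, LinearMap.smul_apply, ContinuousLinearMap.smulRight_apply, smul_smul]
    simp [smul_smul]
    field_simp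
  rw [ContinuousLinearMap.det, h1, LinearMap.det_smul, LinearMap.transvection.det,
    finrank_euclideanSpace_fin]
  simp only [LinearMap.smul_apply, ContinuousLinearMap.coe_coe, innerSL_apply_apply,
    real_inner_self_eq_norm_sq, smul_eq_mul]
  obtain ⟨m, rfl⟩ := Nat.exists_eq_succ_of_ne_zero hn
  simp only [Nat.succ_eq_add_one, Nat.add_sub_cancel]
  field_simp
  ring

/-- The difference quotient `(det Dφ_h - 1) / h` of the Jacobian of the deformation. -/
def jacobianQuotient (θ : ℝ → ℝ) (h : ℝ) (x : Rn n) : ℝ :=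
  θ (‖x‖ ^ 2) * (∑ k ∈ Finset.range (n - 1), (1 + h * θ (‖x‖ ^ 2)) ^ k) *
      (1 + h * (θ (‖x‖ ^ 2) + 2 * deriv θ (‖x‖ ^ 2) * ‖x‖ ^ 2)) +
    (θ (‖x‖ ^ 2) + 2 * deriv θ (‖x‖ ^ 2) * ‖x‖ ^ 2)

/-- The geometric sum expresses ((1 + hθ)^(n-1) - 1)/h without dividing by h, so the quotient
extends continuously to h = 0. -/
theorem det_deformationDeriv_eq (hn : n ≠ 0) (θ : ℝ → ℝ) (h : ℝ) (x : Rn n)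
    (h0 : 1 + h * θ (‖x‖ ^ 2) ≠ 0) :
    (deformationDeriv θ h x).det = 1 + h * jacobianQuotient θ h x := by
  rw [det_deformationDeriv hn θ h x h0, jacobianQuotient]
  have h1 := mul_geom_sum (1 + h * θ (‖x‖ ^ 2)) (n - 1)
  rw [add_sub_cancel_left] at h1
  linear_combination (-(1 + h * (θ (‖x‖ ^ 2) + 2 * deriv θ (‖x‖ ^ 2) * ‖x‖ ^ 2))) * h1

theorem jacobianQuotient_zero (hn : n ≠ 0) (θ : ℝ → ℝ) (x : Rn n) :
    jacobianQuotient θ 0 x = n * θ (‖x‖ ^ 2) + 2 * deriv θ (‖x‖ ^ 2) * ‖x‖ ^ 2 := by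
  simp [jacobianQuotient, Nat.cast_pred (Nat.pos_of_ne_zero hn)]
  ring

theorem continuous_jacobianQuotient {θ : ℝ → ℝ} (hθ : ContDiff ℝ 1 θ) :
    Continuous fun p : ℝ × Rn n => jacobianQuotient θ p.1 p.2 := by
  have h1 : Continuous fun p : ℝ × Rn n => θ (‖p.2‖ ^ 2) := hθ.continuous.comp (by fun_prop)
  have h2 : Continuous fun p : ℝ × Rn n => deriv θ (‖p.2‖ ^ 2) :=
    hθ.continuous_deriv_one.comp (by fun_prop)
  unfold jacobianQuotient
  fun_prop

theorem deformation_of_le {θ : ℝ → ℝ} {R : ℝ} (hR : 0 ≤ R) (hθ : ∀ t, R ^ 2 ≤ t → θ t = 0) (h : ℝ)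
    {x : Rn n} (hx : R ≤ ‖x‖) : deformation θ h x = x := by
  rw [deformation, radialField, hθ _ (pow_le_pow_left₀ hR hx 2)]; simp

theorem exists_lipschitzWith_radialField {θ : ℝ → ℝ} (hc : ContDiff ℝ 1 θ) {R : ℝ} (hR : 0 ≤ R)
    (hθ : ∀ t, R ^ 2 ≤ t → θ t = 0) :
    ∃ L : ℝ≥0, LipschitzWith L (radialField θ : Rn n → Rn n) := by
  refine ContDiff.lipschitzWith_of_hasCompactSupport (𝕂 := ℝ) (n := 1) ?_
    (contDiff_radialField hc) one_ne_zero
  refine HasCompactSupport.intro (isCompact_closedBall (0 : Rn n) R) fun x hx => ?_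
  have : R ≤ ‖x‖ := by
    rw [mem_closedBall_zero_iff] at hx; exact (not_le.1 hx).le
  rw [radialField, hθ _ (pow_le_pow_left₀ hR this 2), zero_smul]

theorem injective_deformation {θ : ℝ → ℝ} {L : ℝ≥0}
    (hL : LipschitzWith L (radialField θ : Rn n → Rn n)) {h : ℝ} (h0 : 0 ≤ h) (hh : h * L < 1) :
    Function.Injective (deformation θ h : Rn n → Rn n) := by
  intro x y hxy
  have h1 : x - y = h • (radialField θ y - radialField θ x) := by
    simp only [deformation] at hxy
    rw [smul_sub, sub_eq_sub_iff_add_eq_add, hxy, add_comm]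
  have h2 := hL.dist_le_mul y x
  have h3 : ‖x - y‖ ≤ h * (L * ‖x - y‖) := by
    conv_lhs => rw [h1, norm_smul, Real.norm_of_nonneg h0]
    rw [dist_eq_norm, dist_eq_norm, norm_sub_rev y x] at h2
    gcongr
  by_contra hne
  have h4 : 0 < ‖x - y‖ := norm_pos_iff.2 (sub_ne_zero.2 hne)
  nlinarith

/-- A point of the ball sent outside it would share its image with that outside point, which the
deformation fixes; injectivity excludes this. -/
theorem norm_deformation_le {θ : ℝ → ℝ} {R : ℝ} (hR : 0 ≤ R) (hθ : ∀ t, R ^ 2 ≤ t → θ t = 0) {h : ℝ}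
    (hinj : Function.Injective (deformation θ h : Rn n → Rn n)) {x : Rn n} (hx : ‖x‖ ≤ R) :
    ‖deformation θ h x‖ ≤ R := by
  by_contra! hlt
  have h1 := hinj (deformation_of_le hR hθ h hlt.le)
  rw [h1] at hlt
  linarith

/-! ### Inner variations of weak solutions -/

/-- Symmetric nonnegative Lipschitz coefficients `A`, with a nonnegative Lipschitz weight `w`. -/
structure IsCoefficient (K : ℝ) (A : Rn n → Matrix (Fin n) (Fin n) ℝ) (w : Rn n → ℝ) : Prop where
  symm : ∀ x ∈ ball (0 : Rn n) 1, (A x).IsSymm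
  lip : ∀ i j, ∀ x ∈ ball (0 : Rn n) 1, ∀ y ∈ ball (0 : Rn n) 1, |A x i j - A y i j| ≤ K * ‖x - y‖
  lip_weight : ∀ x ∈ ball (0 : Rn n) 1, ∀ y ∈ ball (0 : Rn n) 1, |w x - w y| ≤ K * ‖x - y‖
  nonneg : ∀ x ∈ ball (0 : Rn n) 1, ∀ P, 0 ≤ qform (A x) P P
  weight_nonneg : ∀ x ∈ ball (0 : Rn n) 1, 0 ≤ w x

/-- Weak solutions of the Ginzburg-Landau equation with coefficients `A` and weight `w`. -/
structure IsWeakSolution (ε : ℝ) (A : Rn n → Matrix (Fin n) (Fin n) ℝ) (w : Rn n → ℝ)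
    (u : Rn n → ℂ) : Prop where
  contDiffOn : ContDiffOn ℝ 1 u (ball (0 : Rn n) 1)
  weak : ∀ ζ : Rn n → ℂ, ContDiff ℝ 1 ζ → HasCompactSupport ζ → tsupport ζ ⊆ ball (0 : Rn n) 1 →
    ∫ x in ball (0 : Rn n) 1, (qform (A x) (grad u x) (grad ζ x) +
      (‖u x‖ ^ 2 - 1) / ε ^ 2 * inner ℝ (u x) (ζ x) * w x) = 0

theorem continuousOn_of_abs_sub_le {f : Rn n → ℝ} {s : Set (Rn n)} {K : ℝ}
    (h : ∀ x ∈ s, ∀ y ∈ s, |f x - f y| ≤ K * ‖x - y‖) : ContinuousOn f s := by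
  have h1 : LipschitzOnWith K.toNNReal f s := by
    refine LipschitzOnWith.of_dist_le_mul fun x hx y hy => ?_
    rw [Real.dist_eq, dist_eq_norm]
    refine (h x hx y hy).trans ?_
    gcongr
    exact Real.le_coe_toNNReal K
  exact h1.continuousOn

theorem IsCoefficient.continuousOn {K : ℝ} {A : Rn n → Matrix (Fin n) (Fin n) ℝ} {w : Rn n → ℝ}
    (hA : IsCoefficient K A w) (i j : Fin n) : ContinuousOn (fun x => A x i j) (ball 0 1) :=
  continuousOn_of_abs_sub_le (hA.lip i j)

theorem IsCoefficient.continuousOn_weight {K : ℝ} {A : Rn n → Matrix (Fin n) (Fin n) ℝ}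
    {w : Rn n → ℝ} (hA : IsCoefficient K A w) : ContinuousOn w (ball 0 1) :=
  continuousOn_of_abs_sub_le hA.lip_weight

theorem continuousOn_fderiv_ball {u : Rn n → ℂ} (hu : ContDiffOn ℝ 1 u (ball 0 1)) :
    ContinuousOn (fderiv ℝ u) (ball 0 1) :=
  hu.continuousOn_fderiv_of_isOpen isOpen_ball le_rfl

theorem continuousOn_grad {u : Rn n → ℂ} (hu : ContDiffOn ℝ 1 u (ball 0 1)) :
    ContinuousOn (grad u) (ball 0 1) :=
  continuousOn_pi.2 fun _ => (continuousOn_fderiv_ball hu).clm_apply continuousOn_const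

theorem differentiableAt_of_mem_ball {u : Rn n → ℂ} (hu : ContDiffOn ℝ 1 u (ball 0 1)) {x : Rn n}
    (hx : x ∈ ball (0 : Rn n) 1) : DifferentiableAt ℝ u x :=
  (hu.contDiffAt (isOpen_ball.mem_nhds hx)).differentiableAt one_ne_zero

theorem grad_comp_deformation {u : Rn n → ℂ} {θ : ℝ → ℝ} (hθ : ContDiff ℝ 1 θ) {h : ℝ} {x : Rn n}
    (hu : DifferentiableAt ℝ u (deformation θ h x)) :
    grad (u ∘ deformation θ h) x =
      (1 + h * θ (‖x‖ ^ 2)) • grad u (deformation θ h x) + (2 * h * deriv θ (‖x‖ ^ 2)) •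
        fun i => x i • fderiv ℝ u (deformation θ h x) x := by
  ext1 i
  rw [grad, partialDeriv, (hu.hasFDerivAt.comp x (hasFDerivAt_deformation hθ h x)).fderiv]
  simp [deformationDeriv, grad, partialDeriv, EuclideanSpace.inner_single_right]

theorem grad_sub {u v : Rn n → ℂ} {x : Rn n} (hu : DifferentiableAt ℝ u x)
    (hv : DifferentiableAt ℝ v x) : grad (u - v) x = grad u x - grad v x := by
  ext1 i
  simp [grad, partialDeriv, fderiv_sub hu hv]

theorem deformation_mem_ball {θ : ℝ → ℝ} {R : ℝ} (hR : 0 ≤ R) (hR1 : R < 1)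
    (hθ : ∀ t, R ^ 2 ≤ t → θ t = 0) {h : ℝ}
    (hinj : Function.Injective (deformation θ h : Rn n → Rn n)) {x : Rn n}
    (hx : x ∈ ball (0 : Rn n) 1) : deformation θ h x ∈ ball (0 : Rn n) 1 := by
  rw [mem_ball_zero_iff] at *
  rcases le_total ‖x‖ R with h1 | h1
  · exact (norm_deformation_le hR hθ hinj h1).trans_lt hR1
  · rwa [deformation_of_le hR hθ h h1]

theorem tsupport_comp_deformation_sub_subset (u : Rn n → ℂ) {θ : ℝ → ℝ} {R : ℝ} (hR : 0 ≤ R)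
    (hθ : ∀ t, R ^ 2 ≤ t → θ t = 0) (h : ℝ) :
    tsupport (u ∘ deformation θ h - u) ⊆ closedBall 0 R := by
  refine closure_minimal (fun x hx => ?_) isClosed_closedBall
  by_contra h1
  rw [mem_closedBall_zero_iff, not_le] at h1
  refine hx ?_
  simp [deformation_of_le hR hθ h h1.le]

theorem contDiffOn_comp_deformation {u : Rn n → ℂ} (hu : ContDiffOn ℝ 1 u (ball 0 1)) {θ : ℝ → ℝ}
    (hc : ContDiff ℝ 1 θ) {R : ℝ} (hR : 0 ≤ R) (hR1 : R < 1) (hθ : ∀ t, R ^ 2 ≤ t → θ t = 0) {h : ℝ}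
    (hinj : Function.Injective (deformation θ h : Rn n → Rn n)) :
    ContDiffOn ℝ 1 (u ∘ deformation θ h) (ball 0 1) :=
  hu.comp (contDiff_deformation hc h).contDiffOn fun _ hx =>
    deformation_mem_ball hR hR1 hθ hinj hx

/-- The regularity is global, although nothing is known about u off the unit ball, because the
difference vanishes outside the ball of radius R < 1. -/
theorem contDiff_comp_deformation_sub {u : Rn n → ℂ} (hu : ContDiffOn ℝ 1 u (ball 0 1)) {θ : ℝ → ℝ}
    (hc : ContDiff ℝ 1 θ) {R : ℝ} (hR : 0 ≤ R) (hR1 : R < 1) (hθ : ∀ t, R ^ 2 ≤ t → θ t = 0) {h : ℝ}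
    (hinj : Function.Injective (deformation θ h : Rn n → Rn n)) :
    ContDiff ℝ 1 (u ∘ deformation θ h - u) := by
  rw [contDiff_iff_contDiffAt]
  intro x
  by_cases hx : x ∈ ball (0 : Rn n) 1
  · exact ((contDiffOn_comp_deformation hu hc hR hR1 hθ hinj).sub hu).contDiffAt
      (isOpen_ball.mem_nhds hx)
  · have h1 : x ∉ tsupport (u ∘ deformation θ h - u) := fun h2 =>
      hx (closedBall_subset_ball hR1 (tsupport_comp_deformation_sub_subset u hR hθ h h2))
    exact (contDiffAt_const (c := (0 : ℂ))).congr_of_eventuallyEq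
      (notMem_tsupport_iff_eventuallyEq.1 h1)

/-- The energy of a deformed weak solution is at least its energy, up to a quadratic error. -/
theorem integral_density_comp_deformation_ge {K ε : ℝ} (hε : 0 < ε)
    {A : Rn n → Matrix (Fin n) (Fin n) ℝ} {w : Rn n → ℝ} (hA : IsCoefficient K A w)
    {u : Rn n → ℂ} (hu : IsWeakSolution ε A w u) {θ : ℝ → ℝ} (hc : ContDiff ℝ 1 θ)
    {R : ℝ} (hR : 0 ≤ R) (hR1 : R < 1) (hθ : ∀ t, R ^ 2 ≤ t → θ t = 0) :
    ∃ C : ℝ, ∀ h : ℝ, Function.Injective (deformation θ h : Rn n → Rn n) →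
      (∫ x in closedBall (0 : Rn n) R, densityAt ε (A x) (w x) (grad u x) (u x)) - C * h ^ 2 ≤
      ∫ x in closedBall (0 : Rn n) R,
        densityAt ε (A x) (w x) (grad (u ∘ deformation θ h) x) (u (deformation θ h x)) := by
  have hsub : closedBall (0 : Rn n) R ⊆ ball 0 1 := closedBall_subset_ball hR1
  have hcpt := isCompact_closedBall (0 : Rn n) R
  obtain ⟨Lu, hLu⟩ := (hu.contDiffOn.mono hsub).exists_lipschitzOnWith one_ne_zero
    (convex_closedBall _ _) hcpt
  obtain ⟨X, hX⟩ := hcpt.exists_bound_of_continuousOn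
    (contDiff_radialField (n := n) hc).continuous.continuousOn
  obtain ⟨W, hW⟩ := hcpt.exists_bound_of_continuousOn (hA.continuousOn_weight.mono hsub)
  refine ⟨∫ x in closedBall (0 : Rn n) R, (Lu * X) ^ 2 / (2 * ε ^ 2) * W, fun h hinj => ?_⟩
  set φ := (deformation θ h : Rn n → Rn n) with hφ
  -- The infinitesimal variation θ(|x|²) x·∇u is merely continuous. Its finite difference is C¹ with
  -- compact support, and so can be inserted into the weak equation.
  set ζ := u ∘ φ - u with hζ
  have hmaps : Set.MapsTo φ (closedBall 0 R) (closedBall 0 R) := fun x hx => by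
    rw [mem_closedBall_zero_iff] at *
    exact norm_deformation_le hR hθ hinj hx
  have hv := contDiffOn_comp_deformation hu.contDiffOn hc hR hR1 hθ hinj
  have hζc := contDiff_comp_deformation_sub hu.contDiffOn hc hR hR1 hθ hinj
  have hζs : tsupport ζ ⊆ closedBall 0 R :=
    tsupport_comp_deformation_sub_subset u hR hθ h
  have hweak := hu.weak ζ hζc (hcpt.of_isClosed_subset (isClosed_tsupport _) hζs)
    (hζs.trans hsub)
  rw [setIntegral_eq_of_subset_of_forall_sdiff_eq_zero measurableSet_ball hsub] at hweak
  swap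
  · rintro x ⟨-, hx⟩
    have h1 : x ∉ tsupport ζ := fun h => hx (hζs h)
    have h2 : ζ x = 0 := image_eq_zero_of_notMem_tsupport h1
    have h3 : fderiv ℝ ζ x = 0 := by
      by_contra h4
      exact h1 (support_fderiv_subset ℝ h4)
    have h5 : grad ζ x = 0 := by
      ext1 i; simp [grad, partialDeriv, h3]
    rw [h2, h5]; simp [qform]
  have hAc : ∀ i j, ContinuousOn (fun x => A x i j) (closedBall 0 R) := fun i j =>
    (hA.continuousOn i j).mono hsub
  have hwc := hA.continuousOn_weight.mono hsub
  have huc := hu.contDiffOn.continuousOn.mono hsub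
  have hvc : ContinuousOn (fun x => u (φ x)) (closedBall 0 R) := hv.continuousOn.mono hsub
  have hgu := (continuousOn_grad hu.contDiffOn).mono hsub
  have hgv := (continuousOn_grad hv).mono hsub
  have hgζ : ContinuousOn (grad ζ) (closedBall 0 R) :=
    (continuousOn_grad hζc.contDiffOn).mono hsub
  have hi0 : IntegrableOn (fun x => qform (A x) (grad u x) (grad ζ x) +
      (‖u x‖ ^ 2 - 1) / ε ^ 2 * inner ℝ (u x) (ζ x) * w x) (closedBall 0 R) := by
    refine ContinuousOn.integrableOn_compact hcpt ?_
    refine (continuousOn_qform hAc hgu hgζ).add (ContinuousOn.mul (ContinuousOn.mul ?_ ?_) hwc)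
    · exact ((huc.norm.pow 2).sub continuousOn_const).div_const _
    · exact huc.inner hζc.continuous.continuousOn
  have hi1 : IntegrableOn (fun x => densityAt ε (A x) (w x) (grad u x) (u x))
      (closedBall 0 R) := by
    refine ContinuousOn.integrableOn_compact hcpt ?_
    exact ((continuousOn_qform hAc hgu hgu).div_const 2).add
      (((continuous_potentialAt ε).comp_continuousOn huc).mul hwc)
  have hi2 : IntegrableOn (fun x => densityAt ε (A x) (w x) (grad (u ∘ φ) x) (u (φ x)))
      (closedBall 0 R) := by
    refine ContinuousOn.integrableOn_compact hcpt ?_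
    exact ((continuousOn_qform hAc hgv hgv).div_const 2).add
      (((continuous_potentialAt ε).comp_continuousOn hvc).mul hwc)
  have hi3 : IntegrableOn (fun _ : Rn n => (Lu * X) ^ 2 / (2 * ε ^ 2) * W * h ^ 2)
      (closedBall 0 R) := continuousOn_const.integrableOn_compact hcpt
  have hi4 : IntegrableOn (fun x => densityAt ε (A x) (w x) (grad u x) (u x) -
      (Lu * X) ^ 2 / (2 * ε ^ 2) * W * h ^ 2) (closedBall 0 R) := hi1.sub hi3
  -- Adding the vanishing weak integral to the left side reduces the claim to the pointwise
  -- inequality `densityAt_sub_ge`. The quadratic error is uniform because u is Lipschitz on the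
  -- compact ball and φ moves points by at most |h| X.
  rw [← integral_mul_const, ← integral_sub hi1 hi3, ← add_zero (∫ x in _, _ - _),
    ← hweak, ← integral_add hi4 hi0]
  refine setIntegral_mono_on (hi4.add hi0) hi2 measurableSet_closedBall fun x hx => ?_
  have hx1 := hsub hx
  have hgsub : grad ζ x = grad (u ∘ φ) x - grad u x :=
    grad_sub (differentiableAt_of_mem_ball hv hx1) (differentiableAt_of_mem_ball hu.contDiffOn hx1)
  have hd := densityAt_sub_ge hε (hA.symm x hx1) (hA.nonneg x hx1) (hA.weight_nonneg x hx1)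
    (grad u x) (grad (u ∘ φ) x) (u x) (u (φ x))
  rw [← hgsub] at hd
  have hζx : ζ x = u (φ x) - u x := rfl
  have hsize : ‖u (φ x) - u x‖ ≤ Lu * X * |h| := by
    have h1 := hLu.dist_le_mul _ (hmaps hx) _ hx
    rw [dist_eq_norm, dist_eq_norm] at h1
    have h2 : ‖φ x - x‖ ≤ |h| * X := by
      rw [hφ, deformation, add_sub_cancel_left, norm_smul, Real.norm_eq_abs]
      gcongr
      exact hX x hx
    calc _ ≤ _ := h1
      _ ≤ Lu * (|h| * X) := by gcongr
      _ = _ := by ring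
  have herr : ‖u (φ x) - u x‖ ^ 2 / (2 * ε ^ 2) * w x ≤ (Lu * X) ^ 2 / (2 * ε ^ 2) * W * h ^ 2 := by
    have h1 : w x ≤ W := (le_abs_self _).trans (hW x hx)
    have h2 := hA.weight_nonneg x hx1
    calc _ ≤ (Lu * X * |h|) ^ 2 / (2 * ε ^ 2) * W := by gcongr
      _ = _ := by rw [mul_pow, sq_abs]; ring
  rw [hζx]
  linarith

/-- An upper bound for the integrand of the difference quotient of the energy along the
deformation; it depends continuously on `h`. -/
def variationBound (K ε : ℝ) (A : Rn n → Matrix (Fin n) (Fin n) ℝ) (w : Rn n → ℝ) (u : Rn n → ℂ)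
    (θ : ℝ → ℝ) (h : ℝ) (x : Rn n) : ℝ :=
  (2 * θ (‖x‖ ^ 2) + h * θ (‖x‖ ^ 2) ^ 2 - jacobianQuotient θ h x) / 2 *
      qform (A x) (grad u (deformation θ h x)) (grad u (deformation θ h x)) +
    (1 + h * θ (‖x‖ ^ 2)) * (2 * deriv θ (‖x‖ ^ 2)) *
      qform (A x) (fun i => x i • fderiv ℝ u (deformation θ h x) x) (grad u (deformation θ h x)) +
    2 * h * deriv θ (‖x‖ ^ 2) ^ 2 *
      qform (A x) (fun i => x i • fderiv ℝ u (deformation θ h x) x)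
        (fun i => x i • fderiv ℝ u (deformation θ h x) x) -
    jacobianQuotient θ h x * potentialAt ε (u (deformation θ h x)) * w x +
    (1 + h * jacobianQuotient θ h x) * (|θ (‖x‖ ^ 2)| * (‖x‖ * K *
      ((∑ i, ‖grad u (deformation θ h x) i‖) ^ 2 / 2 + potentialAt ε (u (deformation θ h x)))))

/-- The chain rule gives the terms in A x. Replacing A and w at the deformed point by their values
at x costs K |x - φ(x)| = h K |θ| |x| times the gradient and potential terms. This already carries
the factor h, so a Lipschitz bound is enough and no derivative of the coefficients is needed. -/
theorem density_deformation_sub_le {K ε : ℝ}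
    {A : Rn n → Matrix (Fin n) (Fin n) ℝ} {w : Rn n → ℝ} (hA : IsCoefficient K A w)
    {u : Rn n → ℂ} (hu : ContDiffOn ℝ 1 u (ball 0 1)) {θ : ℝ → ℝ} (hc : ContDiff ℝ 1 θ)
    {h : ℝ} (h0 : 0 ≤ h) {x : Rn n} (hx : x ∈ ball (0 : Rn n) 1)
    (hy : deformation θ h x ∈ ball (0 : Rn n) 1) (hJ : 0 ≤ 1 + h * jacobianQuotient θ h x) :
    densityAt ε (A x) (w x) (grad (u ∘ deformation θ h) x) (u (deformation θ h x)) -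
      (1 + h * jacobianQuotient θ h x) * densityAt ε (A (deformation θ h x))
        (w (deformation θ h x)) (grad u (deformation θ h x)) (u (deformation θ h x)) ≤
      h * variationBound K ε A w u θ h x := by
  rw [grad_comp_deformation hc (differentiableAt_of_mem_ball hu hy), variationBound]
  set y := deformation θ h x with hydef
  set p := grad u y
  set X : Fin n → ℂ := fun i => x i • fderiv ℝ u y x
  set D := jacobianQuotient θ h x
  set V := potentialAt ε (u y) with hVdef
  set S := ∑ i, ‖p i‖
  have hV : 0 ≤ V := potentialAt_nonneg _ _
  have hxy : ‖x - y‖ = h * (|θ (‖x‖ ^ 2)| * ‖x‖) := by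
    rw [hydef, deformation, sub_add_cancel_left, norm_neg, norm_smul, radialField, norm_smul,
      Real.norm_of_nonneg h0, Real.norm_eq_abs]
  have h1 := le_of_abs_le (abs_qform_sub_le (fun i j => hA.lip i j x hx y hy) p p)
  have h2 := mul_le_mul_of_nonneg_right (le_of_abs_le (hA.lip_weight x hx y hy)) hV
  rw [hxy] at h1 h2
  have h3 : densityAt ε (A x) (w x) p (u y) - densityAt ε (A y) (w y) p (u y) ≤
      h * (|θ (‖x‖ ^ 2)| * (‖x‖ * K * (S ^ 2 / 2 + V))) := by
    unfold densityAt
    rw [← hVdef]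
    linarith
  have h4 := mul_le_mul_of_nonneg_left h3 hJ
  have h5 := qform_smul_add_self (hA.symm x hx) (1 + h * θ (‖x‖ ^ 2))
    (2 * h * deriv θ (‖x‖ ^ 2)) p X
  unfold densityAt at h4 ⊢
  rw [← hVdef] at h4 ⊢
  rw [h5]
  linarith

theorem continuousOn_variationBound (K ε : ℝ)
    {A : Rn n → Matrix (Fin n) (Fin n) ℝ} {w : Rn n → ℝ} (hA : IsCoefficient K A w)
    {u : Rn n → ℂ} (hu : ContDiffOn ℝ 1 u (ball 0 1)) {θ : ℝ → ℝ} (hc : ContDiff ℝ 1 θ)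
    {s : Set (ℝ × Rn n)} (hs : ∀ p ∈ s, p.2 ∈ ball (0 : Rn n) 1)
    (hs' : ∀ p ∈ s, deformation θ p.1 p.2 ∈ ball (0 : Rn n) 1) :
    ContinuousOn (fun p : ℝ × Rn n => variationBound K ε A w u θ p.1 p.2) s := by
  have hθ1 : Continuous fun p : ℝ × Rn n => θ (‖p.2‖ ^ 2) := hc.continuous.comp (by fun_prop)
  have hθ2 : Continuous fun p : ℝ × Rn n => deriv θ (‖p.2‖ ^ 2) :=
    hc.continuous_deriv_one.comp (by fun_prop)
  have hD := (continuous_jacobianQuotient (n := n) hc).continuousOn (s := s)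
  have hφ : Continuous fun p : ℝ × Rn n => deformation θ p.1 p.2 := by
    unfold deformation
    exact continuous_snd.add (continuous_fst.smul
      ((contDiff_radialField hc).continuous.comp continuous_snd))
  have hAc : ∀ i j, ContinuousOn (fun p : ℝ × Rn n => A p.2 i j) s := fun i j =>
    (hA.continuousOn i j).comp continuous_snd.continuousOn hs
  have hwc : ContinuousOn (fun p : ℝ × Rn n => w p.2) s :=
    hA.continuousOn_weight.comp continuous_snd.continuousOn hs
  have hV : ContinuousOn (fun p : ℝ × Rn n => potentialAt ε (u (deformation θ p.1 p.2))) s :=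
    (continuous_potentialAt ε).comp_continuousOn (hu.continuousOn.comp hφ.continuousOn hs')
  have hg : ContinuousOn (fun p : ℝ × Rn n => grad u (deformation θ p.1 p.2)) s :=
    (continuousOn_grad hu).comp hφ.continuousOn hs'
  have hF : ContinuousOn (fun p : ℝ × Rn n => fderiv ℝ u (deformation θ p.1 p.2)) s :=
    (continuousOn_fderiv_ball hu).comp hφ.continuousOn hs'
  have hX : ContinuousOn (fun (p : ℝ × Rn n) (i : Fin n) =>
      p.2 i • fderiv ℝ u (deformation θ p.1 p.2) p.2) s := by
    refine continuousOn_pi.2 fun i => ?_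
    exact ((EuclideanSpace.proj i).continuous.comp continuous_snd).continuousOn.smul
      (hF.clm_apply continuous_snd.continuousOn)
  have hS : ContinuousOn (fun p : ℝ × Rn n => ∑ i, ‖grad u (deformation θ p.1 p.2) i‖) s :=
    continuousOn_finsetSum _ fun i _ => ((continuous_apply i).comp_continuousOn hg).norm
  have q1 := continuousOn_qform hAc hg hg
  have q2 := continuousOn_qform hAc hX hg
  have q3 := continuousOn_qform hAc hX hX
  have hθ1' := hθ1.continuousOn (s := s)
  have hθ2' := hθ2.continuousOn (s := s)
  have hh : ContinuousOn (fun p : ℝ × Rn n => p.1) s := continuous_fst.continuousOn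
  have hx : ContinuousOn (fun p : ℝ × Rn n => ‖p.2‖) s := by fun_prop
  unfold variationBound
  refine ((((((((continuousOn_const.mul hθ1').add (hh.mul (hθ1'.pow 2))).sub hD).div_const 2).mul
    q1).add (((continuousOn_const.add (hh.mul hθ1')).mul (continuousOn_const.mul hθ2')).mul q2)).add
    (((continuousOn_const.mul hh).mul (hθ2'.pow 2)).mul q3)).sub ((hD.mul hV).mul hwc)).add ?_
  exact (continuousOn_const.add (hh.mul hD)).mul (hθ1'.abs.mul ((hx.mul continuousOn_const).mul
    (((hS.pow 2).div_const 2).add hV)))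

theorem tendsto_integral_of_continuousOn {X : Type*} [TopologicalSpace X] [MeasurableSpace X]
    [OpensMeasurableSpace X] {μ : Measure X} [IsFiniteMeasureOnCompacts μ] {B : Set X}
    (hB : IsCompact B) (hBm : MeasurableSet B) {N : ℝ → X → ℝ} {a : ℝ} (ha : 0 < a)
    (hN : ContinuousOn (fun p : ℝ × X => N p.1 p.2) (Set.Icc 0 a ×ˢ B)) :
    Filter.Tendsto (fun h => ∫ x in B, N h x ∂μ) (𝓝[>] 0) (𝓝 (∫ x in B, N 0 x ∂μ)) := by
  obtain ⟨M, hM⟩ := (isCompact_Icc.prod hB).exists_bound_of_continuousOn hN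
  have hev : ∀ᶠ h in 𝓝[>] (0 : ℝ), h ∈ Set.Icc 0 a := by
    filter_upwards [Ioo_mem_nhdsGT ha] with h hh using ⟨hh.1.le, hh.2.le⟩
  have hsec : ∀ h ∈ Set.Icc 0 a, ContinuousOn (N h) B := fun h hh =>
    hN.comp (f := fun x => (h, x)) (by fun_prop) fun x hx => ⟨hh, hx⟩
  refine tendsto_integral_filter_of_dominated_convergence (fun _ => M) ?_ ?_ ?_ ?_
  · filter_upwards [hev] with h hh
    exact (hsec h hh).aestronglyMeasurable_of_isCompact hB hBm
  · filter_upwards [hev] with h hh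
    filter_upwards [ae_restrict_mem hBm] with x hx using hM (h, x) ⟨hh, hx⟩
  · exact continuousOn_const.integrableOn_compact' hB hBm
  · filter_upwards [ae_restrict_mem hBm] with x hx
    have h1 : ContinuousWithinAt (fun h => N h x) (Set.Icc 0 a) 0 :=
      (hN.comp (f := fun h => (h, x)) (s := Set.Icc 0 a) (by fun_prop) fun h hh => ⟨hh, hx⟩) 0
        ⟨le_rfl, ha.le⟩
    refine h1.mono_left (nhdsWithin_le_iff.2 ?_)
    exact hev

/-- The inner variation inequality for weak solutions. -/
theorem integral_variationBound_nonneg (hn : n ≠ 0) {K ε : ℝ} (hε : 0 < ε)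
    {A : Rn n → Matrix (Fin n) (Fin n) ℝ} {w : Rn n → ℝ} (hA : IsCoefficient K A w)
    {u : Rn n → ℂ} (hu : IsWeakSolution ε A w u) {θ : ℝ → ℝ} (hc : ContDiff ℝ 1 θ)
    {R : ℝ} (hR : 0 ≤ R) (hR1 : R < 1) (hθ : ∀ t, R ^ 2 ≤ t → θ t = 0) :
    0 ≤ ∫ x in closedBall (0 : Rn n) R, variationBound K ε A w u θ 0 x := by
  have hsub : closedBall (0 : Rn n) R ⊆ ball 0 1 := closedBall_subset_ball hR1
  have hcpt := isCompact_closedBall (0 : Rn n) R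
  obtain ⟨C, hC⟩ := integral_density_comp_deformation_ge hε hA hu hc hR hR1 hθ
  obtain ⟨L, hL⟩ := exists_lipschitzWith_radialField (n := n) hc hR hθ
  obtain ⟨T, hT⟩ := hcpt.exists_bound_of_continuousOn (f := fun x : Rn n => θ (‖x‖ ^ 2))
    (hc.continuous.comp (by fun_prop)).continuousOn
  obtain ⟨M, hM⟩ := ((isCompact_Icc (a := (0 : ℝ)) (b := 1)).prod hcpt).exists_bound_of_continuousOn
    (continuous_jacobianQuotient (n := n) hc).continuousOn
  have hT0 : 0 ≤ T := (norm_nonneg _).trans (hT 0 (mem_closedBall_self hR))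
  have hM0 : 0 ≤ M := (norm_nonneg _).trans (hM (0, 0) ⟨by simp, mem_closedBall_self hR⟩)
  -- For h ≤ a each of hL, hT, hM is below 1. These give, respectively, injectivity of the
  -- deformation, 1 + hθ ≠ 0 and a nonnegative Jacobian.
  set a : ℝ := 1 / (1 + L + T + M) with ha
  have hden : 0 < 1 + L + T + M := by positivity
  have ha0 : 0 < a := by positivity
  have hle : ∀ b : ℝ, 0 ≤ b → b ≤ L + T + M → ∀ h ∈ Set.Icc 0 a, h * b < 1 := by
    intro b hb0 hb h hh
    calc h * b ≤ a * b := by gcongr; exact hh.2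
      _ < 1 := by rw [ha, div_mul_eq_mul_div, one_mul, div_lt_one hden]; linarith
  have ha1 : a ≤ 1 := by
    rw [ha, div_le_one hden]; have := L.2; linarith [NNReal.coe_nonneg L]
  have hinj : ∀ h ∈ Set.Icc 0 a, Function.Injective (deformation θ h : Rn n → Rn n) :=
    fun h hh => injective_deformation hL hh.1 (hle L L.2 (by linarith) h hh)
  have hdef : ∀ p ∈ Set.Icc 0 a ×ˢ closedBall (0 : Rn n) R,
      deformation θ p.1 p.2 ∈ closedBall (0 : Rn n) R := by
    rintro ⟨h, x⟩ ⟨hh, hx⟩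
    rw [mem_closedBall_zero_iff] at *
    exact norm_deformation_le hR hθ (hinj h hh) hx
  have hcont : ContinuousOn (fun p : ℝ × Rn n => variationBound K ε A w u θ p.1 p.2)
      (Set.Icc 0 a ×ˢ closedBall 0 R) :=
    continuousOn_variationBound K ε hA hu.contDiffOn hc (fun p hp => hsub hp.2)
      fun p hp => hsub (hdef p hp)
  have hlim := tendsto_integral_of_continuousOn (μ := volume) hcpt measurableSet_closedBall ha0 hcont
  have hlim2 : Filter.Tendsto (fun h : ℝ => -C * h) (𝓝[>] 0) (𝓝 0) := by
    have : Filter.Tendsto (fun h : ℝ => -C * h) (𝓝 0) (𝓝 (-C * 0)) :=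
      (continuous_const.mul continuous_id).tendsto 0
    rw [mul_zero] at this
    exact this.mono_left nhdsWithin_le_nhds
  refine le_of_tendsto_of_tendsto hlim2 hlim ?_
  filter_upwards [Ioo_mem_nhdsGT ha0] with h hh
  have hhI : h ∈ Set.Icc 0 a := ⟨hh.1.le, hh.2.le⟩
  set φ := (deformation θ h : Rn n → Rn n) with hφ
  have hmaps : Set.MapsTo φ (closedBall 0 R) (closedBall 0 R) := fun x hx => hdef (h, x) ⟨hhI, hx⟩
  have hJ : ∀ x ∈ closedBall (0 : Rn n) R, 0 ≤ 1 + h * jacobianQuotient θ h x := by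
    intro x hx
    have h1 := hM (h, x) ⟨⟨hh.1.le, hh.2.le.trans ha1⟩, hx⟩
    have h2 := hle M hM0 (by linarith [NNReal.coe_nonneg L]) h hhI
    have h3 : h * -M ≤ h * jacobianQuotient θ h x := by
      gcongr
      · exact hh.1.le
      · exact (abs_le.1 h1).1
    linarith
  have hα : ∀ x ∈ closedBall (0 : Rn n) R, 1 + h * θ (‖x‖ ^ 2) ≠ 0 := by
    intro x hx
    have h2 := hle T hT0 (by linarith [NNReal.coe_nonneg L]) h hhI
    have h3 : h * -T ≤ h * θ (‖x‖ ^ 2) := by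
      gcongr
      · exact hh.1.le
      · exact (abs_le.1 (hT x hx)).1
    linarith
  set e : Rn n → ℝ := fun x => densityAt ε (A x) (w x) (grad u x) (u x) with he
  have hAc : ∀ i j, ContinuousOn (fun x => A x i j) (closedBall 0 R) := fun i j =>
    (hA.continuousOn i j).mono hsub
  have hwc := hA.continuousOn_weight.mono hsub
  have hgu := (continuousOn_grad hu.contDiffOn).mono hsub
  have hv := contDiffOn_comp_deformation hu.contDiffOn hc hR hR1 hθ (hinj h hhI)
  have hgv := (continuousOn_grad hv).mono hsub
  have hvc : ContinuousOn (fun x => u (φ x)) (closedBall 0 R) := hv.continuousOn.mono hsub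
  have hec : ContinuousOn e (closedBall 0 R) :=
    ((continuousOn_qform hAc hgu hgu).div_const 2).add
      (((continuous_potentialAt ε).comp_continuousOn (hu.contDiffOn.continuousOn.mono hsub)).mul hwc)
  have hφc : Continuous φ := (contDiff_deformation hc h).continuous
  -- Since the density is nonnegative, it suffices that the deformation maps the ball into itself;
  -- surjectivity is not needed for this direction.
  have hcov : ∫ x in closedBall (0 : Rn n) R, (1 + h * jacobianQuotient θ h x) * e (φ x) ≤
      ∫ x in closedBall (0 : Rn n) R, e x := by
    have h1 := integral_image_eq_integral_abs_det_fderiv_smul volume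
      (measurableSet_closedBall (x := (0 : Rn n)) (ε := R))
      (fun x _ => (hasFDerivAt_deformation hc h x).hasFDerivWithinAt)
      ((hinj h hhI).injOn) e
    have h2 : ∫ x in closedBall (0 : Rn n) R, (1 + h * jacobianQuotient θ h x) * e (φ x) =
        ∫ x in φ '' closedBall (0 : Rn n) R, e x := by
      rw [h1]
      refine setIntegral_congr_fun measurableSet_closedBall fun x hx => ?_
      simp only [smul_eq_mul]
      rw [det_deformationDeriv_eq hn θ h x (hα x hx), abs_of_nonneg (hJ x hx)]
    rw [h2]
    refine setIntegral_mono_set (hec.integrableOn_compact hcpt) ?_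
      (Set.MapsTo.image_subset hmaps).eventuallyLE
    filter_upwards [ae_restrict_mem measurableSet_closedBall] with x hx
    have := hA.nonneg x (hsub hx) (grad u x)
    have := hA.weight_nonneg x (hsub hx)
    have := potentialAt_nonneg ε (u x)
    simp only [he, densityAt, Pi.zero_apply]
    positivity
  have hi1 : IntegrableOn (fun x => densityAt ε (A x) (w x) (grad (u ∘ φ) x) (u (φ x)))
      (closedBall 0 R) :=
    (((continuousOn_qform hAc hgv hgv).div_const 2).add
      (((continuous_potentialAt ε).comp_continuousOn hvc).mul hwc)).integrableOn_compact hcpt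
  have hi2 : IntegrableOn (fun x => (1 + h * jacobianQuotient θ h x) * e (φ x))
      (closedBall 0 R) := by
    refine ContinuousOn.integrableOn_compact hcpt (ContinuousOn.mul ?_ ?_)
    · exact (continuous_const.add (continuous_const.mul ((continuous_jacobianQuotient hc).comp
        (by fun_prop : Continuous fun x : Rn n => (h, x))))).continuousOn
    · exact hec.comp hφc.continuousOn hmaps
  have hi3 : IntegrableOn (fun x => h * variationBound K ε A w u θ h x) (closedBall 0 R) := by
    refine ContinuousOn.integrableOn_compact hcpt (continuousOn_const.mul ?_)
    exact hcont.comp (f := fun x : Rn n => (h, x)) (by fun_prop) fun x hx => ⟨hhI, hx⟩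
  have hmono : ∫ x in closedBall (0 : Rn n) R,
      (densityAt ε (A x) (w x) (grad (u ∘ φ) x) (u (φ x)) -
        (1 + h * jacobianQuotient θ h x) * e (φ x)) ≤
      ∫ x in closedBall (0 : Rn n) R, h * variationBound K ε A w u θ h x :=
    setIntegral_mono_on (hi1.sub hi2) hi3 measurableSet_closedBall fun x hx =>
      density_deformation_sub_le hA hu.contDiffOn hc hh.1.le (hsub hx) (hsub (hmaps hx)) (hJ x hx)
  rw [integral_sub hi1 hi2, integral_const_mul] at hmono
  have hCh := hC h (hinj h hhI)
  -- Chain: -C h² ≤ E(u∘φ) - E(u) ≤ E(u∘φ) - ∫ (Jacobian) e∘φ ≤ h ∫ `variationBound`. Dividing by h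
  -- > 0 leaves a lower bound that tends to 0.
  have hfin : h * (-C * h) ≤ h * ∫ x in closedBall (0 : Rn n) R, variationBound K ε A w u θ h x := by
    nlinarith
  exact le_of_mul_le_mul_left hfin hh.1

/-! ### Uniform bounds for the class of Lipschitz metrics -/

/-- A compact convex set of matrices containing all values of the metrics in the class. -/
def admissible (n : ℕ) (lam Lam : ℝ) : Set (Fin n → Fin n → ℝ) :=
  {M | (∀ i j, M i j = M j i) ∧ (∀ i j, |M i j| ≤ 1 + Lam) ∧
    ∀ ξ : Rn n, lam * ‖ξ‖ ^ 2 ≤ ∑ i, ∑ j, M i j * ξ i * ξ j}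

theorem isCompact_admissible (lam Lam : ℝ) : IsCompact (admissible n lam Lam) := by
  have hK : IsCompact (Set.univ.pi fun _ : Fin n => Set.univ.pi fun _ : Fin n =>
      Set.Icc (-(1 + Lam)) (1 + Lam)) :=
    isCompact_univ_pi fun _ => isCompact_univ_pi fun _ => isCompact_Icc
  refine hK.of_isClosed_subset ?_ fun M hM i _ j _ => abs_le.1 (hM.2.1 i j)
  have h1 : IsClosed {M : Fin n → Fin n → ℝ | ∀ i j, M i j = M j i} := by
    simp only [Set.ofPred_forall]
    exact isClosed_iInter fun i => isClosed_iInter fun j => isClosed_eq (by fun_prop) (by fun_prop)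
  have h2 : IsClosed {M : Fin n → Fin n → ℝ | ∀ i j, |M i j| ≤ 1 + Lam} := by
    simp only [Set.ofPred_forall]
    exact isClosed_iInter fun i => isClosed_iInter fun j => isClosed_le (by fun_prop) (by fun_prop)
  have h3 : IsClosed {M : Fin n → Fin n → ℝ |
      ∀ ξ : Rn n, lam * ‖ξ‖ ^ 2 ≤ ∑ i, ∑ j, M i j * ξ i * ξ j} := by
    simp only [Set.ofPred_forall]
    exact isClosed_iInter fun ξ => isClosed_le (by fun_prop) (by fun_prop)
  exact h1.inter (h2.inter h3)

theorem convex_admissible (lam Lam : ℝ) : Convex ℝ (admissible n lam Lam) := by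
  rintro M ⟨hM1, hM2, hM3⟩ N ⟨hN1, hN2, hN3⟩ a b ha hb hab
  refine ⟨fun i j => ?_, fun i j => ?_, fun ξ => ?_⟩
  · simp [hM1 i j, hN1 i j]
  · simp only [Pi.add_apply, Pi.smul_apply, smul_eq_mul]
    calc |a * M i j + b * N i j| ≤ |a * M i j| + |b * N i j| := abs_add_le _ _
      _ = a * |M i j| + b * |N i j| := by rw [abs_mul, abs_mul, abs_of_nonneg ha, abs_of_nonneg hb]
      _ ≤ a * (1 + Lam) + b * (1 + Lam) := by gcongr; exacts [hM2 i j, hN2 i j]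
      _ = 1 + Lam := by rw [← add_mul, hab, one_mul]
  · have h1 : ∑ i, ∑ j, (a • M + b • N) i j * ξ i * ξ j =
        a * ∑ i, ∑ j, M i j * ξ i * ξ j + b * ∑ i, ∑ j, N i j * ξ i * ξ j := by
      simp only [Pi.add_apply, Pi.smul_apply, smul_eq_mul, Finset.mul_sum, ← Finset.sum_add_distrib]
      refine Finset.sum_congr rfl fun i _ => Finset.sum_congr rfl fun j _ => by ring
    rw [h1]
    calc lam * ‖ξ‖ ^ 2 = a * (lam * ‖ξ‖ ^ 2) + b * (lam * ‖ξ‖ ^ 2) := by rw [← add_mul, hab, one_mul]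
      _ ≤ _ := by gcongr; exacts [hM3 ξ, hN3 ξ]

theorem det_pos_of_admissible {lam Lam : ℝ} (hlam : 0 < lam) {M : Fin n → Fin n → ℝ}
    (hM : M ∈ admissible n lam Lam) : 0 < (Matrix.of M).det := by
  refine Matrix.PosDef.det_pos (𝕜 := ℝ) (Matrix.PosDef.of_dotProduct_mulVec_pos ?_ fun x hx => ?_)
  · ext i j
    simp [hM.1 i j]
  · have h1 := hM.2.2 (WithLp.toLp 2 x)
    have h2 : 0 < ‖(WithLp.toLp 2 x : Rn n)‖ := by
      rw [norm_pos_iff]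
      intro h
      exact hx (congrArg (WithLp.ofLp) h)
    have h3 : star x ⬝ᵥ (Matrix.of M).mulVec x = ∑ i, ∑ j, M i j * x i * x j := by
      simp only [dotProduct, Matrix.mulVec, star_trivial, Matrix.of_apply, Finset.mul_sum]
      refine Finset.sum_congr rfl fun i _ => Finset.sum_congr rfl fun j _ => by ring
    rw [h3]
    exact lt_of_lt_of_le (by positivity) h1

theorem contDiff_det_of {m : ℕ} {E : Type*} [NormedAddCommGroup E] [NormedSpace ℝ E]
    {F : E → Matrix (Fin m) (Fin m) ℝ} (hF : ∀ i j, ContDiff ℝ 1 fun x => F x i j) :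
    ContDiff ℝ 1 fun x => (F x).det := by
  simp_rw [Matrix.det_apply]
  exact ContDiff.sum fun σ _ => (contDiff_prod fun i _ => hF _ _).const_smul _

theorem contDiff_entry (i j : Fin n) : ContDiff ℝ 1 fun M : Fin n → Fin n → ℝ => M i j := by
  fun_prop

theorem contDiffOn_sqrt_det {lam Lam : ℝ} (hlam : 0 < lam) :
    ContDiffOn ℝ 1 (fun M : Fin n → Fin n → ℝ => Real.sqrt (Matrix.of M).det)
      (admissible n lam Lam) :=
  (contDiff_det_of fun i j => contDiff_entry i j).contDiffOn.sqrt
    fun _ hM => (det_pos_of_admissible hlam hM).ne'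

theorem contDiffOn_inv_apply {lam Lam : ℝ} (hlam : 0 < lam) (i j : Fin n) :
    ContDiffOn ℝ 1 (fun M : Fin n → Fin n → ℝ => (Matrix.of M)⁻¹ i j) (admissible n lam Lam) := by
  have h1 : ContDiff ℝ 1 fun M : Fin n → Fin n → ℝ => (Matrix.of M).adjugate i j := by
    simp_rw [Matrix.adjugate_apply]
    refine contDiff_det_of fun k l => ?_
    by_cases hk : k = j
    · subst hk
      simp only [Matrix.updateRow_self]
      exact contDiff_const
    · simp only [Matrix.updateRow_ne hk, Matrix.of_apply]
      exact contDiff_entry k l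
  have h2 : ContDiffOn ℝ 1 (fun M : Fin n → Fin n → ℝ => ((Matrix.of M).det)⁻¹)
      (admissible n lam Lam) :=
    (contDiff_det_of fun i j => contDiff_entry i j).contDiffOn.inv
      fun _ hM => (det_pos_of_admissible hlam hM).ne'
  refine (h2.mul h1.contDiffOn).congr fun M _ => ?_
  rw [Matrix.inv_def, Ring.inverse_eq_inv, Matrix.smul_apply, smul_eq_mul]

theorem IsLipschitzMetric.mem_admissible {lam Lam : ℝ} {g : Rn n → Matrix (Fin n) (Fin n) ℝ}
    (hLam : 0 ≤ Lam) (hg : IsLipschitzMetric lam Lam g) {x : Rn n} (hx : x ∈ ball (0 : Rn n) 1) :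
    (g x : Fin n → Fin n → ℝ) ∈ admissible n lam Lam := by
  refine ⟨fun i j => (hg.symm x hx).apply j i, fun i j => ?_, hg.lower x hx⟩
  have h1 := hg.lipschitz i j x hx 0 (mem_ball_self one_pos)
  rw [hg.normalized, sub_zero] at h1
  have h2 : |(1 : Matrix (Fin n) (Fin n) ℝ) i j| ≤ 1 := by
    rw [Matrix.one_apply]; split_ifs <;> simp
  have h3 : Lam * ‖x‖ ≤ Lam := mul_le_of_le_one_right hLam (mem_ball_zero_iff.1 hx).le
  have h4 := abs_sub_abs_le_abs_sub (g x i j) ((1 : Matrix (Fin n) (Fin n) ℝ) i j)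
  linarith

/-- A smooth function of the metric is Lipschitz with a constant depending only on the class. -/
theorem exists_lipschitz_comp_metric {lam Lam : ℝ} (hLam : 0 ≤ Lam)
    {F : (Fin n → Fin n → ℝ) → ℝ} (hF : ContDiffOn ℝ 1 F (admissible n lam Lam)) :
    ∃ K : ℝ, 0 ≤ K ∧ ∀ g : Rn n → Matrix (Fin n) (Fin n) ℝ, IsLipschitzMetric lam Lam g →
      ∀ x ∈ ball (0 : Rn n) 1, ∀ y ∈ ball (0 : Rn n) 1, |F (g x) - F (g y)| ≤ K * ‖x - y‖ := by
  -- Compactness bounds the derivative of F, and convexity of the admissible set turns this bound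
  -- into a Lipschitz constant that does not depend on g.
  obtain ⟨K, hK⟩ := hF.exists_lipschitzOnWith one_ne_zero (convex_admissible lam Lam)
    (isCompact_admissible lam Lam)
  refine ⟨K * Lam, by positivity, fun g hg x hx y hy => ?_⟩
  have h1 := hK.dist_le_mul _ (hg.mem_admissible hLam hx) _ (hg.mem_admissible hLam hy)
  rw [Real.dist_eq] at h1
  refine h1.trans ?_
  rw [mul_assoc]
  refine mul_le_mul_of_nonneg_left ?_ K.2
  have h2 : 0 ≤ Lam * ‖x - y‖ := by positivity
  refine (dist_pi_le_iff h2).2 fun i => (dist_pi_le_iff h2).2 fun j => ?_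
  rw [Real.dist_eq]
  exact hg.lipschitz i j x hx y hy

theorem inner_complex_eq (z y : ℂ) : ⟪z, y⟫ = z.re * y.re + z.im * y.im := by
  rw [Complex.inner]; simp; ring

theorem qform_lower_of_admissible {lam Lam : ℝ} {M : Matrix (Fin n) (Fin n) ℝ}
    (hM : (M : Fin n → Fin n → ℝ) ∈ admissible n lam Lam) (P : Fin n → ℂ) :
    lam * ∑ i, ‖P i‖ ^ 2 ≤ qform M P P := by
  have h1 := hM.2.2 (WithLp.toLp 2 fun i => (P i).re)
  have h2 := hM.2.2 (WithLp.toLp 2 fun i => (P i).im)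
  rw [EuclideanSpace.norm_sq_eq] at h1 h2
  have h3 : qform M P P = ∑ i, ∑ j, M i j * (P i).re * (P j).re +
      ∑ i, ∑ j, M i j * (P i).im * (P j).im := by
    simp only [qform, inner_complex_eq, ← Finset.sum_add_distrib]
    refine Finset.sum_congr rfl fun i _ => Finset.sum_congr rfl fun j _ => by ring
  have h4 : ∑ i, ‖P i‖ ^ 2 = ∑ i, ‖(P i).re‖ ^ 2 + ∑ i, ‖(P i).im‖ ^ 2 := by
    rw [← Finset.sum_add_distrib]
    refine Finset.sum_congr rfl fun i _ => ?_
    rw [Complex.sq_norm, Complex.normSq_apply, Real.norm_eq_abs, Real.norm_eq_abs, sq_abs, sq_abs]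
    ring
  rw [h3, h4, mul_add]
  exact add_le_add h1 h2

/-- Put P = Mη, so that the form of M⁻¹ at P is the form of M at η, at least lam Σ‖η_j‖². The entry
bound gives Σ‖P_i‖ ≤ n(1 + Lam) Σ‖η_j‖, and Cauchy-Schwarz supplies the third factor n. -/
theorem qform_inv_lower_of_admissible (hn : n ≠ 0) {lam Lam : ℝ} (hlam : 0 < lam) (hLam : 0 ≤ Lam)
    {M : Matrix (Fin n) (Fin n) ℝ} (hM : (M : Fin n → Fin n → ℝ) ∈ admissible n lam Lam)
    (P : Fin n → ℂ) :
    lam / (n ^ 3 * (1 + Lam) ^ 2) * (∑ i, ‖P i‖) ^ 2 ≤ qform M⁻¹ P P := by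
  have hdet : IsUnit M.det := (det_pos_of_admissible hlam hM).ne'.isUnit
  set η : Fin n → ℂ := fun i => ∑ j, M⁻¹ i j • P j with hη
  have hP : ∀ i, P i = ∑ j, M i j • η j := by
    intro i
    have h1 : ∑ j, M i j • η j = ∑ k, (M * M⁻¹) i k • P k := by
      simp only [hη, Finset.smul_sum, Matrix.mul_apply, Finset.sum_smul, smul_smul]
      exact Finset.sum_comm
    rw [h1, Matrix.mul_nonsing_inv M hdet]
    simp [Matrix.one_apply]
  have h2 : qform M η η = qform M⁻¹ P P := by
    have e1 : qform M η η = ∑ i, ⟪η i, P i⟫ := by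
      refine Finset.sum_congr rfl fun i _ => ?_
      rw [hP i, inner_sum]
      simp only [inner_smul_right]
    have e2 : qform M⁻¹ P P = ∑ i, ⟪P i, η i⟫ := by
      refine Finset.sum_congr rfl fun i _ => ?_
      simp only [hη, inner_sum, inner_smul_right]
    rw [e1, e2]
    exact Finset.sum_congr rfl fun i _ => real_inner_comm _ _
  have h3 := qform_lower_of_admissible hM η
  have h4 : ∑ i, ‖P i‖ ≤ n * ((1 + Lam) * ∑ j, ‖η j‖) := by
    have : ∀ i ∈ Finset.univ, ‖P i‖ ≤ (1 + Lam) * ∑ j, ‖η j‖ := by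
      intro i _
      rw [hP i, Finset.mul_sum]
      refine (norm_sum_le _ _).trans (Finset.sum_le_sum fun j _ => ?_)
      rw [norm_smul]
      gcongr
      exact hM.2.1 i j
    simpa using Finset.sum_le_card_nsmul _ _ _ this
  have h5 : (∑ j, ‖η j‖) ^ 2 ≤ n * ∑ j, ‖η j‖ ^ 2 := by
    simpa using sq_sum_le_card_mul_sum_sq (s := Finset.univ) (f := fun j => ‖η j‖)
  have hn0 : (0 : ℝ) < n := by exact_mod_cast Nat.pos_of_ne_zero hn
  have h0 : 0 ≤ ∑ i, ‖P i‖ := Finset.sum_nonneg fun _ _ => norm_nonneg _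
  calc lam / (n ^ 3 * (1 + Lam) ^ 2) * (∑ i, ‖P i‖) ^ 2
      ≤ lam / (n ^ 3 * (1 + Lam) ^ 2) * (n * ((1 + Lam) * ∑ j, ‖η j‖)) ^ 2 := by gcongr
    _ = lam / n * (∑ j, ‖η j‖) ^ 2 := by
      have : 1 + Lam ≠ 0 := by positivity
      field_simp
    _ ≤ lam / n * (n * ∑ j, ‖η j‖ ^ 2) := by gcongr
    _ = lam * ∑ j, ‖η j‖ ^ 2 := by field_simp
    _ ≤ qform M⁻¹ P P := h2 ▸ h3

/-- The bounds on a metric, uniform over the class, on which the Pohozaev inequalities depend. -/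
structure MetricBounds (K G c : ℝ) (g : Rn n → Matrix (Fin n) (Fin n) ℝ) : Prop where
  coeff : IsCoefficient K (fun x => Real.sqrt (g x).det • (g x)⁻¹) fun x => Real.sqrt (g x).det
  inv_sub_one : ∀ x ∈ ball (0 : Rn n) 1, ∀ i j,
    |(g x)⁻¹ i j - (1 : Matrix (Fin n) (Fin n) ℝ) i j| ≤ K * ‖x‖
  inv_le : ∀ x ∈ ball (0 : Rn n) 1, ∀ i j, |(g x)⁻¹ i j| ≤ G
  lower : ∀ x ∈ ball (0 : Rn n) 1, ∀ P, c * (∑ i, ‖P i‖) ^ 2 ≤ qform (g x)⁻¹ P P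
  sqrt_det : ∀ x ∈ ball (0 : Rn n) 1, c ≤ Real.sqrt (g x).det
  inv_cont : ∀ i j, ContinuousOn (fun x => (g x)⁻¹ i j) (ball 0 1)

/-- Each quantity is a continuously differentiable function of the matrix on the admissible set, so
its bounds are uniform over the class. Proximity of the inverse to the identity comes from its
Lipschitz bound and g(0) = I. -/
theorem exists_metricBounds (hn : n ≠ 0) {lam Lam : ℝ} (hlam : 0 < lam) (hLam : 0 ≤ Lam) :
    ∃ K G c : ℝ, 0 ≤ K ∧ 0 ≤ G ∧ 0 < c ∧ ∀ g : Rn n → Matrix (Fin n) (Fin n) ℝ,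
      IsLipschitzMetric lam Lam g → MetricBounds K G c g := by
  have hn0 : (0 : ℝ) < n := by exact_mod_cast Nat.pos_of_ne_zero hn
  obtain ⟨K₀, hK₀, hw⟩ := exists_lipschitz_comp_metric hLam (contDiffOn_sqrt_det (n := n) hlam)
  choose K₁ hK₁ hinv using fun i j => exists_lipschitz_comp_metric hLam
    (contDiffOn_inv_apply (n := n) (lam := lam) (Lam := Lam) hlam i j)
  choose K₂ hK₂ hprod using fun i j => exists_lipschitz_comp_metric hLam
    ((contDiffOn_sqrt_det (n := n) (lam := lam) (Lam := Lam) hlam).mul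
      (contDiffOn_inv_apply (n := n) (lam := lam) (Lam := Lam) hlam i j))
  -- An upper bound for 1/√det is a positive lower bound for √det.
  obtain ⟨B, hB⟩ := (isCompact_admissible (n := n) lam Lam).exists_bound_of_continuousOn
    ((contDiffOn_sqrt_det hlam).continuousOn.inv₀
      fun _ hM => (Real.sqrt_pos.2 (det_pos_of_admissible hlam hM)).ne')
  set K := K₀ + ∑ i, ∑ j, K₁ i j + ∑ i, ∑ j, K₂ i j with hK
  have hs1 : ∀ i j, K₁ i j ≤ ∑ i, ∑ j, K₁ i j := fun i j =>
    (Finset.single_le_sum (fun j _ => hK₁ i j) (Finset.mem_univ j)).trans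
      (Finset.single_le_sum (f := fun i => ∑ j, K₁ i j)
        (fun i _ => Finset.sum_nonneg fun j _ => hK₁ i j) (Finset.mem_univ i))
  have hs2 : ∀ i j, K₂ i j ≤ ∑ i, ∑ j, K₂ i j := fun i j =>
    (Finset.single_le_sum (fun j _ => hK₂ i j) (Finset.mem_univ j)).trans
      (Finset.single_le_sum (f := fun i => ∑ j, K₂ i j)
        (fun i _ => Finset.sum_nonneg fun j _ => hK₂ i j) (Finset.mem_univ i))
  have hs1' : 0 ≤ ∑ i, ∑ j, K₁ i j :=
    Finset.sum_nonneg fun i _ => Finset.sum_nonneg fun j _ => hK₁ i j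
  have hs2' : 0 ≤ ∑ i, ∑ j, K₂ i j :=
    Finset.sum_nonneg fun i _ => Finset.sum_nonneg fun j _ => hK₂ i j
  have hK0 : 0 ≤ K := by positivity
  set c₁ := lam / (n ^ 3 * (1 + Lam) ^ 2)
  have hc₁ : 0 < c₁ := by positivity
  have hc₂ : 0 < (|B| + 1)⁻¹ := by positivity
  refine ⟨K, K + 1, min c₁ (|B| + 1)⁻¹, hK0, by positivity, lt_min hc₁ hc₂, fun g hg => ?_⟩
  have hsub : ∀ x ∈ ball (0 : Rn n) 1, ∀ i j,
      |(g x)⁻¹ i j - (1 : Matrix (Fin n) (Fin n) ℝ) i j| ≤ K * ‖x‖ := by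
    intro x hx i j
    have h1 := hinv i j g hg x hx 0 (mem_ball_self one_pos)
    have h2 : (Matrix.of (g 0))⁻¹ i j = (1 : Matrix (Fin n) (Fin n) ℝ) i j := by
      change (g 0)⁻¹ i j = _
      rw [hg.normalized, inv_one]
    rw [h2, sub_zero] at h1
    refine h1.trans ?_
    gcongr
    linarith [hs1 i j]
  have hadm := fun x (hx : x ∈ ball (0 : Rn n) 1) => hg.mem_admissible hLam hx
  have hlow : ∀ x ∈ ball (0 : Rn n) 1, ∀ P, c₁ * (∑ i, ‖P i‖) ^ 2 ≤ qform (g x)⁻¹ P P :=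
    fun x hx P => qform_inv_lower_of_admissible hn hlam hLam (hadm x hx) P
  refine ⟨⟨fun x hx => ?_, fun i j x hx y hy => ?_, fun x hx y hy => ?_, fun x hx P => ?_,
    fun x hx => Real.sqrt_nonneg _⟩, hsub, fun x hx i j => ?_, fun x hx P => ?_, fun x hx => ?_,
    fun i j => ?_⟩
  · exact (hg.symm x hx).inv.smul _
  · refine (hprod i j g hg x hx y hy).trans ?_
    gcongr
    linarith [hs2 i j]
  · refine (hw g hg x hx y hy).trans ?_
    gcongr
    linarith
  · rw [qform_smul_matrix]
    refine mul_nonneg (Real.sqrt_nonneg _) (le_trans ?_ (hlow x hx P))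
    positivity
  · have h1 := hsub x hx i j
    have h2 : |(1 : Matrix (Fin n) (Fin n) ℝ) i j| ≤ 1 := by
      rw [Matrix.one_apply]; split_ifs <;> simp
    have h3 : K * ‖x‖ ≤ K := mul_le_of_le_one_right hK0 (mem_ball_zero_iff.1 hx).le
    have h4 := abs_sub_abs_le_abs_sub ((g x)⁻¹ i j) ((1 : Matrix (Fin n) (Fin n) ℝ) i j)
    linarith
  · refine le_trans ?_ (hlow x hx P)
    gcongr
    exact min_le_left _ _
  · refine (min_le_right _ _).trans ?_
    have h0 : 0 < Real.sqrt (g x).det := Real.sqrt_pos.2 (det_pos_of_admissible hlam (hadm x hx))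
    have h1 : ‖(Real.sqrt (g x).det)⁻¹‖ ≤ B := hB _ (hadm x hx)
    rw [norm_inv, Real.norm_of_nonneg h0.le] at h1
    rw [inv_le_comm₀ (by positivity) h0]
    linarith [le_abs_self B]
  · exact continuousOn_of_abs_sub_le (hinv i j g hg)

/-! ### The Pohozaev inequalities on balls -/

theorem integrableOn_sphere (hn : n ≠ 0) {f : Rn n → ℝ} (hf : ContinuousOn f (ball 0 1)) {ρ : ℝ}
    (hρ : ρ ∈ Set.Ioo (0 : ℝ) 1) :
    IntegrableOn f (sphere 0 ρ) (μHE[n - 1] : Measure (Rn n)) := by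
  have hfin : IsFiniteMeasure ((μHE[n - 1] : Measure (Rn n)).restrict (sphere 0 ρ)) := by
    have : IsFiniteMeasure (polarMeasure n) := by unfold polarMeasure; infer_instance
    rw [hausdorff_restrict_sphere hρ.1, ← polarMeasure_eq_hausdorff hn]
    exact Measure.smul_finite _ ENNReal.ofReal_ne_top
  have hsub : sphere (0 : Rn n) ρ ⊆ ball 0 1 :=
    sphere_subset_closedBall.trans (closedBall_subset_ball hρ.2)
  obtain ⟨M, hM⟩ := (isCompact_sphere (0 : Rn n) ρ).exists_bound_of_continuousOn (hf.mono hsub)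
  refine Integrable.of_bound
    ((hf.mono hsub).aestronglyMeasurable_of_isCompact (isCompact_sphere _ _)
      isClosed_sphere.measurableSet) M ?_
  filter_upwards [ae_restrict_mem isClosed_sphere.measurableSet] with x hx using hM x hx

theorem sphInt_mono (hn : n ≠ 0) {f g : Rn n → ℝ} (hf : ContinuousOn f (ball 0 1))
    (hg : ContinuousOn g (ball 0 1)) {ρ : ℝ} (hρ : ρ ∈ Set.Ioo (0 : ℝ) 1)
    (h : ∀ x : Rn n, ‖x‖ = ρ → f x ≤ g x) : sphInt f ρ ≤ sphInt g ρ :=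
  setIntegral_mono_on (integrableOn_sphere hn hf hρ) (integrableOn_sphere hn hg hρ)
    isClosed_sphere.measurableSet fun x hx => h x (by simpa using hx)

theorem sphInt_neg (f : Rn n → ℝ) (s : ℝ) : sphInt (fun x => -f x) s = -sphInt f s :=
  integral_neg _

theorem sphInt_const_mul (c : ℝ) (f : Rn n → ℝ) (s : ℝ) :
    sphInt (fun x => c * f x) s = c * sphInt f s :=
  integral_const_mul _ _

theorem sphInt_add (hn : n ≠ 0) {f g : Rn n → ℝ} (hf : ContinuousOn f (ball 0 1))
    (hg : ContinuousOn g (ball 0 1)) {ρ : ℝ} (hρ : ρ ∈ Set.Ioo (0 : ℝ) 1) :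
    sphInt (fun x => f x + g x) ρ = sphInt f ρ + sphInt g ρ :=
  integral_add (integrableOn_sphere hn hf hρ) (integrableOn_sphere hn hg hρ)

theorem variationBound_zero (hn : n ≠ 0) (K ε : ℝ) (A : Rn n → Matrix (Fin n) (Fin n) ℝ)
    (w : Rn n → ℝ) (u : Rn n → ℂ) (θ : ℝ → ℝ) (x : Rn n) :
    variationBound K ε A w u θ 0 x =
      θ (‖x‖ ^ 2) * (qform (A x) (grad u x) (grad u x) -
        n * densityAt ε (A x) (w x) (grad u x) (u x)) +
      2 * deriv θ (‖x‖ ^ 2) * (qform (A x) (fun i => x i • fderiv ℝ u x x) (grad u x) -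
        ‖x‖ ^ 2 * densityAt ε (A x) (w x) (grad u x) (u x)) +
      |θ (‖x‖ ^ 2)| * (‖x‖ * K * ((∑ i, ‖grad u x i‖) ^ 2 / 2 + potentialAt ε (u x))) := by
  rw [variationBound, jacobianQuotient_zero hn, densityAt]
  simp only [deformation, zero_smul, add_zero]
  ring

/-- The inner variation inequality is linear in θ except for the error in |θ|. Cutoffs θ ≥ 0 bound
the boundary term from above, their negatives bound it from below, and the error keeps its sign in
both cases. -/
theorem pohozaev_of_weakSolution (hn : n ≠ 0) {K ε : ℝ} (hε : 0 < ε)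
    {A : Rn n → Matrix (Fin n) (Fin n) ℝ} {w : Rn n → ℝ} (hA : IsCoefficient K A w)
    {u : Rn n → ℂ} (hu : IsWeakSolution ε A w u) {ρ : ℝ} (hρ : ρ ∈ Set.Ioo (0 : ℝ) 1)
    {f₀ f₁ f₂ : Rn n → ℝ}
    (hf₀ : ∀ x, f₀ x = qform (A x) (grad u x) (grad u x) -
        n * densityAt ε (A x) (w x) (grad u x) (u x))
    (hf₁ : ∀ x, f₁ x = qform (A x) (fun i => x i • fderiv ℝ u x x) (grad u x) -
        ‖x‖ ^ 2 * densityAt ε (A x) (w x) (grad u x) (u x))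
    (hf₂ : ∀ x, f₂ x = ‖x‖ * K * ((∑ i, ‖grad u x i‖) ^ 2 / 2 + potentialAt ε (u x)))
    (hc₀ : ContinuousOn f₀ (ball 0 1)) (hc₁ : ContinuousOn f₁ (ball 0 1))
    (hc₂ : ContinuousOn f₂ (ball 0 1)) :
    sphInt f₁ ρ / ρ ≤ (∫ x in ball 0 ρ, f₀ x) + ∫ x in ball 0 ρ, f₂ x ∧
      (∫ x in ball 0 ρ, f₀ x) - ∫ x in ball 0 ρ, f₂ x ≤ sphInt f₁ ρ / ρ := by
  have hi₀ := integrableOn_ball_of_continuousOn hc₀ hρ.2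
  have hi₂ := integrableOn_ball_of_continuousOn hc₂ hρ.2
  have hae : closedBall (0 : Rn n) ρ =ᵐ[volume] ball 0 ρ := by
    have : Nontrivial (Rn n) := Module.nontrivial_of_finrank_pos (R := ℝ)
      (by rw [finrank_euclideanSpace_fin]; exact Nat.pos_of_ne_zero hn)
    refine (ae_eq_of_subset_of_measure_ge ball_subset_closedBall ?_
      measurableSet_ball.nullMeasurableSet measure_closedBall_lt_top.ne).symm
    rw [Measure.addHaar_closedBall_eq_addHaar_ball]
  have hvar : ∀ θ : ℝ → ℝ, ContDiff ℝ 1 θ → (∀ t, ρ ^ 2 ≤ t → θ t = 0) →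
      0 ≤ ∫ x in ball (0 : Rn n) ρ, (θ (‖x‖ ^ 2) * f₀ x + 2 * deriv θ (‖x‖ ^ 2) * f₁ x +
        |θ (‖x‖ ^ 2)| * f₂ x) := by
    intro θ hθ hθ0
    have h1 := integral_variationBound_nonneg hn hε hA hu hθ hρ.1.le hρ.2 hθ0
    rw [setIntegral_congr_set hae] at h1
    simp_rw [variationBound_zero hn, ← hf₀, ← hf₁, ← hf₂] at h1
    exact h1
  constructor
  · rw [← integral_add hi₀ hi₂]
    refine sphInt_div_le_of_forall_cutoff hn hρ (hc₀.add hc₂) hc₁ fun θ hθ hpos hθ0 => ?_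
    refine (hvar θ hθ hθ0).trans_eq ?_
    refine integral_congr_ae (Filter.Eventually.of_forall fun x => ?_)
    simp only [abs_of_nonneg (hpos _)]
    ring
  · have h2 := sphInt_div_le_of_forall_cutoff hn hρ (F := fun x => -f₀ x + f₂ x)
      (f := fun x => -f₁ x) (hc₀.neg.add hc₂) hc₁.neg fun θ hθ hpos hθ0 => by
        refine (hvar (-θ) hθ.neg fun t ht => by simp [hθ0 t ht]).trans_eq ?_
        refine integral_congr_ae (Filter.Eventually.of_forall fun x => ?_)
        simp only [Pi.neg_apply, abs_neg, abs_of_nonneg (hpos _), deriv.neg']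
        ring
    have h3 : ∫ x in ball (0 : Rn n) ρ, (-f₀ x + f₂ x) =
        -(∫ x in ball (0 : Rn n) ρ, f₀ x) + ∫ x in ball (0 : Rn n) ρ, f₂ x := by
      rw [← integral_neg]; exact integral_add hi₀.neg hi₂
    rw [h3, sphInt_neg, neg_div] at h2
    linarith

/-! ### The Pohozaev inequalities for a Lipschitz metric -/

/-- `|x|` times the radial derivative. -/
def scaledRadial (g : Rn n → Matrix (Fin n) (Fin n) ℝ) (u : Rn n → ℂ) (x : Rn n) : ℂ :=
  ∑ i, ∑ j, ((g x)⁻¹ i j * x i) • grad u x j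

theorem radialDeriv_eq (g : Rn n → Matrix (Fin n) (Fin n) ℝ) (u : Rn n → ℂ) (x : Rn n) :
    radialDeriv g u x = ‖x‖⁻¹ • scaledRadial g u x := by
  simp only [radialDeriv, scaledRadial, Finset.smul_sum, smul_smul, grad]
  refine Finset.sum_congr rfl fun i _ => Finset.sum_congr rfl fun j _ => ?_
  congr 1
  ring

theorem fderiv_apply_self_eq (u : Rn n → ℂ) (x : Rn n) :
    fderiv ℝ u x x = ∑ i, x i • grad u x i := by
  have h1 : x = ∑ i, x i • EuclideanSpace.single i (1 : ℝ) := by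
    ext j
    simp [Finset.sum_apply, Pi.single_apply]
  conv_lhs => rw [h1, map_sum]
  simp only [map_smul, grad, partialDeriv]
  rw [← h1]

theorem abs_apply_le_norm (x : Rn n) (i : Fin n) : |x i| ≤ ‖x‖ := by
  simpa using PiLp.norm_apply_le x i

theorem norm_sum_smul_le {a : Matrix (Fin n) (Fin n) ℝ} {M : ℝ} (h : ∀ i j, |a i j| ≤ M)
    (x : Rn n) (P : Fin n → ℂ) :
    ‖∑ i, ∑ j, (a i j * x i) • P j‖ ≤ n * (M * ‖x‖ * ∑ j, ‖P j‖) := by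
  have h1 : ∀ i ∈ Finset.univ, ‖∑ j, (a i j * x i) • P j‖ ≤ M * ‖x‖ * ∑ j, ‖P j‖ := by
    intro i _
    rw [Finset.mul_sum]
    refine (norm_sum_le _ _).trans (Finset.sum_le_sum fun j _ => ?_)
    have hM : 0 ≤ M := (abs_nonneg _).trans (h i j)
    rw [norm_smul, norm_mul, Real.norm_eq_abs, Real.norm_eq_abs]
    gcongr
    · exact h i j
    · exact abs_apply_le_norm x i
  refine (norm_sum_le _ _).trans ?_
  simpa using Finset.sum_le_card_nsmul _ _ _ h1

theorem qform_radial (g : Rn n → Matrix (Fin n) (Fin n) ℝ) (u : Rn n → ℂ) (x : Rn n) :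
    qform (g x)⁻¹ (fun i => x i • fderiv ℝ u x x) (grad u x) =
      ⟪fderiv ℝ u x x, scaledRadial g u x⟫ := by
  simp only [qform, scaledRadial, inner_sum, inner_smul_right, real_inner_smul_left, mul_assoc]

/-- The form is the inner product of x·∇u with g^{ij} x_i ∂_j u. These two vectors coincide for the
identity matrix, so the normalization at the origin makes them differ by O(|x|²) times the gradient.
-/
theorem abs_qform_radial_sub_le {K G c : ℝ} (hK : 0 ≤ K)
    {g : Rn n → Matrix (Fin n) (Fin n) ℝ} (hB : MetricBounds K G c g) (u : Rn n → ℂ) {x : Rn n}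
    (hx : x ∈ ball (0 : Rn n) 1) :
    |qform (g x)⁻¹ (fun i => x i • fderiv ℝ u x x) (grad u x) - ‖scaledRadial g u x‖ ^ 2| ≤
      K * G * n ^ 2 * ‖x‖ ^ 3 * (∑ i, ‖grad u x i‖) ^ 2 := by
  set S := ∑ i, ‖grad u x i‖ with hS
  have hS0 : 0 ≤ S := Finset.sum_nonneg fun _ _ => norm_nonneg _
  rw [qform_radial, ← real_inner_self_eq_norm_sq, ← inner_sub_left]
  have h1 : ‖scaledRadial g u x‖ ≤ n * (G * ‖x‖ * S) := norm_sum_smul_le (hB.inv_le x hx) _ _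
  have h2 : ‖fderiv ℝ u x x - scaledRadial g u x‖ ≤ n * (K * ‖x‖ * ‖x‖ * S) := by
    have h3 : scaledRadial g u x - fderiv ℝ u x x =
        ∑ i, ∑ j, (((g x)⁻¹ i j - (1 : Matrix (Fin n) (Fin n) ℝ) i j) * x i) • grad u x j := by
      simp only [sub_mul, sub_smul, Finset.sum_sub_distrib]
      rw [fderiv_apply_self_eq, scaledRadial]
      congr 1
      refine Finset.sum_congr rfl fun i _ => ?_
      simp [Matrix.one_apply]
    rw [norm_sub_rev, h3]
    exact norm_sum_smul_le
      (a := fun i j => (g x)⁻¹ i j - (1 : Matrix (Fin n) (Fin n) ℝ) i j) (hB.inv_sub_one x hx) _ _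
  calc _ ≤ ‖fderiv ℝ u x x - scaledRadial g u x‖ * ‖scaledRadial g u x‖ :=
        abs_real_inner_le_norm _ _
    _ ≤ (n * (K * ‖x‖ * ‖x‖ * S)) * (n * (G * ‖x‖ * S)) := by gcongr
    _ = _ := by ring

theorem densityAt_eq (ε : ℝ) (g : Rn n → Matrix (Fin n) (Fin n) ℝ) (u : Rn n → ℂ) (x : Rn n) :
    densityAt ε (Real.sqrt (g x).det • (g x)⁻¹) (Real.sqrt (g x).det) (grad u x) (u x) =
      energyDensity ε g u x * Real.sqrt (g x).det := by
  have h : gradSq g u x = qform (g x)⁻¹ (grad u x) (grad u x) := rfl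
  have h2 : potential ε u x = potentialAt ε (u x) := rfl
  rw [densityAt, qform_smul_matrix, energyDensity, h, h2]
  ring

theorem IsSolution.isWeakSolution {ε : ℝ} {g : Rn n → Matrix (Fin n) (Fin n) ℝ} {u : Rn n → ℂ}
    (hu : IsSolution ε g u) :
    IsWeakSolution ε (fun x => Real.sqrt (g x).det • (g x)⁻¹) (fun x => Real.sqrt (g x).det) u := by
  refine ⟨hu.contDiffOn, fun ζ h1 h2 h3 => ?_⟩
  rw [← hu.weak ζ h1 h2 h3, ballIntegral]
  refine integral_congr_ae (Filter.Eventually.of_forall fun x => ?_)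
  have h : gradPairing g u ζ x = qform (g x)⁻¹ (grad u x) (grad ζ x) := rfl
  simp only [qform_smul_matrix, h]
  ring

/-- Converts the Euclidean quantities in the error terms into the energy density of g. -/
theorem energyDensity_ge {K G c : ℝ}
    {g : Rn n → Matrix (Fin n) (Fin n) ℝ} (hB : MetricBounds K G c g) (ε : ℝ) (u : Rn n → ℂ)
    {x : Rn n} (hx : x ∈ ball (0 : Rn n) 1) :
    min c 1 * ((∑ i, ‖grad u x i‖) ^ 2 / 2 + potentialAt ε (u x)) ≤ energyDensity ε g u x := by
  have h1 : gradSq g u x = qform (g x)⁻¹ (grad u x) (grad u x) := rfl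
  have h2 : potential ε u x = potentialAt ε (u x) := rfl
  have h3 := hB.lower x hx (grad u x)
  have h4 := potentialAt_nonneg ε (u x)
  rw [energyDensity, h1, h2]
  have h5 : min c 1 * (∑ i, ‖grad u x i‖) ^ 2 ≤ c * (∑ i, ‖grad u x i‖) ^ 2 := by
    gcongr; exact min_le_left _ _
  have h6 : min c 1 * potentialAt ε (u x) ≤ 1 * potentialAt ε (u x) := by
    gcongr; exact min_le_right _ _
  linarith

theorem continuousOn_potential_mul {K G c : ℝ} {g : Rn n → Matrix (Fin n) (Fin n) ℝ}
    (hB : MetricBounds K G c g) {u : Rn n → ℂ} (hu : ContDiffOn ℝ 1 u (ball 0 1)) (ε : ℝ) :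
    ContinuousOn (fun x => potential ε u x * Real.sqrt (g x).det) (ball 0 1) :=
  ((continuous_potentialAt ε).comp_continuousOn hu.continuousOn).mul hB.coeff.continuousOn_weight

theorem continuousOn_energyDensity_mul {K G c : ℝ} {g : Rn n → Matrix (Fin n) (Fin n) ℝ}
    (hB : MetricBounds K G c g) {u : Rn n → ℂ} (hu : ContDiffOn ℝ 1 u (ball 0 1)) (ε : ℝ) :
    ContinuousOn (fun x => energyDensity ε g u x * Real.sqrt (g x).det) (ball 0 1) := by
  have hgc := continuousOn_grad hu
  refine ContinuousOn.congr (((continuousOn_qform hB.coeff.continuousOn hgc hgc).div_const 2).add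
    (continuousOn_potential_mul hB hu ε)) fun x _ => ?_
  rw [← densityAt_eq]; rfl

theorem continuousOn_scaledRadial_sq_mul {K G c : ℝ} {g : Rn n → Matrix (Fin n) (Fin n) ℝ}
    (hB : MetricBounds K G c g) {u : Rn n → ℂ} (hu : ContDiffOn ℝ 1 u (ball 0 1)) :
    ContinuousOn (fun x => ‖scaledRadial g u x‖ ^ 2 * Real.sqrt (g x).det) (ball 0 1) := by
  refine ContinuousOn.mul (ContinuousOn.pow (ContinuousOn.norm ?_) 2) hB.coeff.continuousOn_weight
  refine continuousOn_finsetSum _ fun i _ => continuousOn_finsetSum _ fun j _ => ?_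
  exact ((hB.inv_cont i j).mul (EuclideanSpace.proj (𝕜 := ℝ) i).continuous.continuousOn).smul
    ((continuous_apply j).comp_continuousOn (continuousOn_grad hu))

/-- The Pohozaev inequalities on Euclidean balls, with errors controlled by the energy. -/
theorem pohozaev (hn : n ≠ 0) {K G c ε : ℝ} (hK : 0 ≤ K) (hc : 0 < c) (hε : 0 < ε)
    {g : Rn n → Matrix (Fin n) (Fin n) ℝ} (hB : MetricBounds K G c g) {u : Rn n → ℂ}
    (hu : IsSolution ε g u) {ρ : ℝ} (hρ : ρ ∈ Set.Ioo (0 : ℝ) 1) {C : ℝ}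
    (hC : 2 * K * G * n ^ 2 / min c 1 + K / (c * min c 1) ≤ C) :
    (n - 2 - C * ρ) * ballIntegral g ρ (energyDensity ε g u) +
        2 * ballIntegral g ρ (potential ε u) +
        ρ * sphereIntegral g ρ (fun x => ‖radialDeriv g u x‖ ^ 2) ≤
      ρ * (1 + C * ρ) * sphereIntegral g ρ (energyDensity ε g u) ∧
    ρ * (1 - C * ρ) * sphereIntegral g ρ (energyDensity ε g u) ≤
      (n - 2 + C * ρ) * ballIntegral g ρ (energyDensity ε g u) +
        2 * ballIntegral g ρ (potential ε u) +
        ρ * sphereIntegral g ρ (fun x => ‖radialDeriv g u x‖ ^ 2) := by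
  set m := min c 1 with hm
  have hm0 : 0 < m := lt_min hc one_pos
  set w : Rn n → ℝ := fun x => Real.sqrt (g x).det with hw
  set A : Rn n → Matrix (Fin n) (Fin n) ℝ := fun x => w x • (g x)⁻¹ with hAdef
  have hA : IsCoefficient K A w := hB.coeff
  have hU : IsWeakSolution ε A w u := hu.isWeakSolution
  set e : Rn n → ℝ := fun x => energyDensity ε g u x * w x with he
  set v : Rn n → ℝ := fun x => potential ε u x * w x with hv
  set b : Rn n → ℝ := fun x => qform (A x) (fun i => x i • fderiv ℝ u x x) (grad u x) with hb
  set y : Rn n → ℝ := fun x => ‖scaledRadial g u x‖ ^ 2 * w x with hy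
  set f₂ : Rn n → ℝ := fun x =>
    ‖x‖ * K * ((∑ i, ‖grad u x i‖) ^ 2 / 2 + potentialAt ε (u x)) with hf₂
  have hdens : ∀ x, densityAt ε (A x) (w x) (grad u x) (u x) = e x := densityAt_eq ε g u
  have hgc := continuousOn_grad hu.contDiffOn
  have hAc : ∀ i j, ContinuousOn (fun x => A x i j) (ball 0 1) := hA.continuousOn
  have hwc : ContinuousOn w (ball 0 1) := hA.continuousOn_weight
  have hVc : ContinuousOn (fun x => potentialAt ε (u x)) (ball 0 1) :=
    (continuous_potentialAt ε).comp_continuousOn hu.contDiffOn.continuousOn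
  have hvc : ContinuousOn v (ball 0 1) := continuousOn_potential_mul hB hu.contDiffOn ε
  have hec : ContinuousOn e (ball 0 1) := continuousOn_energyDensity_mul hB hu.contDiffOn ε
  have hcoord : ∀ i, Continuous fun x : Rn n => x i := fun i =>
    (EuclideanSpace.proj (𝕜 := ℝ) i).continuous
  have hbc : ContinuousOn b (ball 0 1) :=
    continuousOn_qform hAc (continuousOn_pi.2 fun i => (hcoord i).continuousOn.smul
      ((continuousOn_fderiv_ball hu.contDiffOn).clm_apply continuousOn_id)) hgc
  have hyc : ContinuousOn y (ball 0 1) := continuousOn_scaledRadial_sq_mul hB hu.contDiffOn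
  have hf₂c : ContinuousOn f₂ (ball 0 1) :=
    (continuous_norm.mul continuous_const).continuousOn.mul
      (((continuousOn_finsetSum _ fun i _ =>
        ((continuous_apply i).comp_continuousOn hgc).norm).pow 2 |>.div_const 2).add hVc)
  have hsqc : ContinuousOn (fun x : Rn n => ‖x‖ ^ 2 * e x) (ball 0 1) :=
    (continuous_norm.pow 2).continuousOn.mul hec
  have hw0 : ∀ x ∈ ball (0 : Rn n) 1, 0 < w x := fun x hx => hc.trans_le (hB.sqrt_det x hx)
  have hS : ∀ x ∈ ball (0 : Rn n) 1,
      m * ((∑ i, ‖grad u x i‖) ^ 2 / 2 + potentialAt ε (u x)) ≤ energyDensity ε g u x :=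
    fun x hx => energyDensity_ge hB ε u hx
  have he0 : ∀ x ∈ ball (0 : Rn n) 1, 0 ≤ energyDensity ε g u x := by
    intro x hx
    refine le_trans ?_ (hS x hx)
    have := potentialAt_nonneg ε (u x)
    positivity
  have hsph : ∀ x : Rn n, ‖x‖ = ρ → x ∈ ball (0 : Rn n) 1 := fun x hx => by
    rw [mem_ball_zero_iff, hx]; exact hρ.2
  -- C₁ measures the boundary error from replacing x·∇u by the g-radial derivative, and C₂ the
  -- interior error from the oscillation of the coefficients.
  set C₁ := 2 * K * G * n ^ 2 / m with hC₁
  set C₂ := K / (c * m) with hC₂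
  have hbound : ∀ x : Rn n, ‖x‖ = ρ → |b x - y x| ≤ C₁ * ρ ^ 3 * e x := by
    intro x hx
    have hx1 := hsph x hx
    have h1 := abs_qform_radial_sub_le hK hB u hx1
    have h2 : b x - y x = w x * (qform (g x)⁻¹ (fun i => x i • fderiv ℝ u x x) (grad u x) -
        ‖scaledRadial g u x‖ ^ 2) := by
      simp only [hb, hy, hAdef, qform_smul_matrix]; ring
    have h3 : (∑ i, ‖grad u x i‖) ^ 2 ≤ 2 / m * energyDensity ε g u x := by
      have := hS x hx1
      have h4 := potentialAt_nonneg ε (u x)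
      rw [div_mul_eq_mul_div, le_div_iff₀ hm0]
      nlinarith
    have hG : 0 ≤ G := by
      obtain ⟨i⟩ : Nonempty (Fin n) := ⟨⟨0, Nat.pos_of_ne_zero hn⟩⟩
      exact (abs_nonneg _).trans (hB.inv_le x hx1 i i)
    rw [h2, abs_mul, abs_of_pos (hw0 x hx1)]
    rw [hx] at h1
    have := hw0 x hx1
    have hρ0 := hρ.1
    calc _ ≤ w x * (K * G * n ^ 2 * ρ ^ 3 * (2 / m * energyDensity ε g u x)) := by
          refine mul_le_mul_of_nonneg_left (h1.trans ?_) this.le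
          gcongr
      _ = C₁ * ρ ^ 3 * e x := by simp only [he, hC₁]; ring
  have hf₂le : ∀ x ∈ ball (0 : Rn n) ρ, f₂ x ≤ C₂ * ρ * e x := by
    intro x hx
    have hxρ : ‖x‖ < ρ := mem_ball_zero_iff.1 hx
    have hx1 : x ∈ ball (0 : Rn n) 1 := ball_subset_ball hρ.2.le hx
    have h1 : (∑ i, ‖grad u x i‖) ^ 2 / 2 + potentialAt ε (u x) ≤ energyDensity ε g u x / m := by
      rw [le_div_iff₀ hm0, mul_comm]; exact hS x hx1
    have h2 : energyDensity ε g u x ≤ e x / c := by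
      rw [le_div_iff₀ hc]
      exact mul_le_mul_of_nonneg_left (hB.sqrt_det x hx1) (he0 x hx1)
    have := potentialAt_nonneg ε (u x)
    have h3 := he0 x hx1
    have hρ0 := hρ.1
    calc f₂ x ≤ ρ * K * (energyDensity ε g u x / m) := by simp only [hf₂]; gcongr
      _ ≤ ρ * K * ((e x / c) / m) := by gcongr
      _ = C₂ * ρ * e x := by simp only [hC₂]; field_simp
  have hie := integrableOn_ball_of_continuousOn hec hρ.2
  have hiv := integrableOn_ball_of_continuousOn hvc hρ.2
  have hif₂ := integrableOn_ball_of_continuousOn hf₂c hρ.2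
  have hI₂ : ∫ x in ball (0 : Rn n) ρ, f₂ x ≤ C₂ * ρ * ∫ x in ball (0 : Rn n) ρ, e x := by
    rw [← integral_const_mul]
    exact setIntegral_mono_on hif₂ (hie.const_mul _) measurableSet_ball hf₂le
  -- The gradient term is twice the energy minus twice the potential. Subtracting n times the energy
  -- produces the coefficient 2 - n and the extra potential term of the formulas.
  have hq : ∀ x, qform (A x) (grad u x) (grad u x) = 2 * e x - 2 * v x := by
    intro x
    rw [← hdens, densityAt]
    simp only [hv]
    rw [show potential ε u x = potentialAt ε (u x) from rfl]
    ring
  have hI₀ : ∫ x in ball (0 : Rn n) ρ, ((2 - (n : ℝ)) * e x - 2 * v x) =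
      (2 - n) * (∫ x in ball (0 : Rn n) ρ, e x) - 2 * ∫ x in ball (0 : Rn n) ρ, v x := by
    rw [integral_sub (hie.const_mul _) (hiv.const_mul _), integral_const_mul, integral_const_mul]
  have hpoh := pohozaev_of_weakSolution hn hε hA hU hρ
    (f₀ := fun x => (2 - (n : ℝ)) * e x - 2 * v x) (f₁ := fun x => b x - ‖x‖ ^ 2 * e x) (f₂ := f₂)
    (fun x => by rw [hq, hdens]; ring) (fun x => by rw [hdens]) (fun x => rfl)
    ((hec.const_mul _).sub (hvc.const_mul _)) (hbc.sub hsqc) hf₂c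
  rw [hI₀] at hpoh
  have hf₁ : sphInt (fun x => b x - ‖x‖ ^ 2 * e x) ρ = sphInt b ρ - ρ ^ 2 * sphInt e ρ := by
    rw [← sphInt_radial_mul (fun s => s ^ 2) e ρ]
    exact integral_sub (integrableOn_sphere hn hbc hρ) (integrableOn_sphere hn hsqc hρ)
  have hJ : sphInt y ρ = ρ ^ 2 * sphereIntegral g ρ (fun x => ‖radialDeriv g u x‖ ^ 2) := by
    rw [sphereIntegral, ← integral_const_mul]
    refine setIntegral_congr_fun isClosed_sphere.measurableSet fun x hx => ?_
    have hx' : ‖x‖ = ρ := by simpa using hx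
    have hρ0 := hρ.1.ne'
    simp only [hy, hw, radialDeriv_eq, norm_smul, norm_inv, hx', Real.norm_of_nonneg hρ.1.le]
    field_simp
  have hup : sphInt b ρ ≤ sphInt y ρ + C₁ * ρ ^ 3 * sphInt e ρ := by
    rw [← sphInt_const_mul, ← sphInt_add hn hyc (hec.const_mul _) hρ]
    exact sphInt_mono hn hbc (hyc.add (hec.const_mul _)) hρ fun x hx => by
      simp only [Pi.add_apply]
      linarith [(abs_le.1 (hbound x hx)).2]
  have hlo : sphInt y ρ ≤ sphInt b ρ + C₁ * ρ ^ 3 * sphInt e ρ := by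
    rw [← sphInt_const_mul, ← sphInt_add hn hbc (hec.const_mul _) hρ]
    exact sphInt_mono hn hyc (hbc.add (hec.const_mul _)) hρ fun x hx => by
      simp only [Pi.add_apply]
      linarith [(abs_le.1 (hbound x hx)).1]
  have hE' : 0 ≤ sphInt e ρ := setIntegral_nonneg isClosed_sphere.measurableSet fun x hx => by
    have hx1 := hsph x (by simpa using hx)
    exact mul_nonneg (he0 x hx1) (hw0 x hx1).le
  have hE : 0 ≤ ∫ x in ball (0 : Rn n) ρ, e x := setIntegral_nonneg measurableSet_ball fun x hx => by
    have hx1 := ball_subset_ball hρ.2.le hx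
    exact mul_nonneg (he0 x hx1) (hw0 x hx1).le
  have hC₁0 : 0 ≤ C₁ := by
    have h0 : (0 : Rn n) ∈ ball (0 : Rn n) 1 := mem_ball_self one_pos
    obtain ⟨i⟩ : Nonempty (Fin n) := ⟨⟨0, Nat.pos_of_ne_zero hn⟩⟩
    have hG : 0 ≤ G := (abs_nonneg _).trans (hB.inv_le 0 h0 i i)
    positivity
  have hC₂0 : 0 ≤ C₂ := by positivity
  change (n - 2 - C * ρ) * (∫ x in ball (0 : Rn n) ρ, e x) + 2 * (∫ x in ball (0 : Rn n) ρ, v x) +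
      ρ * sphereIntegral g ρ (fun x => ‖radialDeriv g u x‖ ^ 2) ≤ ρ * (1 + C * ρ) * sphInt e ρ ∧
    ρ * (1 - C * ρ) * sphInt e ρ ≤ (n - 2 + C * ρ) * (∫ x in ball (0 : Rn n) ρ, e x) +
      2 * (∫ x in ball (0 : Rn n) ρ, v x) +
      ρ * sphereIntegral g ρ (fun x => ‖radialDeriv g u x‖ ^ 2)
  rw [hf₁] at hpoh
  rw [hJ] at hup hlo
  obtain ⟨h1, h2⟩ := hpoh
  set E' := sphInt e ρ
  set E := ∫ x in ball (0 : Rn n) ρ, e x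
  set P := ∫ x in ball (0 : Rn n) ρ, v x
  set J := sphereIntegral g ρ (fun x => ‖radialDeriv g u x‖ ^ 2)
  have hρ0 := hρ.1
  have hdivlo : ρ * J - C₁ * ρ ^ 2 * E' - ρ * E' ≤ (sphInt b ρ - ρ ^ 2 * E') / ρ := by
    rw [le_div_iff₀ hρ0]; linarith
  have hdivup : (sphInt b ρ - ρ ^ 2 * E') / ρ ≤ ρ * J + C₁ * ρ ^ 2 * E' - ρ * E' := by
    rw [div_le_iff₀ hρ0]; linarith
  -- The interior error involves only C₂ and the boundary error only C₁; nonnegativity of E and E'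
  -- allows both to be weakened to the common constant C ≥ C₁ + C₂.
  have hx1 : 0 ≤ C₂ * (ρ ^ 2 * E') := by positivity
  have hx2 : 0 ≤ C₁ * (ρ * E) := by positivity
  have hx3 : (C₁ + C₂) * (ρ * E) ≤ C * (ρ * E) := by gcongr
  have hx4 : (C₁ + C₂) * (ρ ^ 2 * E') ≤ C * (ρ ^ 2 * E') := by gcongr
  constructor <;> linarith

/-! ### The almost monotonicity formulas -/

theorem hasDerivAt_exp_mul_zpow_mul {χ ρ E' : ℝ} {E : ℝ → ℝ} (hρ : 0 < ρ)
    (hE : HasDerivAt E E' ρ) :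
    HasDerivAt (fun ρ => Real.exp (χ * ρ) * ρ ^ (2 - (n : ℤ)) * E ρ)
      (Real.exp (χ * ρ) * ρ ^ (1 - (n : ℤ)) * (ρ * E' + (χ * ρ + 2 - n) * E ρ)) ρ := by
  have h1 : HasDerivAt (fun ρ => Real.exp (χ * ρ)) (Real.exp (χ * ρ) * χ) ρ := by
    simpa using ((hasDerivAt_id ρ).const_mul χ).exp
  have h2 := hasDerivAt_zpow (2 - (n : ℤ)) ρ (Or.inl hρ.ne')
  refine ((h1.mul h2).mul hE).congr_deriv ?_
  have h3 : (2 - (n : ℤ)) - 1 = 1 - n := by ring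
  have h4 : ρ ^ (2 - (n : ℤ)) = ρ ^ (1 - (n : ℤ)) * ρ := by
    rw [← zpow_add_one₀ hρ.ne']; congr 1; ring
  simp only [Pi.mul_apply]
  rw [h3, h4]
  push_cast
  ring

theorem ballIntegral_nonneg (g : Rn n → Matrix (Fin n) (Fin n) ℝ) {ρ : ℝ} {f : Rn n → ℝ}
    (hf : ∀ x ∈ ball (0 : Rn n) ρ, 0 ≤ f x) : 0 ≤ ballIntegral g ρ f :=
  setIntegral_nonneg measurableSet_ball fun x hx => mul_nonneg (hf x hx) (Real.sqrt_nonneg _)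

theorem sphereIntegral_nonneg (g : Rn n → Matrix (Fin n) (Fin n) ℝ) {ρ : ℝ} {f : Rn n → ℝ}
    (hf : ∀ x, 0 ≤ f x) : 0 ≤ sphereIntegral g ρ f :=
  setIntegral_nonneg isClosed_sphere.measurableSet fun x _ =>
    mul_nonneg (hf x) (Real.sqrt_nonneg _)

theorem potential_eq (ε : ℝ) (u : Rn n → ℂ) (x : Rn n) :
    (1 - ‖u x‖ ^ 2) ^ 2 / (2 * ε ^ 2) = 2 * potential ε u x := by
  rw [potential, ← mul_div_assoc, show 4 * ε ^ 2 = 2 * (2 * ε ^ 2) by ring,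
    mul_div_mul_left _ _ two_ne_zero]

theorem potential_nonneg (ε : ℝ) (u : Rn n → ℂ) (x : Rn n) : 0 ≤ potential ε u x :=
  potentialAt_nonneg _ _

theorem ballIntegral_const_mul (g : Rn n → Matrix (Fin n) (Fin n) ℝ) (ρ c : ℝ) (f : Rn n → ℝ) :
    ballIntegral g ρ (fun x => c * f x) = c * ballIntegral g ρ f := by
  simp only [ballIntegral, mul_assoc, integral_const_mul]

theorem ballIntegral_energyDensity_nonneg {K G c : ℝ} (hc : 0 ≤ c)
    {g : Rn n → Matrix (Fin n) (Fin n) ℝ} (hB : MetricBounds K G c g) (ε : ℝ) (u : Rn n → ℂ)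
    {ρ : ℝ} (hρ : ρ ≤ 1) : 0 ≤ ballIntegral g ρ (energyDensity ε g u) := by
  refine ballIntegral_nonneg g fun x hx => le_trans ?_ (energyDensity_ge hB ε u
    (ball_subset_ball hρ hx))
  have := potentialAt_nonneg ε (u x)
  have : 0 ≤ min c 1 := le_min hc zero_le_one
  positivity

theorem hasDerivAt_ballIntegral (hn : n ≠ 0) {g : Rn n → Matrix (Fin n) (Fin n) ℝ} {f : Rn n → ℝ}
    (hf : ContinuousOn (fun x => f x * Real.sqrt (g x).det) (ball 0 1)) {ρ : ℝ}
    (hρ : ρ ∈ Set.Ioo (0 : ℝ) 1) :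
    HasDerivAt (fun ρ => ballIntegral g ρ f) (sphereIntegral g ρ f) ρ :=
  hasDerivAt_integral_ball hn hf hρ

theorem hasDerivAt_scaledEnergy (hn : n ≠ 0) {K G c : ℝ}
    {g : Rn n → Matrix (Fin n) (Fin n) ℝ} (hB : MetricBounds K G c g) {u : Rn n → ℂ}
    (hu : ContDiffOn ℝ 1 u (ball 0 1)) (χ ε : ℝ) {ρ : ℝ} (hρ : ρ ∈ Set.Ioo (0 : ℝ) 1) :
    HasDerivAt (scaledEnergy χ ε g u) (Real.exp (χ * ρ) * ρ ^ (1 - (n : ℤ)) *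
      (ρ * sphereIntegral g ρ (energyDensity ε g u) +
        (χ * ρ + 2 - n) * ballIntegral g ρ (energyDensity ε g u))) ρ :=
  hasDerivAt_exp_mul_zpow_mul hρ.1
    (hasDerivAt_ballIntegral hn (continuousOn_energyDensity_mul hB hu ε) hρ)

theorem modifiedScaledEnergy_eq {K G c : ℝ}
    {g : Rn n → Matrix (Fin n) (Fin n) ℝ} (hB : MetricBounds K G c g) {u : Rn n → ℂ}
    (hu : ContDiffOn ℝ 1 u (ball 0 1)) (χ C ε : ℝ) {ρ : ℝ} (hρ : ρ < 1) :
    modifiedScaledEnergy χ C ε g u ρ = scaledEnergy χ ε g u ρ + 2 / ((1 + C) * ((n : ℝ) - 2)) *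
      (Real.exp (χ * ρ) * ρ ^ (2 - (n : ℤ)) * ballIntegral g ρ (potential ε u)) := by
  have h1 : ballIntegral g ρ (fun x => gradSq g u x / 2 +
      (1 + 2 / ((1 + C) * ((n : ℝ) - 2))) * potential ε u x) =
      ballIntegral g ρ (energyDensity ε g u) +
        2 / ((1 + C) * ((n : ℝ) - 2)) * ballIntegral g ρ (potential ε u) := by
    rw [← ballIntegral_const_mul]
    simp only [ballIntegral]
    rw [← integral_add
      (integrableOn_ball_of_continuousOn (continuousOn_energyDensity_mul hB hu ε) hρ)]
    · refine integral_congr_ae (Filter.Eventually.of_forall fun x => ?_)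
      simp only [energyDensity]
      ring
    · simp only [mul_assoc]
      exact (integrableOn_ball_of_continuousOn (continuousOn_potential_mul hB hu ε) hρ).const_mul _
  rw [modifiedScaledEnergy, scaledEnergy, h1]
  ring

theorem sphereIntegral_potential_add (hn : n ≠ 0) {K G c : ℝ}
    {g : Rn n → Matrix (Fin n) (Fin n) ℝ} (hB : MetricBounds K G c g) {u : Rn n → ℂ}
    (hu : ContDiffOn ℝ 1 u (ball 0 1)) (ε a : ℝ) {ρ : ℝ} (hρ : ρ ∈ Set.Ioo (0 : ℝ) 1) :
    sphereIntegral g ρ (fun x => a * ((1 - ‖u x‖ ^ 2) ^ 2 / (2 * ε ^ 2)) +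
        ‖radialDeriv g u x‖ ^ 2) =
      a * (2 * sphereIntegral g ρ (potential ε u)) +
        sphereIntegral g ρ (fun x => ‖radialDeriv g u x‖ ^ 2) := by
  have h1 := integrableOn_sphere hn (continuousOn_potential_mul hB hu ε) hρ
  have h2 : IntegrableOn (fun x => ‖radialDeriv g u x‖ ^ 2 * Real.sqrt (g x).det) (sphere 0 ρ)
      (μHE[n - 1] : Measure (Rn n)) := by
    have h3 : IntegrableOn (fun x => (ρ ^ 2)⁻¹ * (‖scaledRadial g u x‖ ^ 2 * √(g x).det))
        (sphere 0 ρ) (μHE[n - 1] : Measure (Rn n)) :=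
      (integrableOn_sphere hn (continuousOn_scaledRadial_sq_mul hB hu) hρ).const_mul _
    refine h3.congr_fun (fun x hx => ?_) isClosed_sphere.measurableSet
    have hx' : ‖x‖ = ρ := by simpa using hx
    simp only [radialDeriv_eq, norm_smul, norm_inv, hx', Real.norm_of_nonneg hρ.1.le]
    rw [mul_pow, inv_pow, mul_assoc]
  simp only [sphereIntegral]
  rw [← mul_assoc, ← integral_const_mul, ← integral_add (h1.const_mul _) h2]
  refine integral_congr_ae (Filter.Eventually.of_forall fun x => ?_)
  simp only [potential_eq]
  ring

/-- The algebra of the lower bound for the derivative of the scaled energy. -/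
theorem scaled_lower {m C ρ E E' P J : ℝ} (hm : 1 ≤ m) (hC : 0 < C) (hρ : 0 < ρ) (hE : 0 ≤ E)
    (h : (m - C * ρ) * E + 2 * P + ρ * J ≤ ρ * (1 + C * ρ) * E') :
    1 / (1 + C * ρ) * (2 * P + ρ * J) ≤ ρ * E' + (C * (m + 1) * ρ - m) * E := by
  have h1 : 0 < 1 + C * ρ := by positivity
  rw [one_div, inv_mul_le_iff₀ h1]
  -- With χ = C(m + 1) the terms linear in ρ cancel exactly after multiplication by 1 + Cρ, and this
  -- quadratic term is all that remains.
  have h2 : 0 ≤ C * (C * (m + 1)) * ρ ^ 2 * E := by positivity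
  linarith

/-- The algebra of the upper bound for the derivative of the scaled energy. -/
theorem scaled_upper {m C ρ E E' P J : ℝ} (hm : 1 ≤ m) (hC : 0 < C) (hρ : 0 < ρ) (hE : 0 ≤ E)
    (hCρ : C * ρ ≤ 1 / 2)
    (h : ρ * (1 - C * ρ) * E' ≤ (m + C * ρ) * E + 2 * P + ρ * J) :
    ρ * E' + (-(2 * C * (m + 1)) * ρ - m) * E ≤ 1 / (1 - C * ρ) * (2 * P + ρ * J) := by
  have h1 : 0 < 1 - C * ρ := by linarith
  rw [one_div, ← div_eq_inv_mul, le_div_iff₀ h1]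
  -- Here χ' is twice as large, because after multiplication by 1 - Cρ the quadratic term has the
  -- unfavourable sign; for Cρ ≤ 1/2 the surplus linear term dominates it.
  have h2 : 0 ≤ (C * (m + 1) * ρ * E) * (1 - 2 * (C * ρ)) :=
    mul_nonneg (by positivity) (by linarith)
  linarith

/-- The algebra of the lower bound for the derivative of the modified scaled energy. -/
theorem modified_lower {m C χ ρ P P' J D : ℝ} (hm : 1 ≤ m) (hC : 0 < C) (hχ : 0 ≤ χ) (hρ : 0 < ρ)
    (hρ1 : ρ ≤ 1) (hP : 0 ≤ P) (hJ : 0 ≤ J)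
    (h : 1 / (1 + C * ρ) * (2 * P + ρ * J) ≤ D) :
    1 / (1 + C) * (ρ * (1 / m * (2 * P') + J)) ≤
      D + 2 / ((1 + C) * m) * (ρ * P' + (χ * ρ - m) * P) := by
  have hm0 : 0 < m := by linarith
  have h1 : 1 / (1 + C) * (2 * P + ρ * J) ≤ 1 / (1 + C * ρ) * (2 * P + ρ * J) := by
    gcongr
    exact mul_le_of_le_one_right hC.le hρ1
  -- The added multiple of the potential is chosen so that differentiating ρ^(-m) produces -2P/(1 +
  -- C). This cancels the interior potential of the first formula and leaves a pure boundary term.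
  have h2 : 2 / ((1 + C) * m) * (ρ * P' + (χ * ρ - m) * P) =
      1 / (1 + C) * (ρ * (1 / m * (2 * P')) - 2 * P) + 2 / ((1 + C) * m) * (χ * ρ * P) := by
    field_simp
    ring
  have h3 : 0 ≤ 2 / ((1 + C) * m) * (χ * ρ * P) := by positivity
  rw [h2]
  linarith

end GinzburgLandau

end

/-! ### Choice of constants and conclusion -/

theorem mainTheorem7 (n : ℕ) (hn : 3 ≤ n) (lam Lam : ℝ) (hlam : 0 < lam) (hLam : 0 < Lam) :
    (∃ χ C : ℝ, 0 < χ ∧ 0 < C ∧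
      ∀ (g : GinzburgLandau.Rn n → Matrix (Fin n) (Fin n) ℝ) (ε : ℝ)
        (u : GinzburgLandau.Rn n → ℂ),
        GinzburgLandau.IsLipschitzMetric lam Lam g → 0 < ε → GinzburgLandau.IsSolution ε g u →
        MonotoneOn (GinzburgLandau.scaledEnergy χ ε g u) (Set.Ioo 0 1) ∧
        ∀ ρ ∈ Set.Ioo (0 : ℝ) 1,
          (DifferentiableAt ℝ (GinzburgLandau.scaledEnergy χ ε g u) ρ ∧
            1 / (1 + C * ρ) *
              (Real.exp (χ * ρ) * ρ ^ (1 - (n : ℤ)) *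
                  GinzburgLandau.ballIntegral g ρ
                    (fun x => (1 - ‖u x‖ ^ 2) ^ 2 / (2 * ε ^ 2)) +
                Real.exp (χ * ρ) * ρ ^ (2 - (n : ℤ)) *
                  GinzburgLandau.sphereIntegral g ρ
                    (fun x => ‖GinzburgLandau.radialDeriv g u x‖ ^ 2)) ≤
              deriv (GinzburgLandau.scaledEnergy χ ε g u) ρ) ∧
          (DifferentiableAt ℝ (GinzburgLandau.modifiedScaledEnergy χ C ε g u) ρ ∧
            1 / (1 + C) * (Real.exp (χ * ρ) * ρ ^ (2 - (n : ℤ)) *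
                GinzburgLandau.sphereIntegral g ρ
                  (fun x => 1 / ((n : ℝ) - 2) * ((1 - ‖u x‖ ^ 2) ^ 2 / (2 * ε ^ 2)) +
                    ‖GinzburgLandau.radialDeriv g u x‖ ^ 2)) ≤
              deriv (GinzburgLandau.modifiedScaledEnergy χ C ε g u) ρ)) ∧
    (∃ χ' C ρ₀ : ℝ, 0 < χ' ∧ 0 < C ∧ 0 < ρ₀ ∧ ρ₀ ≤ 1 ∧ C * ρ₀ < 1 ∧
      ∀ (g : GinzburgLandau.Rn n → Matrix (Fin n) (Fin n) ℝ) (ε : ℝ)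
        (u : GinzburgLandau.Rn n → ℂ),
        GinzburgLandau.IsLipschitzMetric lam Lam g → 0 < ε → GinzburgLandau.IsSolution ε g u →
        ∀ ρ ∈ Set.Ioo (0 : ℝ) ρ₀,
          DifferentiableAt ℝ (GinzburgLandau.scaledEnergy (-χ') ε g u) ρ ∧
            deriv (GinzburgLandau.scaledEnergy (-χ') ε g u) ρ ≤
              1 / (1 - C * ρ) *
                (Real.exp (-χ' * ρ) * ρ ^ (1 - (n : ℤ)) *
                    GinzburgLandau.ballIntegral g ρ
                      (fun x => (1 - ‖u x‖ ^ 2) ^ 2 / (2 * ε ^ 2)) +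
                  Real.exp (-χ' * ρ) * ρ ^ (2 - (n : ℤ)) *
                    GinzburgLandau.sphereIntegral g ρ
                      (fun x => ‖GinzburgLandau.radialDeriv g u x‖ ^ 2))) := by
  have hn0 : n ≠ 0 := by omega
  obtain ⟨K, G, c, hK, hG, hc, hbounds⟩ :=
    GinzburgLandau.exists_metricBounds hn0 hlam hLam.le
  -- The summand 1 makes C strictly positive even when K = 0.
  set C : ℝ := 2 * K * G * n ^ 2 / min c 1 + K / (c * min c 1) + 1 with hCdef
  have hmin : 0 < min c 1 := lt_min hc one_pos
  have hC : 0 < C := by positivity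
  set m : ℝ := (n : ℝ) - 2 with hm
  have hm1 : 1 ≤ m := by
    have : (3 : ℝ) ≤ n := by exact_mod_cast hn
    linarith
  have hzpow : ∀ ρ : ℝ, 0 < ρ → ρ ^ (2 - (n : ℤ)) = ρ ^ (1 - (n : ℤ)) * ρ := fun ρ hρ => by
    rw [← zpow_add_one₀ hρ.ne']; congr 1; ring
  -- The exponents are those of `scaled_lower` and `scaled_upper`; the radius min 1 (1/(2C))
  -- guarantees Cρ ≤ 1/2, as the upper bound requires.
  refine ⟨⟨C * (m + 1), C, by positivity, hC, fun g ε u hg hε hu => ?_⟩,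
    ⟨2 * C * (m + 1), C, min 1 (1 / (2 * C)), by positivity, hC, by positivity, min_le_left _ _,
      ?_, fun g ε u hg hε hu ρ hρ => ?_⟩⟩
  · have hB := hbounds g hg
    have hfirst : ∀ ρ ∈ Set.Ioo (0 : ℝ) 1,
        1 / (1 + C * ρ) * (2 * GinzburgLandau.ballIntegral g ρ (GinzburgLandau.potential ε u) +
          ρ * GinzburgLandau.sphereIntegral g ρ
            (fun x => ‖GinzburgLandau.radialDeriv g u x‖ ^ 2)) ≤
        ρ * GinzburgLandau.sphereIntegral g ρ (GinzburgLandau.energyDensity ε g u) +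
          (C * (m + 1) * ρ + 2 - n) *
            GinzburgLandau.ballIntegral g ρ (GinzburgLandau.energyDensity ε g u) := by
      intro ρ hρ
      have h1 := GinzburgLandau.scaled_lower hm1 hC hρ.1
        (GinzburgLandau.ballIntegral_energyDensity_nonneg hc.le hB ε u hρ.2.le)
        (GinzburgLandau.pohozaev hn0 hK hc hε hB hu hρ (C := C) (by linarith)).1
      have e : C * (m + 1) * ρ + 2 - n = C * (m + 1) * ρ - m := by rw [hm]; ring
      rw [e]
      exact h1
    have hP : ∀ ρ, 0 ≤ GinzburgLandau.ballIntegral g ρ (GinzburgLandau.potential ε u) :=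
      fun ρ => GinzburgLandau.ballIntegral_nonneg g fun x _ => GinzburgLandau.potential_nonneg ε u x
    have hJ : ∀ ρ, 0 ≤ GinzburgLandau.sphereIntegral g ρ
        (fun x => ‖GinzburgLandau.radialDeriv g u x‖ ^ 2) :=
      fun ρ => GinzburgLandau.sphereIntegral_nonneg g fun x => by positivity
    have hder := fun ρ (hρ : ρ ∈ Set.Ioo (0 : ℝ) 1) =>
      GinzburgLandau.hasDerivAt_scaledEnergy hn0 hB hu.contDiffOn (C * (m + 1)) ε hρ
    refine ⟨monotoneOn_of_deriv_nonneg (convex_Ioo 0 1)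
      (fun ρ hρ => (hder ρ hρ).continuousAt.continuousWithinAt)
      (fun ρ hρ => ?_) (fun ρ hρ => ?_), fun ρ hρ => ⟨⟨(hder ρ hρ).differentiableAt, ?_⟩, ?_⟩⟩
    · rw [interior_Ioo] at hρ
      exact (hder ρ hρ).differentiableAt.differentiableWithinAt
    · rw [interior_Ioo] at hρ
      rw [(hder ρ hρ).deriv]
      have hρ0 := hρ.1
      -- Monotonicity follows from the derivative bound, whose lower side is a sum of nonnegative
      -- terms.
      refine mul_nonneg (by positivity) (le_trans ?_ (hfirst ρ hρ))
      have := hP ρ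
      have := hJ ρ
      positivity
    · have hρ0 := hρ.1
      rw [(hder ρ hρ).deriv, hzpow ρ hρ.1]
      simp only [GinzburgLandau.potential_eq, GinzburgLandau.ballIntegral_const_mul]
      refine Eq.trans_le ?_ (mul_le_mul_of_nonneg_left (hfirst ρ hρ)
        (by positivity : 0 ≤ Real.exp (C * (m + 1) * ρ) * ρ ^ (1 - (n : ℤ))))
      ring
    · have hρ0 := hρ.1
      -- Splitting the integral requires integrability, available for radii below 1; equality near ρ
      -- suffices for the derivative.
      have heq : GinzburgLandau.modifiedScaledEnergy (C * (m + 1)) C ε g u =ᶠ[nhds ρ]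
          fun ρ => GinzburgLandau.scaledEnergy (C * (m + 1)) ε g u ρ + 2 / ((1 + C) * m) *
            (Real.exp (C * (m + 1) * ρ) * ρ ^ (2 - (n : ℤ)) *
              GinzburgLandau.ballIntegral g ρ (GinzburgLandau.potential ε u)) := by
        filter_upwards [Iio_mem_nhds hρ.2] with r hr
        exact GinzburgLandau.modifiedScaledEnergy_eq hB hu.contDiffOn _ C ε hr
      have hmod := ((hder ρ hρ).add ((GinzburgLandau.hasDerivAt_exp_mul_zpow_mul
        (n := n) (χ := C * (m + 1)) hρ0 (GinzburgLandau.hasDerivAt_ballIntegral hn0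
          (GinzburgLandau.continuousOn_potential_mul hB hu.contDiffOn ε) hρ)).const_mul
            (2 / ((1 + C) * m)))).congr_of_eventuallyEq heq
      refine ⟨hmod.differentiableAt, ?_⟩
      rw [hmod.deriv, hzpow ρ hρ0,
        GinzburgLandau.sphereIntegral_potential_add hn0 hB hu.contDiffOn ε _ hρ]
      have h1 := mul_le_mul_of_nonneg_left
        (GinzburgLandau.modified_lower hm1 hC (χ := C * (m + 1)) (by positivity) hρ0 hρ.2.le
          (hP ρ) (hJ ρ)
          (P' := GinzburgLandau.sphereIntegral g ρ (GinzburgLandau.potential ε u)) (hfirst ρ hρ))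
        (by positivity : 0 ≤ Real.exp (C * (m + 1) * ρ) * ρ ^ (1 - (n : ℤ)))
      have e : C * (m + 1) * ρ - m = C * (m + 1) * ρ + 2 - n := by rw [hm]; ring
      rw [e] at h1
      refine Eq.trans_le ?_ (h1.trans_eq ?_) <;> ring
  · have h1 : C * min 1 (1 / (2 * C)) ≤ C * (1 / (2 * C)) :=
      mul_le_mul_of_nonneg_left (min_le_right _ _) hC.le
    have h2 : C * (1 / (2 * C)) = 1 / 2 := by field_simp
    linarith
  · have hB := hbounds g hg
    have hρ0 := hρ.1
    have hρ1 : ρ ∈ Set.Ioo (0 : ℝ) 1 := ⟨hρ.1, hρ.2.trans_le (min_le_left _ _)⟩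
    have hCρ : C * ρ ≤ 1 / 2 := by
      have h1 : C * ρ ≤ C * (1 / (2 * C)) :=
        mul_le_mul_of_nonneg_left (hρ.2.le.trans (min_le_right _ _)) hC.le
      have h2 : C * (1 / (2 * C)) = 1 / 2 := by field_simp
      linarith
    have hder := GinzburgLandau.hasDerivAt_scaledEnergy hn0 hB hu.contDiffOn
      (-(2 * C * (m + 1))) ε hρ1
    refine ⟨hder.differentiableAt, ?_⟩
    rw [hder.deriv, hzpow ρ hρ0]
    simp only [GinzburgLandau.potential_eq, GinzburgLandau.ballIntegral_const_mul]
    have h1 := GinzburgLandau.scaled_upper hm1 hC hρ0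
      (GinzburgLandau.ballIntegral_energyDensity_nonneg hc.le hB ε u hρ1.2.le) hCρ
      (GinzburgLandau.pohozaev hn0 hK hc hε hB hu hρ1 (C := C) (by linarith)).2
    have e : -(2 * C * (m + 1)) * ρ - m = -(2 * C * (m + 1)) * ρ + 2 - n := by rw [hm]; ring
    rw [e] at h1
    refine (mul_le_mul_of_nonneg_left h1
      (by positivity : 0 ≤ Real.exp (-(2 * C * (m + 1)) * ρ) * ρ ^ (1 - (n : ℤ)))).trans_eq ?_
    ring
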